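/- Let $V$ be a real vector space of finite dimension $n\ge 2$ with a volume form $\Omega\neq 0$. Let $\mathrm{vol}$ be the corresponding Lebesgue measure on $V$, $\mathrm{vol}^*$ the dual Lebesgue measure on $V^*$ (if $\mathrm{vol}$ gives measure $1$ to the parallelepiped of a basis, then $\mathrm{vol}^*$ gives measure $1$ to the parallelepiped of the dual basis), and $\mathrm{svol}=\mathrm{vol}\times\mathrm{vol}^*$ the symplectic volume on $V\times V^*$. Let $\mathcal K(V)$ be the set of compact convex bodies (non-empty compact convex subsets) of $V$. For $K\in\mathcal K(V)$ the projection body $\Pi K\subset V^*$ is the convex body with support function $h(\Pi K,v)=\mathrm{vol}(\pi_vK,i_v\Omega)$ for $v\in V\setminus\{0\}$, where $\pi_v:V\to V/\mathbb R v$ is the quotient map and $i_v\Omega=\Omega(v,\cdot)$ is regarded as a volume form on $V/\mathbb R v$. Let $V_1(L,B)=V(L,\dots,L,B)$ denote the mixed volume with $n-1$ entries $L$ and one entry $B$, and $\omega_k$ the volume of the Euclidean unit ball of $\mathbb R^k$. For a unit ball $B$ in $V$ (a centrally symmetric compact convex body with non-empty interior) put $$\mathcal V(B)=\frac{\omega_n^{\,n-1}}{\omega_{n-1}^{\,n}}\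 \sup\{\mathrm{svol}(B\times\Pi L) : L\in\mathcal K(V),\ V_1(L,B)=1\},$$ and let $\mathcal V^b(B)=\omega_n$ be the affine invariant associated with the Busemann definition of volume. Proposition. The following two assertions are equivalent: (a) $\mathcal V(B)\ge\mathcal V^b(B)=\omega_n$ for all unit balls $B$ in $V$. (b) (Petty's conjectured projection inequality) For every compact convex body $K\subset V$ with non-empty interior and every ellipsoid $E\subset V$ (with any centre), $$\mathrm{vol}^*(\Pi K)\,\mathrm{vol}(K)^{1-n}\ \ge\ \mathrm{vol}^*(\Pi E)\,\mathrm{vol}(E)^{1-n}.$$ -/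

import Mathlib

open Module MeasureTheory
open scoped ENNReal Pointwise

noncomputable section

namespace ConvexVolume

/-- `ω_k`, the Lebesgue volume of the Euclidean unit ball of `ℝ^k`. -/
def ballVolume (k : ℕ) : ℝ≥0∞ :=
  volume (Metric.closedBall (0 : EuclideanSpace ℝ (Fin k)) 1)

section Quotient

variable {V : Type*} [AddCommGroup V] [Module ℝ V] {m : ℕ}

/-- A linear section of the quotient map `V → V / ℝ v`. -/
def quotSection (v : V) : (V ⧸ Submodule.span ℝ {v}) →ₗ[ℝ] V :=
  Classical.choose ((Submodule.span ℝ {v}).mkQ.exists_rightInverse_of_surjective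
    (Submodule.range_mkQ _))

theorem mkQ_quotSection (v : V) (y : V ⧸ Submodule.span ℝ {v}) :
    (Submodule.span ℝ {v}).mkQ (quotSection v y) = y :=
  LinearMap.congr_fun (Classical.choose_spec
    ((Submodule.span ℝ {v}).mkQ.exists_rightInverse_of_surjective (Submodule.range_mkQ _))) y

/-- The form `i_v Ω = Ω(v, ·)`, regarded as a form of top degree on the quotient `V / ℝ v`.
It does not depend on the section used here, see `contraction_mkQ`. -/
def contraction (Ω : V [⋀^Fin (m + 1)]→ₗ[ℝ] ℝ) (v : V) :
    (V ⧸ Submodule.span ℝ {v}) [⋀^Fin m]→ₗ[ℝ] ℝ :=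
  (Ω.curryLeft v).compLinearMap (quotSection v)

/-- The pullback of `contraction Ω v` to `V` is `Ω(v, ·)`. -/
theorem contraction_mkQ (Ω : V [⋀^Fin (m + 1)]→ₗ[ℝ] ℝ) (v : V) (w : Fin m → V) :
    contraction Ω v (fun i => (Submodule.span ℝ {v}).mkQ (w i)) = Ω (Fin.cons v w) := by
  have h : ∀ i, ∃ c : ℝ, quotSection v ((Submodule.span ℝ {v}).mkQ (w i)) = w i + c • v := by
    intro i
    have h1 : (Submodule.span ℝ {v}).mkQ
        (quotSection v ((Submodule.span ℝ {v}).mkQ (w i)) - w i) = 0 := by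
      rw [map_sub, mkQ_quotSection, sub_self]
    rw [← LinearMap.mem_ker, Submodule.ker_mkQ, Submodule.mem_span_singleton] at h1
    obtain ⟨c, hc⟩ := h1
    exact ⟨c, by rw [hc]; abel⟩
  choose c hc using h
  have hfun : (fun i => quotSection v ((Submodule.span ℝ {v}).mkQ (w i)))
      = w + fun i => c i • v := funext hc
  have key : (Ω.curryLeft v).toMultilinearMap (w + fun i => c i • v)
      = (Ω.curryLeft v).toMultilinearMap w := by
    rw [MultilinearMap.map_add_univ, Finset.sum_eq_single Finset.univ]
    · simp
    · intro s _ hs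
      obtain ⟨i, hi⟩ : ∃ i, i ∉ s := by
        by_contra hcon
        push Not at hcon
        exact hs (Finset.eq_univ_iff_forall.mpr hcon)
      have hsp : s.piecewise w (fun i => c i • v)
          = Function.update (s.piecewise w (fun i => c i • v)) i (c i • v) := by
        rw [eq_comm, Function.update_eq_self_iff, Finset.piecewise_eq_of_notMem _ _ _ hi]
      rw [hsp, MultilinearMap.map_update_smul]
      have h0 : (Ω.curryLeft v).toMultilinearMap
          (Function.update (s.piecewise w (fun i => c i • v)) i v) = 0 := by
        change Ω (Matrix.vecCons v
          (Function.update (s.piecewise w (fun i => c i • v)) i v)) = 0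
        refine Ω.map_eq_zero_of_eq _ (i := 0) (j := i.succ) ?_ (Fin.succ_ne_zero i).symm
        simp
      rw [h0, smul_zero]
    · simp
  change (Ω.curryLeft v).toMultilinearMap
    (fun i => quotSection v ((Submodule.span ℝ {v}).mkQ (w i))) = _
  rw [hfun, key]
  rfl

end Quotient

variable {V : Type*} [NormedAddCommGroup V] [NormedSpace ℝ V] [FiniteDimensional ℝ V]
  {m : ℕ}

/-- The basis of `V*` dual to a basis of `V`. -/
def dualBasis (b : Basis (Fin (m + 1)) ℝ V) : Basis (Fin (m + 1)) ℝ (StrongDual ℝ V) :=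
  b.dualBasis.map LinearMap.toContinuousLinearMap

theorem dualBasis_apply (b : Basis (Fin (m + 1)) ℝ V) (i : Fin (m + 1)) (x : V) :
    dualBasis b i x = b.repr x i := by
  simp [dualBasis]

variable [hV : Fact (finrank ℝ V = m + 1)]

instance fact_finrank_dual : Fact (finrank ℝ (StrongDual ℝ V) = m + 1) :=
  ⟨by rw [finrank_eq_card_basis (dualBasis (finBasisOfFinrankEq ℝ V hV.out)), Fintype.card_fin]⟩

/-- The volume form `Ω*` on `V*` dual to the volume form `Ω` on `V`: it takes the value
`1 / Ω(b)` on the dual of a basis `b`, for every `b`, see `dualForm_dualBasis`. -/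
def dualForm (Ω : V [⋀^Fin (m + 1)]→ₗ[ℝ] ℝ) : (StrongDual ℝ V) [⋀^Fin (m + 1)]→ₗ[ℝ] ℝ :=
  (Ω (finBasisOfFinrankEq ℝ V hV.out))⁻¹ •
    (dualBasis (finBasisOfFinrankEq ℝ V hV.out)).det

theorem dualForm_dualBasis (Ω : V [⋀^Fin (m + 1)]→ₗ[ℝ] ℝ) (b : Basis (Fin (m + 1)) ℝ V) :
    dualForm Ω (dualBasis b) = (Ω b)⁻¹ := by
  set e := finBasisOfFinrankEq ℝ V hV.out with he
  have h1 : Ω b = Ω e * e.det b := by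
    conv_lhs => rw [Ω.eq_smul_basis_det e]
    simp
  have h2 : (dualBasis e).toMatrix (dualBasis b) = (b.toMatrix e).transpose := by
    ext i j
    have h3 : dualBasis b j = ∑ k, dualBasis b j (e k) • dualBasis e k := by
      ext x
      have hx : dualBasis b j x = dualBasis b j (∑ k, e.repr x k • e k) := by rw [e.sum_repr]
      rw [hx, map_sum]
      simp [dualBasis_apply, mul_comm]
    rw [Basis.toMatrix_apply, h3]
    simp [Finsupp.single_apply, dualBasis_apply, Basis.toMatrix_apply]
  have h4 : (dualBasis e).det (dualBasis b) * e.det b = 1 := by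
    rw [Basis.det_apply, Basis.det_apply, h2, Matrix.det_transpose, ← Matrix.det_mul,
      Basis.toMatrix_mul_toMatrix_flip, Matrix.det_one]
  rw [h1, mul_inv, ← eq_inv_of_mul_eq_one_left h4]
  simp [dualForm, ← he]

variable [MeasurableSpace V] [BorelSpace V]

/-- `vol (π_v K, i_v Ω)`: the volume of the image of `K` in `V / ℝ v`, for `v ≠ 0`. -/
def shadowVolume (Ω : V [⋀^Fin (m + 1)]→ₗ[ℝ] ℝ) (K : Set V) (v : V) (hv : v ≠ 0) : ℝ≥0∞ :=
  letI : MeasurableSpace (V ⧸ Submodule.span ℝ {v}) := borel _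
  haveI : BorelSpace (V ⧸ Submodule.span ℝ {v}) := ⟨rfl⟩
  haveI : IsClosed ((Submodule.span ℝ {v} : Submodule ℝ V) : Set V) :=
    Submodule.closed_of_finiteDimensional _
  haveI : Fact (finrank ℝ (V ⧸ Submodule.span ℝ {v}) = m) := ⟨by
    have h1 := (Submodule.span ℝ {v}).finrank_quotient_add_finrank
    rw [finrank_span_singleton hv, hV.out] at h1
    omega⟩
  (contraction Ω v).measure ((Submodule.span ℝ {v}).mkQ '' K)

/-- The projection body `Π K ⊆ V*`: the convex body with support function
`h(Π K, v) = vol (π_v K, i_v Ω)` for `v ≠ 0`. -/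
def projectionBody (Ω : V [⋀^Fin (m + 1)]→ₗ[ℝ] ℝ) (K : Set V) : Set (StrongDual ℝ V) :=
  {ξ | ∀ (v : V) (hv : v ≠ 0), ξ v ≤ (shadowVolume Ω K v hv).toReal}

/-- The mixed volume `V(K_1, …, K_n)`, `n = dim V = m + 1`, associated with the Lebesgue measure
of `Ω`, that is, the polarization of the volume with respect to Minkowski addition:
`V(K_1, …, K_n) = (1 / n!) ∑_{J ⊆ {1, …, n}} (-1) ^ (n - |J|) vol (∑_{j ∈ J} K_j)`. -/
def mixedVolume (Ω : V [⋀^Fin (m + 1)]→ₗ[ℝ] ℝ) (K : Fin (m + 1) → Set V) : ℝ :=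
  ((m + 1).factorial : ℝ)⁻¹ * ∑ J : Finset (Fin (m + 1)),
    (-1 : ℝ) ^ (m + 1 - J.card) * (Ω.measure (∑ j ∈ J, K j)).toReal

/-- `V_i(K, L) = V(K, …, K, L, …, L)`, with `n - i` entries `K` followed by `i` entries `L`. -/
def mixedVolumePair (Ω : V [⋀^Fin (m + 1)]→ₗ[ℝ] ℝ) (i : ℕ) (K L : Set V) : ℝ :=
  mixedVolume Ω (fun j => if (j : ℕ) < m + 1 - i then K else L)

/-- The symplectic volume `svol = vol × vol*` on `V × V*`. -/
def symplecticVolume (Ω : V [⋀^Fin (m + 1)]→ₗ[ℝ] ℝ) : Measure (V × StrongDual ℝ V) :=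
  Ω.measure.prod (dualForm Ω).measure

/-- `B` is the unit ball of a norm: a centrally symmetric convex body with interior points. -/
def IsUnitBall (B : ConvexBody V) : Prop :=
  (∀ x ∈ B, -x ∈ B) ∧ (interior (B : Set V)).Nonempty

/-- The functional `𝒱(B) = ω_n^(n-1) / ω_(n-1)^n * sup {svol (B × Π L) | V_1(L, B) = 1}`, where
`n = dim V = m + 1` and `L` ranges over all convex bodies in `V`; the supremum is taken in
`[0, ∞]`. -/
def volumeInvariant (Ω : V [⋀^Fin (m + 1)]→ₗ[ℝ] ℝ) (B : ConvexBody V) : ℝ≥0∞ :=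
  ballVolume (m + 1) ^ m / ballVolume m ^ (m + 1) *
    ⨆ (L : ConvexBody V) (_ : mixedVolumePair Ω 1 L B = 1),
      symplecticVolume Ω ((B : Set V) ×ˢ projectionBody Ω L)

/-- The affine invariant `𝒱ᵇ(B) = ω_n`, `n = dim V`, of the Busemann definition of volume. -/
def busemannInvariant (_B : ConvexBody V) : ℝ≥0∞ := ballVolume (finrank ℝ V)

/-- `E` is an ellipsoid (with any centre): an affine image of the Euclidean unit ball. -/
def IsEllipsoid (E : ConvexBody V) : Prop :=
  ∃ (f : EuclideanSpace ℝ (Fin (finrank ℝ V)) ≃ₗ[ℝ] V) (c : V),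
    (E : Set V) = (fun x => c + f x) '' Metric.closedBall 0 1

/-- Petty's conjectured projection inequality
`vol (Π K) vol (K)^(1-n) ≥ vol (Π E) vol (E)^(1-n)`, `n = dim V = m + 1`, for all convex bodies
`K` with interior points and all ellipsoids `E` in `V`. -/
def PettyProjectionInequality (Ω : V [⋀^Fin (m + 1)]→ₗ[ℝ] ℝ) : Prop :=
  ∀ K E : ConvexBody V, (interior (K : Set V)).Nonempty → IsEllipsoid E →
    (dualForm Ω).measure (projectionBody Ω E) * Ω.measure (E : Set V) ^ (1 - ((m + 1 : ℕ) : ℤ)) ≤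
      (dualForm Ω).measure (projectionBody Ω K) * Ω.measure (K : Set V) ^ (1 - ((m + 1 : ℕ) : ℤ))

end ConvexVolume

end

/-! Write n = m + 1 and ε = `ellipsoidValue m`. Every ellipsoid E gives vol*(ΠE) vol(E)^(1-n) = ε,
and the normalising constant in 𝒱 times ε equals ω_n. So (a) says that, for every unit ball B, the
supremum of vol(B) vol*(ΠL) over V₁(L, B) = 1 is at least ε, and (b) says that vol*(ΠK) ≥ ε
vol(K)^(n-1) for every K with interior.

(b) ⇒ (a): the multiple L = cB with V₁(L, B) = 1 is already good enough, by (b) applied to L.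

(a) ⇒ (b): let M = ΠK and let B = ΠM, regarded as a body in V. Two facts are used: Minkowski's first
inequality V₁(L, C)^n ≥ vol(L)^(n-1) vol(C), and the symmetry V₁(L, ΠM) = V₁(M, ΠL). If V₁(L, B) = 1
then V₁(M, ΠL) = 1, so vol*(M)^(n-1) vol*(ΠL) ≤ 1, and (a) yields ε vol*(M)^(n-1) ≤ vol(B). On the
other hand V₁(K, B) = V₁(M, M) = vol*(M), so vol(K)^(n-1) vol(B) ≤ vol*(M)^n. Combining the two and
cancelling vol*(M)^(n-1) gives (b).

Mixed volumes are defined here by polarization, so they become usable only once vol(∑ tᵢKᵢ) is known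
to be a homogeneous polynomial in t. For polytopes conv(Sᵢ), the gradient of ∑ tᵢ log ∑_{p ∈ Sᵢ}
e^⟨p, x⟩ is injective with image the Minkowski combination up to its boundary. The volume is
therefore the integral over x of the determinant of a combination of Hessians, a form in t for each
x. General bodies follow by approximation.

Consequently n V₁(L, B) is the right derivative of vol(L + tB) at 0
(`hasDerivWithinAt_measure_add_smul`), which makes V₁(L, ·) additive, homogeneous and monotone.
Brunn–Minkowski, obtained from Prékopa–Leindler, then gives Minkowski's inequality. Hahn–Banach and
Riesz give a measure S_L with V₁(L, C) = ∫ h_C dS_L. Since vol(L + t[0, v]) = vol(L) + t vol(π_v L),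
the support function of ΠL is n V₁(L, [0, v]) = n ∫ max(0, ξ(v)) dS_L(ξ), and the symmetry is
Fubini's theorem. -/

noncomputable section

namespace ConvexVolume

/-! ### The Prékopa–Leindler inequality -/

/-- The one-dimensional Brunn–Minkowski inequality for compact sets. -/
theorem volume_add_le_volume_add_of_isCompact {A B : Set ℝ} (hA : IsCompact A) (hB : IsCompact B)
    (hA0 : A.Nonempty) (hB0 : B.Nonempty) : volume A + volume B ≤ volume (A + B) := by
  obtain ⟨a, ha, hamax⟩ := hA.exists_isGreatest hA0
  obtain ⟨b, hb, hbmin⟩ := hB.exists_isLeast hB0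
  -- With b the minimum of B and a the maximum of A, the translates A + b and a + B both lie in A +
  -- B and meet only in a + b.
  have h1 : volume A = volume ((fun x => x + b) '' A) := by
    rw [Set.image_add_right, measure_preimage_add_right]
  have h2 : volume B = volume ((fun x => a + x) '' B) := by
    rw [Set.image_add_left, measure_preimage_add]
  have hmeas : MeasurableSet ((fun x => a + x) '' B) :=
    (hB.image (continuous_const.add continuous_id)).isClosed.measurableSet
  have hinter : volume ((fun x => x + b) '' A ∩ (fun x => a + x) '' B) = 0 := by
    refine measure_mono_null (t := {a + b}) ?_ (measure_singleton _)
    rintro _ ⟨⟨x, hx, rfl⟩, ⟨y, hy, hxy⟩⟩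
    have := hamax hx
    have := hbmin hy
    simp only [Set.mem_singleton_iff] at *
    linarith
  rw [h1, h2, ← measure_union_add_inter _ hmeas, hinter, add_zero]
  refine measure_mono (Set.union_subset ?_ ?_)
  · rintro _ ⟨x, hx, rfl⟩; exact Set.add_mem_add hx hb
  · rintro _ ⟨x, hx, rfl⟩; exact Set.add_mem_add ha hx

/-- Inner regularity reduces this to compact sets. The superset C avoids any question about the
measurability of A + B. -/
theorem volume_add_le_of_add_subset {A B C : Set ℝ} (hA : MeasurableSet A) (hB : MeasurableSet B)
    (hA0 : A.Nonempty) (hB0 : B.Nonempty) (hC : A + B ⊆ C) : volume A + volume B ≤ volume C := by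
  rw [hA.measure_eq_iSup_isCompact, hB.measure_eq_iSup_isCompact]
  simp only [iSup_and', ]
  obtain ⟨a, ha⟩ := hA0
  obtain ⟨b, hb⟩ := hB0
  refine ENNReal.biSup_add_biSup_le' (p := fun K : Set ℝ => K ⊆ A ∧ IsCompact K)
    (q := fun K : Set ℝ => K ⊆ B ∧ IsCompact K) ⟨{a}, by simpa using ha, isCompact_singleton⟩
    ⟨{b}, by simpa using hb, isCompact_singleton⟩ ?_
  rintro K ⟨hKA, hK⟩ L ⟨hLB, hL⟩
  -- The approximating compact sets may be empty; adjoining a and b makes the compact case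
  -- applicable.
  calc volume K + volume L ≤ volume (insert a K) + volume (insert b L) :=
        add_le_add (measure_mono (Set.subset_insert _ _)) (measure_mono (Set.subset_insert _ _))
    _ ≤ volume (insert a K + insert b L) :=
        volume_add_le_volume_add_of_isCompact (hK.insert a) (hL.insert b)
          (Set.insert_nonempty _ _) (Set.insert_nonempty _ _)
    _ ≤ volume C := measure_mono ((Set.add_subset_add (Set.insert_subset ha hKA)
        (Set.insert_subset hb hLB)).trans hC)

theorem four_mul_le_sq_add_ennreal (a b : ℝ≥0∞) : 4 * (a * b) ≤ (a + b) ^ 2 := by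
  rcases eq_or_ne a ∞ with rfl | ha
  · simp
  rcases eq_or_ne b ∞ with rfl | hb
  · simp
  lift a to NNReal using ha
  lift b to NNReal using hb
  norm_cast
  rw [← NNReal.coe_le_coe]
  push_cast
  nlinarith [sq_nonneg ((a : ℝ) - b)]

/-- Layer cake formula for a function with supremum `1`. -/
theorem lintegral_ofReal_eq_setLIntegral_Ioo {f : ℝ → ℝ} (hf : Measurable f) (h0 : ∀ x, 0 ≤ f x)
    (h1 : ∀ x, f x ≤ 1) :
    ∫⁻ x, ENNReal.ofReal (f x) = ∫⁻ t in Set.Ioo (0 : ℝ) 1, volume {x | t < f x} := by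
  rw [lintegral_eq_lintegral_meas_lt _ (Filter.Eventually.of_forall h0) hf.aemeasurable]
  rw [← Set.Ioo_union_Ici_eq_Ioi zero_lt_one, lintegral_union measurableSet_Ici]
  · rw [setLIntegral_congr_fun (g := fun _ => 0) measurableSet_Ici]
    · simp
    · intro t ht
      have : {x | t < f x} = ∅ := by
        ext x
        simpa using (h1 x).trans ht
      simp [this]
  · rw [Set.disjoint_left]
    intro x hx hx'
    exact absurd hx.2 (not_lt.mpr hx')

/-- One-dimensional Prékopa–Leindler inequality for functions with supremum `1`. -/
theorem lintegral_add_lintegral_le_of_iSup_eq_one {f g h : ℝ → ℝ} (hf : Measurable f)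
    (hg : Measurable g) (hh : Measurable h)
    (hf0 : ∀ x, 0 ≤ f x) (hg0 : ∀ x, 0 ≤ g x) (hh0 : ∀ x, 0 ≤ h x)
    (hf1 : IsLUB (Set.range f) 1) (hg1 : IsLUB (Set.range g) 1)
    (H : ∀ x y, f x * g y ≤ h (x + y) ^ 2) :
    (∫⁻ x, ENNReal.ofReal (f x)) + ∫⁻ x, ENNReal.ofReal (g x) ≤ ∫⁻ x, ENNReal.ofReal (h x) := by
  rw [lintegral_ofReal_eq_setLIntegral_Ioo hf hf0 fun x => hf1.1 ⟨x, rfl⟩,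
    lintegral_ofReal_eq_setLIntegral_Ioo hg hg0 fun x => hg1.1 ⟨x, rfl⟩,
    lintegral_eq_lintegral_meas_lt _ (Filter.Eventually.of_forall hh0) hh.aemeasurable]
  have hanti : ∀ u : ℝ → ℝ, Measurable fun t : ℝ => volume {x | t < u x} := fun u =>
    Antitone.measurable fun s t hst => measure_mono fun x hx => lt_of_le_of_lt hst hx
  rw [← lintegral_add_left (hanti f)]
  -- Only levels t in (0, 1) are kept: there the superlevel sets of f and g are non-empty, as the
  -- suprema are 1, and their sum lies in that of h.
  refine le_trans ?_ (lintegral_mono_set (Set.Ioo_subset_Ioi_self : Set.Ioo (0 : ℝ) 1 ⊆ Set.Ioi 0))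
  refine setLIntegral_mono' measurableSet_Ioo fun t ht => ?_
  refine volume_add_le_of_add_subset (measurableSet_lt measurable_const hf)
    (measurableSet_lt measurable_const hg) ?_ ?_ ?_
  · obtain ⟨_, ⟨x, rfl⟩, hx⟩ := (lt_isLUB_iff hf1).1 ht.2
    exact ⟨x, hx⟩
  · obtain ⟨_, ⟨x, rfl⟩, hx⟩ := (lt_isLUB_iff hg1).1 ht.2
    exact ⟨x, hx⟩
  · rintro _ ⟨x, hx, y, hy, rfl⟩
    simp only [Set.mem_ofPred_eq] at *
    have h2 : t ^ 2 < h (x + y) ^ 2 := by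
      refine lt_of_lt_of_le ?_ (H x y)
      rw [sq]
      exact mul_lt_mul'' hx hy ht.1.le ht.1.le
    exact lt_of_pow_lt_pow_left₀ 2 (hh0 _) h2

/-- One-dimensional Prékopa–Leindler inequality for bounded functions. -/
theorem four_mul_lintegral_mul_lintegral_le_of_bounded {f g h : ℝ → ℝ} (hf : Measurable f)
    (hg : Measurable g) (hh : Measurable h)
    (hf0 : ∀ x, 0 ≤ f x) (hg0 : ∀ x, 0 ≤ g x) (hh0 : ∀ x, 0 ≤ h x)
    (hfb : BddAbove (Set.range f)) (hgb : BddAbove (Set.range g))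
    (H : ∀ x y, f x * g y ≤ h (x + y) ^ 2) :
    4 * ((∫⁻ x, ENNReal.ofReal (f x)) * ∫⁻ x, ENNReal.ofReal (g x)) ≤
      (∫⁻ x, ENNReal.ofReal (h x)) ^ 2 := by
  have hpos : ∀ u : ℝ → ℝ, (∀ x, 0 ≤ u x) → BddAbove (Set.range u) →
      (∫⁻ x, ENNReal.ofReal (u x)) ≠ 0 → 0 < ⨆ x, u x := by
    intro u hu hub hne
    by_contra hcon
    apply hne
    have : ∀ x, ENNReal.ofReal (u x) = 0 := fun x =>
      ENNReal.ofReal_eq_zero.2 ((le_ciSup hub x).trans (not_lt.1 hcon))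
    simp [this]
  by_cases hf' : (∫⁻ x, ENNReal.ofReal (f x)) = 0
  · simp [hf']
  by_cases hg' : (∫⁻ x, ENNReal.ofReal (g x)) = 0
  · simp [hg']
  have ha := hpos f hf0 hfb hf'
  have hb := hpos g hg0 hgb hg'
  have hfa := isLUB_ciSup hfb
  have hgb' := isLUB_ciSup hgb
  generalize (⨆ x, f x) = a at ha hfa
  generalize (⨆ x, g x) = b at hb hgb'
  have hlub : ∀ (u : ℝ → ℝ) (c : ℝ), 0 < c → IsLUB (Set.range u) c →
      IsLUB (Set.range fun x => u x / c) 1 := by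
    intro u c hc hu
    refine ⟨?_, fun d hd => ?_⟩
    · rintro _ ⟨x, rfl⟩
      exact (div_le_one hc).2 (hu.1 ⟨x, rfl⟩)
    · have : c ≤ d * c := hu.2 (by
        rintro _ ⟨x, rfl⟩
        exact (div_le_iff₀ hc).1 (hd ⟨x, rfl⟩))
      nlinarith
  -- Dividing f, g, h by a, b, √(ab) preserves the hypothesis; the resulting additive inequality
  -- becomes multiplicative by 4AB ≤ (A + B)².
  set c := Real.sqrt (a * b) with hc
  have hc0 : 0 < c := Real.sqrt_pos.2 (mul_pos ha hb)
  have hcc : c ^ 2 = a * b := Real.sq_sqrt (mul_pos ha hb).le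
  have key := lintegral_add_lintegral_le_of_iSup_eq_one (f := fun x => f x / a)
    (g := fun x => g x / b) (h := fun x => h x / c) (hf.div_const _) (hg.div_const _)
    (hh.div_const _) (fun x => div_nonneg (hf0 x) ha.le) (fun x => div_nonneg (hg0 x) hb.le)
    (fun x => div_nonneg (hh0 x) hc0.le) (hlub f a ha hfa) (hlub g b hb hgb')
    (fun x y => by
      rw [div_pow, hcc, div_mul_div_comm]
      exact div_le_div_of_nonneg_right (H x y) (mul_pos ha hb).le)
  have hdiv : ∀ (u : ℝ → ℝ) (d : ℝ), 0 < d → (∫⁻ x, ENNReal.ofReal (u x)) =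
      ENNReal.ofReal d * ∫⁻ x, ENNReal.ofReal (u x / d) := by
    intro u d hd
    rw [← lintegral_const_mul' _ _ ENNReal.ofReal_ne_top]
    refine lintegral_congr fun x => ?_
    rw [← ENNReal.ofReal_mul hd.le, mul_div_cancel₀ _ hd.ne']
  rw [hdiv f a ha, hdiv g b hb, hdiv h c hc0, mul_pow, ← ENNReal.ofReal_pow hc0.le, hcc,
    ENNReal.ofReal_mul ha.le]
  generalize (∫⁻ x, ENNReal.ofReal (f x / a)) = A at *
  generalize (∫⁻ x, ENNReal.ofReal (g x / b)) = B at *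
  calc 4 * (ENNReal.ofReal a * A * (ENNReal.ofReal b * B))
      = ENNReal.ofReal a * ENNReal.ofReal b * (4 * (A * B)) := by ring
    _ ≤ ENNReal.ofReal a * ENNReal.ofReal b * (A + B) ^ 2 := by
        gcongr; exact four_mul_le_sq_add_ennreal A B
    _ ≤ _ := by gcongr

/-- One-dimensional Prékopa–Leindler inequality. -/
theorem four_mul_lintegral_mul_lintegral_le {f g h : ℝ → ℝ≥0∞} (hf : Measurable f)
    (hg : Measurable g) (hh : Measurable h) (H : ∀ x y, f x * g y ≤ h (x + y) ^ 2) :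
    4 * ((∫⁻ x, f x) * ∫⁻ x, g x) ≤ (∫⁻ x, h x) ^ 2 := by
  have htrunc : ∀ u : ℝ → ℝ≥0∞, Measurable u →
      ∫⁻ x, u x = ⨆ N : ℕ, ∫⁻ x, min (u x) N := by
    intro u hu
    rw [← lintegral_iSup (fun N => hu.min measurable_const)]
    · refine lintegral_congr fun x => ?_
      have h1 : ⨆ N : ℕ, (N : ℝ≥0∞) = ∞ := ENNReal.iSup_natCast
      have := inf_iSup_eq (u x) fun N : ℕ => (N : ℝ≥0∞)
      rw [h1] at this
      simpa using this
    · intro N M hNM x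
      exact min_le_min le_rfl (by exact_mod_cast hNM)
  have hmono : ∀ u : ℝ → ℝ≥0∞, Monotone fun N : ℕ => ∫⁻ x, min (u x) N := fun u N M hNM =>
    lintegral_mono fun x => min_le_min le_rfl (by exact_mod_cast hNM)
  rw [htrunc f hf, htrunc g hg]
  simp only [ENNReal.iSup_mul, ENNReal.mul_iSup]
  refine iSup_le fun N₂ => iSup_le fun N₁ => ?_
  set N := max N₁ N₂
  refine (mul_le_mul_right (mul_le_mul' (hmono f (le_max_left N₁ N₂))
    (hmono g (le_max_right N₁ N₂))) 4).trans ?_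
  have hreal : ∀ (u : ℝ → ℝ≥0∞) (x : ℝ),
      min (u x) N = ENNReal.ofReal (min (u x) N).toReal := fun u x =>
    (ENNReal.ofReal_toReal (ne_top_of_le_ne_top (ENNReal.natCast_ne_top N) (min_le_right _ _))).symm
  have hbdd : ∀ u : ℝ → ℝ≥0∞, BddAbove (Set.range fun x => (min (u x) N).toReal) := by
    intro u
    refine ⟨N, ?_⟩
    rintro _ ⟨x, rfl⟩
    exact ENNReal.toReal_le_of_le_ofReal (by positivity) (by simp)
  have key := four_mul_lintegral_mul_lintegral_le_of_bounded
    (f := fun x => (min (f x) N).toReal) (g := fun x => (min (g x) N).toReal)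
    (h := fun x => (min (h x) N).toReal) (hf.min measurable_const).ennreal_toReal
    (hg.min measurable_const).ennreal_toReal (hh.min measurable_const).ennreal_toReal
    (fun _ => ENNReal.toReal_nonneg) (fun _ => ENNReal.toReal_nonneg)
    (fun _ => ENNReal.toReal_nonneg) (hbdd f) (hbdd g) (fun x y => by
      rw [← ENNReal.toReal_mul, ← ENNReal.toReal_pow]
      refine ENNReal.toReal_mono ?_ ?_
      · exact ENNReal.pow_ne_top
          (ne_top_of_le_ne_top (ENNReal.natCast_ne_top N) (min_le_right _ _))
      -- Truncating all three functions at the same height N preserves the hypothesis: either h is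
      -- not truncated, or the right side is N².
      · rcases le_total (h (x + y)) N with hle | hle
        · rw [min_eq_left hle]
          exact (mul_le_mul' (min_le_left _ _) (min_le_left _ _)).trans (H x y)
        · rw [min_eq_right hle, sq]
          exact mul_le_mul' (min_le_right _ _) (min_le_right _ _))
  simp only [← hreal] at key
  exact key.trans (pow_le_pow_left' (lintegral_mono fun x => min_le_left _ _) 2)

/-- **Prékopa–Leindler inequality** on `ℝ^n`, with both weights equal to `1 / 2`. -/
theorem prekopa_leindler (n : ℕ) {f g h : (Fin n → ℝ) → ℝ≥0∞} (hf : Measurable f)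
    (hg : Measurable g) (hh : Measurable h) (H : ∀ x y, f x * g y ≤ h (x + y) ^ 2) :
    4 ^ n * ((∫⁻ x, f x) * ∫⁻ x, g x) ≤ (∫⁻ x, h x) ^ 2 := by
  induction n with
  | zero =>
    have hz : ∀ u : (Fin 0 → ℝ) → ℝ≥0∞, ∫⁻ x, u x = u 0 := by
      intro u
      rw [volume_pi, Measure.pi_of_empty _ 0, lintegral_dirac]
    rw [hz, hz, hz, pow_zero, one_mul]
    simpa using H 0 0
  | succ n ih =>
    set e := (MeasurableEquiv.piFinSuccAbove (fun _ : Fin (n + 1) => ℝ) 0).symm with he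
    have hmp : MeasurePreserving e :=
      (volume_preserving_piFinSuccAbove (fun _ : Fin (n + 1) => ℝ) 0).symm
    have hadd : ∀ (a b : ℝ) (x y : Fin n → ℝ), e (a, x) + e (b, y) = e (a + b, x + y) := by
      intro a b x y
      ext i
      refine Fin.cases ?_ (fun j => ?_) i <;> simp [he, MeasurableEquiv.piFinSuccAbove]
    have hint : ∀ u : (Fin (n + 1) → ℝ) → ℝ≥0∞, Measurable u →
        ∫⁻ x, u x = ∫⁻ a, ∫⁻ x, u (e (a, x)) := by
      intro u hu
      rw [← hmp.lintegral_comp hu, Measure.volume_eq_prod,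
        lintegral_prod (fun z => u (e z)) (hu.comp e.measurable).aemeasurable]
    have hmeas : ∀ u : (Fin (n + 1) → ℝ) → ℝ≥0∞, Measurable u →
        Measurable fun a => ∫⁻ x, u (e (a, x)) := fun u hu =>
      (hu.comp e.measurable).lintegral_prod_right'
    have hmeas' : ∀ (u : (Fin (n + 1) → ℝ) → ℝ≥0∞) (a : ℝ), Measurable u →
        Measurable fun x => u (e (a, x)) := fun u a hu =>
      hu.comp (e.measurable.comp measurable_prodMk_left)
    rw [hint f hf, hint g hg, hint h hh]
    -- The factor 4 ^ n is absorbed into f, so that the induction hypothesis on the slices is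
    -- exactly the hypothesis of the one-dimensional inequality.
    have key := four_mul_lintegral_mul_lintegral_le
      (f := fun a => 4 ^ n * ∫⁻ x, f (e (a, x))) (g := fun a => ∫⁻ x, g (e (a, x)))
      (h := fun a => ∫⁻ x, h (e (a, x))) ((hmeas f hf).const_mul _) (hmeas g hg) (hmeas h hh)
      (fun a b => by
        rw [mul_assoc]
        exact ih (hmeas' f a hf) (hmeas' g b hg) (hmeas' h (a + b) hh) fun x y => by
          rw [← hadd]; exact H _ _)
    rw [lintegral_const_mul _ (hmeas f hf)] at key
    refine le_trans (le_of_eq ?_) key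
    ring

/-- **Brunn–Minkowski inequality** in multiplicative form, for compact sets. -/
theorem four_pow_mul_measure_mul_measure_le {V : Type*} [NormedAddCommGroup V] [NormedSpace ℝ V]
    [FiniteDimensional ℝ V] [MeasurableSpace V] [BorelSpace V] (μ : Measure V)
    [μ.IsAddHaarMeasure] {K L : Set V} (hK : IsCompact K) (hL : IsCompact L) :
    4 ^ finrank ℝ V * (μ K * μ L) ≤ μ (K + L) ^ 2 := by
  let e : V ≃L[ℝ] (Fin (finrank ℝ V) → ℝ) := ContinuousLinearEquiv.ofFinrankEq (by simp)
  have hν : (μ.map e).IsAddHaarMeasure := e.isAddHaarMeasure_map μ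
  have hc := Measure.isAddLeftInvariant_eq_smul (μ.map e) volume
  set c := (μ.map e).addHaarScalarFactor volume
  have hm : ∀ A : Set V, IsCompact A → μ A = c * volume (e '' A) := by
    intro A hA
    have h1 : μ.map e (e '' A) = μ A := by
      rw [Measure.map_apply e.continuous.measurable (hA.image e.continuous).measurableSet,
        Set.preimage_image_eq _ e.injective]
    rw [← h1, hc]
    rfl
  have key := prekopa_leindler (finrank ℝ V) (f := (e '' K).indicator 1)
    (g := (e '' L).indicator 1) (h := (e '' (K + L)).indicator 1)
    (measurable_one.indicator (hK.image e.continuous).measurableSet)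
    (measurable_one.indicator (hL.image e.continuous).measurableSet)
    (measurable_one.indicator ((hK.add hL).image e.continuous).measurableSet) (by
      intro x y
      by_cases hx : x ∈ e '' K
      · by_cases hy : y ∈ e '' L
        · have : x + y ∈ e '' (K + L) := by
            rw [Set.image_add]; exact Set.add_mem_add hx hy
          simp [hx, hy, this]
        · simp [hy]
      · simp [hx])
  rw [lintegral_indicator_one (hK.image e.continuous).measurableSet,
    lintegral_indicator_one (hL.image e.continuous).measurableSet,
    lintegral_indicator_one ((hK.add hL).image e.continuous).measurableSet] at key
  rw [hm K hK, hm L hL, hm _ (hK.add hL), mul_pow]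
  calc 4 ^ finrank ℝ V * (c * volume (e '' K) * (c * volume (e '' L)))
      = (c : ℝ≥0∞) ^ 2 * (4 ^ finrank ℝ V * (volume (e '' K) * volume (e '' L))) := by ring
    _ ≤ _ := by gcongr

/-! ### Interpolation in finite-dimensional function spaces -/

/-- Choose T minimising the dimension of the kernel of restriction to T. A non-zero function in the
kernel would be non-zero at some point, and adding that point to T would shrink the kernel. So
restriction is injective, and a left inverse supplies the φ. This makes W stable under integrals and
pointwise limits without putting a topology on it. -/
theorem exists_interpolation {α : Type*} (W : Submodule ℝ (α → ℝ)) [FiniteDimensional ℝ W] :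
    ∃ (T : Finset α) (φ : T → α → ℝ), (∀ τ, φ τ ∈ W) ∧
      ∀ f ∈ W, f = ∑ τ : T, f τ • φ τ := by
  classical
  let R : (T : Finset α) → W →ₗ[ℝ] (T → ℝ) := fun T =>
    (LinearMap.pi fun τ : T => LinearMap.proj (τ : α)).comp W.subtype
  let r : Finset α → ℕ := fun T => finrank ℝ (LinearMap.ker (R T))
  let T := Function.argmin r
  have hT : ∀ T', r T ≤ r T' := fun T' => Function.argmin_le r T'
  have hker : LinearMap.ker (R T) = ⊥ := by
    rw [eq_bot_iff]
    rintro f hf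
    rw [Submodule.mem_bot]
    by_contra hne
    obtain ⟨a, ha⟩ : ∃ a, (f : α → ℝ) a ≠ 0 := by
      by_contra hcon
      push Not at hcon
      exact hne (Subtype.ext (funext hcon))
    have hlt : LinearMap.ker (R (insert a T)) < LinearMap.ker (R T) := by
      refine lt_of_le_of_ne ?_ ?_
      · intro g hg
        rw [LinearMap.mem_ker] at hg ⊢
        ext τ
        exact congrFun hg ⟨τ, Finset.mem_insert_of_mem τ.2⟩
      · intro heq
        rw [← heq, LinearMap.mem_ker] at hf
        exact ha (congrFun hf ⟨a, Finset.mem_insert_self _ _⟩)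
    exact absurd (Submodule.finrank_lt_finrank_of_lt hlt) (not_lt.2 (hT _))
  obtain ⟨g, hg⟩ := (R T).exists_leftInverse_of_injective hker
  refine ⟨T, fun τ => g (Pi.single τ 1), fun τ => (g _).2, fun f hf => ?_⟩
  have h1 : g (R T ⟨f, hf⟩) = ⟨f, hf⟩ := LinearMap.congr_fun hg _
  have h2 : R T ⟨f, hf⟩ = ∑ τ : T, f τ • Pi.single τ (1 : ℝ) := by
    ext σ
    simp [R, Finset.sum_apply, Pi.single_apply]
  rw [h2, map_sum] at h1
  have h3 := congrArg (Subtype.val) h1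
  simpa using h3.symm

/-- The interpolation nodes do not depend on x, so integrating the interpolation formula only
integrates its finitely many coefficients. -/
theorem integral_mem_of_forall_mem {α X : Type*} [MeasurableSpace X] (μ : Measure X)
    (W : Submodule ℝ (α → ℝ)) [FiniteDimensional ℝ W] (F : X → α → ℝ) (hF : ∀ x, F x ∈ W)
    (hint : ∀ a, Integrable (fun x => F x a) μ) : (fun a => ∫ x, F x a ∂μ) ∈ W := by
  obtain ⟨T, φ, hφ, h⟩ := exists_interpolation W
  have : (fun a => ∫ x, F x a ∂μ) = ∑ τ : T, (∫ x, F x τ ∂μ) • φ τ := by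
    ext a
    have h1 : ∀ x, F x a = ∑ τ : T, F x τ * φ τ a := fun x => by
      conv_lhs => rw [h _ (hF x)]
      simp
    simp only [h1]
    rw [integral_finsetSum _ fun (τ : T) _ => (hint τ).mul_const (φ τ a)]
    simp [integral_mul_const]
  rw [this]
  exact W.sum_mem fun τ _ => W.smul_mem _ (hφ τ)

theorem limit_mem_of_forall_mem {α : Type*} (W : Submodule ℝ (α → ℝ)) [FiniteDimensional ℝ W]
    (F : ℕ → α → ℝ) (hF : ∀ k, F k ∈ W) (f : α → ℝ)
    (hlim : ∀ a, Filter.Tendsto (fun k => F k a) Filter.atTop (nhds (f a))) : f ∈ W := by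
  obtain ⟨T, φ, hφ, h⟩ := exists_interpolation W
  have : f = ∑ τ : T, f τ • φ τ := by
    ext a
    refine tendsto_nhds_unique (hlim a) ?_
    have h1 : ∀ k, F k a = ∑ τ : T, F k τ * φ τ a := fun k => by
      conv_lhs => rw [h _ (hF k)]
      simp
    simp only [h1, Finset.sum_apply, Pi.smul_apply, smul_eq_mul]
    exact tendsto_finsetSum _ fun τ _ => (hlim τ).mul_const _
  rw [this]
  exact W.sum_mem fun τ _ => W.smul_mem _ (hφ τ)

/-! ### Homogeneous forms on the positive orthant -/

/-- The homogeneous polynomial functions of degree `n` on the positive orthant. -/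
def homogeneousForms (ι : Type*) (n : ℕ) : Submodule ℝ ((ι → NNReal) → ℝ) :=
  Submodule.span ℝ (Set.range fun (p : Fin n → ι) (t : ι → NNReal) => ∏ j, (t (p j) : ℝ))

instance (ι : Type*) [Finite ι] (n : ℕ) : FiniteDimensional ℝ (homogeneousForms ι n) :=
  FiniteDimensional.span_of_finite ℝ (Set.finite_range _)

/-- Leibniz expansion of the determinant, followed by expansion of each product of sums over the
choices p of one summand per column. -/
theorem det_sum_smul_mem_homogeneousForms {ι V : Type*} [Fintype ι] [AddCommGroup V] [Module ℝ V]
    {n : ℕ} (b : Basis (Fin n) ℝ V) (A : ι → V →ₗ[ℝ] V) :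
    (fun t : ι → NNReal => LinearMap.det (∑ i, (t i : ℝ) • A i)) ∈ homogeneousForms ι n := by
  classical
  have : (fun t : ι → NNReal => LinearMap.det (∑ i, (t i : ℝ) • A i)) =
      ∑ σ : Equiv.Perm (Fin n), ∑ p : Fin n → ι,
        (((Equiv.Perm.sign σ : ℤ) : ℝ) * ∏ j, LinearMap.toMatrix b b (A (p j)) (σ j) j) •
          fun t : ι → NNReal => ∏ j, (t (p j) : ℝ) := by
    ext t
    rw [← LinearMap.det_toMatrix b, Matrix.det_apply]
    simp only [map_sum, map_smul, Finset.sum_apply, Pi.smul_apply, smul_eq_mul]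
    refine Finset.sum_congr rfl fun σ _ => ?_
    simp only [Matrix.sum_apply, Matrix.smul_apply, smul_eq_mul]
    rw [Finset.prod_univ_sum, Fintype.piFinset_univ, Finset.smul_sum]
    refine Finset.sum_congr rfl fun p _ => ?_
    rw [Finset.prod_mul_distrib, Units.smul_def, zsmul_eq_mul]
    ring
  rw [this]
  exact Submodule.sum_mem _ fun σ _ => Submodule.sum_mem _ fun p _ =>
    Submodule.smul_mem _ _ (Submodule.subset_span ⟨p, rfl⟩)

/-! ### The gradient map of the log-sum-exp function of a finite set -/

section LogSumExp

variable {E : Type*} [NormedAddCommGroup E] [InnerProductSpace ℝ E]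

open scoped InnerProductSpace

/-- The sum `∑_{p ∈ S} e^⟨p, x⟩`. -/
def expSum (S : Finset E) (x : E) : ℝ := ∑ p ∈ S, Real.exp ⟪p, x⟫_ℝ

/-- The weights `e^⟨p, x⟩ / ∑_{q ∈ S} e^⟨q, x⟩`. -/
def expWeight (S : Finset E) (x p : E) : ℝ := Real.exp ⟪p, x⟫_ℝ / expSum S x

/-- The gradient of `x ↦ log ∑_{p ∈ S} e^⟨p, x⟩`. -/
def gradLogSumExp (S : Finset E) (x : E) : E := ∑ p ∈ S, expWeight S x p • p

/-- The second derivative of `x ↦ log ∑_{p ∈ S} e^⟨p, x⟩`. -/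
def hessLogSumExp (S : Finset E) (x : E) : E →L[ℝ] E :=
  ∑ p ∈ S, expWeight S x p • (innerSL ℝ p).smulRight p -
    (innerSL ℝ (gradLogSumExp S x)).smulRight (gradLogSumExp S x)

variable {S : Finset E}

theorem expSum_pos (hS : S.Nonempty) (x : E) : 0 < expSum S x :=
  Finset.sum_pos (fun _ _ => Real.exp_pos _) hS

theorem expWeight_pos (hS : S.Nonempty) (x p : E) : 0 < expWeight S x p :=
  div_pos (Real.exp_pos _) (expSum_pos hS x)

theorem sum_expWeight (hS : S.Nonempty) (x : E) : ∑ p ∈ S, expWeight S x p = 1 := by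
  simp only [expWeight, ← Finset.sum_div]
  exact div_self (expSum_pos hS x).ne'

theorem gradLogSumExp_mem (hS : S.Nonempty) (x : E) :
    gradLogSumExp S x ∈ convexHull ℝ (S : Set E) :=
  (convex_convexHull ℝ _).sum_mem (fun _ _ => (expWeight_pos hS x _).le) (sum_expWeight hS x)
    fun _ hp => subset_convexHull ℝ _ hp

theorem hasFDerivAt_exp_inner (p x : E) :
    HasFDerivAt (fun x => Real.exp ⟪p, x⟫_ℝ) (Real.exp ⟪p, x⟫_ℝ • innerSL ℝ p) x :=
  ((innerSL ℝ p).hasFDerivAt (x := x)).exp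

theorem hasFDerivAt_log_expSum (hS : S.Nonempty) (x : E) :
    HasFDerivAt (fun x => Real.log (expSum S x)) (innerSL ℝ (gradLogSumExp S x)) x := by
  have h := (HasFDerivAt.fun_sum fun p (_ : p ∈ S) => hasFDerivAt_exp_inner p x).log
    (expSum_pos hS x).ne'
  refine h.congr_fderiv ?_
  ext v
  simp only [gradLogSumExp, expWeight, map_sum, inner_smul_left, innerSL_apply_apply,
    smul_apply, sum_apply, smul_eq_mul, Finset.mul_sum]
  refine Finset.sum_congr rfl fun p _ => ?_
  simp [expSum]
  ring

theorem hasFDerivAt_expWeight (hS : S.Nonempty) (x p : E) :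
    HasFDerivAt (fun x => expWeight S x p)
      (expWeight S x p • (innerSL ℝ p - innerSL ℝ (gradLogSumExp S x))) x := by
  -- Written as the exponential of a difference, the weight can be differentiated with the known
  -- gradient of the log-sum-exp function.
  have h : ∀ x, expWeight S x p = Real.exp (⟪p, x⟫_ℝ - Real.log (expSum S x)) := fun x => by
    rw [Real.exp_sub, Real.exp_log (expSum_pos hS x), expWeight]
  simp only [h]
  exact (((innerSL ℝ p).hasFDerivAt (x := x)).sub (hasFDerivAt_log_expSum hS x)).exp

theorem hasFDerivAt_gradLogSumExp (hS : S.Nonempty) (x : E) :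
    HasFDerivAt (gradLogSumExp S) (hessLogSumExp S x) x := by
  have h := HasFDerivAt.fun_sum fun p (_ : p ∈ S) => (hasFDerivAt_expWeight hS x p).smul_const p
  refine h.congr_fderiv ?_
  ext v
  simp only [hessLogSumExp, sum_apply, ContinuousLinearMap.smulRight_apply,
    smul_apply, sub_apply, innerSL_apply_apply,
    smul_eq_mul, mul_sub, sub_smul, Finset.sum_sub_distrib]
  congr 1
  · exact Finset.sum_congr rfl fun p _ => by rw [smul_smul]
  · rw [gradLogSumExp, Finset.smul_sum]
    exact Finset.sum_congr rfl fun p _ => by rw [smul_smul, mul_comm]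

theorem inner_hessLogSumExp (x u v : E) :
    ⟪hessLogSumExp S x u, v⟫_ℝ = ∑ p ∈ S, expWeight S x p * (⟪p, u⟫_ℝ * ⟪p, v⟫_ℝ) -
      ⟪gradLogSumExp S x, u⟫_ℝ * ⟪gradLogSumExp S x, v⟫_ℝ := by
  simp [hessLogSumExp, inner_sub_left, sum_inner, inner_smul_left]

/-- The weights form a probability measure on S with mean the gradient, and the Hessian is its
covariance form. -/
theorem inner_hessLogSumExp_self (hS : S.Nonempty) (x v : E) :
    ⟪hessLogSumExp S x v, v⟫_ℝ =
      ∑ p ∈ S, expWeight S x p * (⟪p, v⟫_ℝ - ⟪gradLogSumExp S x, v⟫_ℝ) ^ 2 := by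
  rw [inner_hessLogSumExp]
  have h1 : ⟪gradLogSumExp S x, v⟫_ℝ = ∑ p ∈ S, expWeight S x p * ⟪p, v⟫_ℝ := by
    simp [gradLogSumExp, sum_inner, inner_smul_left]
  set c := ⟪gradLogSumExp S x, v⟫_ℝ
  have h2 : ∀ p ∈ S, expWeight S x p * (⟪p, v⟫_ℝ - c) ^ 2 =
      expWeight S x p * (⟪p, v⟫_ℝ * ⟪p, v⟫_ℝ) - 2 * c * (expWeight S x p * ⟪p, v⟫_ℝ)
        + c ^ 2 * expWeight S x p := fun p _ => by ring
  rw [Finset.sum_congr rfl h2, Finset.sum_add_distrib, Finset.sum_sub_distrib, ← Finset.mul_sum,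
    ← Finset.mul_sum, ← h1, sum_expWeight hS]
  ring

theorem inner_hessLogSumExp_self_nonneg (hS : S.Nonempty) (x v : E) :
    0 ≤ ⟪hessLogSumExp S x v, v⟫_ℝ := by
  rw [inner_hessLogSumExp_self hS]
  exact Finset.sum_nonneg fun p _ => mul_nonneg (expWeight_pos hS x p).le (sq_nonneg _)

/-- Zero variance would put all of S, hence its convex hull, in a hyperplane orthogonal to v; moving
an interior point slightly along v leaves that hyperplane. -/
theorem inner_hessLogSumExp_self_pos (hS : (interior (convexHull ℝ (S : Set E))).Nonempty) (x : E)
    {v : E} (hv : v ≠ 0) : 0 < ⟪hessLogSumExp S x v, v⟫_ℝ := by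
  have hS0 : S.Nonempty := by
    rw [← Finset.coe_nonempty, ← convexHull_nonempty_iff (𝕜 := ℝ)]
    exact hS.mono interior_subset
  refine lt_of_le_of_ne (inner_hessLogSumExp_self_nonneg hS0 x v) fun h0 => ?_
  rw [inner_hessLogSumExp_self hS0, eq_comm, Finset.sum_eq_zero_iff_of_nonneg
    fun p _ => mul_nonneg (expWeight_pos hS0 x p).le (sq_nonneg _)] at h0
  set c := ⟪gradLogSumExp S x, v⟫_ℝ
  have h1 : convexHull ℝ (S : Set E) ⊆ {p | ⟪v, p⟫_ℝ = c} := by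
    refine convexHull_min (fun p hp => ?_) (convex_hyperplane (innerSL ℝ v).isLinear c)
    have := h0 p hp
    rw [mul_eq_zero, or_iff_right (expWeight_pos hS0 x p).ne', sq_eq_zero_iff, sub_eq_zero] at this
    rw [Set.mem_ofPred_eq, real_inner_comm, this]
  obtain ⟨y, hy⟩ := hS
  have hy' : ∀ᶠ ε : ℝ in nhds 0, y + ε • v ∈ interior (convexHull ℝ (S : Set E)) := by
    have : Filter.Tendsto (fun ε : ℝ => y + ε • v) (nhds 0) (nhds (y + (0 : ℝ) • v)) :=
      (by fun_prop : Continuous fun ε : ℝ => y + ε • v).tendsto 0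
    exact this (isOpen_interior.mem_nhds (by simpa using hy))
  obtain ⟨ε, hε, hε0⟩ := (hy'.filter_mono nhdsWithin_le_nhds |>.and
    (self_mem_nhdsWithin (a := (0 : ℝ)) (s := Set.Ioi 0))).exists
  have h2 := h1 (interior_subset hε)
  have h3 := h1 (interior_subset hy)
  simp only [Set.mem_ofPred_eq, inner_add_right, inner_smul_right] at h2 h3 hε0
  have h4 : 0 < ⟪v, v⟫_ℝ := real_inner_self_pos.2 hv
  have := mul_pos hε0 h4
  linarith

/-- Log-sum-exp dominates the support function of the polytope. This provides the coercivity needed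
for surjectivity. -/
theorem inner_le_log_expSum {q : E} (hq : q ∈ convexHull ℝ (S : Set E)) (x : E) :
    ⟪q, x⟫_ℝ ≤ Real.log (expSum S x) := by
  have hS0 : S.Nonempty := by
    rw [← Finset.coe_nonempty, ← convexHull_nonempty_iff (𝕜 := ℝ)]
    exact ⟨q, hq⟩
  have h1 : convexHull ℝ (S : Set E) ⊆ {p | ⟪x, p⟫_ℝ ≤ Real.log (expSum S x)} := by
    refine convexHull_min (fun p hp => ?_) (convex_halfSpace_le (innerSL ℝ x).isLinear _)
    rw [Set.mem_ofPred_eq, Real.le_log_iff_exp_le (expSum_pos hS0 x), real_inner_comm]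
    exact Finset.single_le_sum (f := fun p => Real.exp ⟪p, x⟫_ℝ)
      (fun _ _ => (Real.exp_pos _).le) hp
  have := h1 hq
  rwa [Set.mem_ofPred_eq, real_inner_comm] at this

end LogSumExp

/-! ### Weighted sums of log-sum-exp gradients and Minkowski combinations of polytopes -/

section LogSumExp

variable {E : Type*} [NormedAddCommGroup E] [InnerProductSpace ℝ E]

open scoped InnerProductSpace

theorem nonempty_of_interior_convexHull_nonempty {S : Finset E}
    (hS : (interior (convexHull ℝ (S : Set E))).Nonempty) : S.Nonempty := by
  rw [← Finset.coe_nonempty, ← convexHull_nonempty_iff (𝕜 := ℝ)]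
  exact hS.mono interior_subset

variable {ι : Type*} [Fintype ι] {S : ι → Finset E}

theorem inner_sum_smul_hessLogSumExp_pos
    (hS : ∀ i, (interior (convexHull ℝ (S i : Set E))).Nonempty) {t : ι → NNReal} (ht : t ≠ 0)
    (x : E) {v : E} (hv : v ≠ 0) :
    0 < ⟪(∑ i, (t i : ℝ) • hessLogSumExp (S i) x) v, v⟫_ℝ := by
  obtain ⟨i, hi⟩ := Function.ne_iff.1 ht
  simp only [sum_apply, smul_apply, sum_inner, inner_smul_left]
  refine Finset.sum_pos' (fun j _ => mul_nonneg (t j).2 ?_) ⟨i, Finset.mem_univ _, mul_pos ?_ ?_⟩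
  · exact inner_hessLogSumExp_self_nonneg (nonempty_of_interior_convexHull_nonempty (hS j)) x v
  · exact (pos_iff_ne_zero.2 hi : 0 < t i)
  · exact inner_hessLogSumExp_self_pos (hS i) x hv

theorem hasFDerivAt_sum_smul_gradLogSumExp (hS : ∀ i, (S i).Nonempty) (t : ι → NNReal) (x : E) :
    HasFDerivAt (fun x => ∑ i, (t i : ℝ) • gradLogSumExp (S i) x)
      (∑ i, (t i : ℝ) • hessLogSumExp (S i) x) x :=
  HasFDerivAt.fun_sum fun i _ => (hasFDerivAt_gradLogSumExp (hS i) x).const_smul _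

/-- Along the segment from x to y, the component of the map in direction y - x has positive
derivative, so the endpoints have different images. -/
theorem sum_smul_gradLogSumExp_injective
    (hS : ∀ i, (interior (convexHull ℝ (S i : Set E))).Nonempty) {t : ι → NNReal} (ht : t ≠ 0) :
    Function.Injective fun x => ∑ i, (t i : ℝ) • gradLogSumExp (S i) x := by
  intro x y hxy
  by_contra hne
  set G := fun x => ∑ i, (t i : ℝ) • gradLogSumExp (S i) x with hG
  have hv : y - x ≠ 0 := sub_ne_zero.2 (Ne.symm hne)
  have hd : ∀ s : ℝ, HasDerivAt (fun s : ℝ => ⟪G (x + s • (y - x)), y - x⟫_ℝ)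
      ⟪(∑ i, (t i : ℝ) • hessLogSumExp (S i) (x + s • (y - x))) (y - x), y - x⟫_ℝ s := by
    intro s
    have h1 : HasDerivAt (fun s : ℝ => x + s • (y - x)) (y - x) s := by
      simpa using ((hasDerivAt_id s).smul_const (y - x)).const_add x
    have h2 := (hasFDerivAt_sum_smul_gradLogSumExp
      (fun i => nonempty_of_interior_convexHull_nonempty (hS i)) t
      (x + s • (y - x))).comp_hasDerivAt s h1
    have h3 := h2.inner ℝ (hasDerivAt_const s (y - x))
    simpa using h3
  have hmono := strictMono_of_hasDerivAt_pos hd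
    fun s => inner_sum_smul_hessLogSumExp_pos hS ht _ hv
  have h01 := hmono zero_lt_one
  simp only [zero_smul, add_zero, one_smul, add_sub_cancel] at h01
  have : G x = G y := hxy
  rw [this] at h01
  exact lt_irrefl _ h01

theorem sum_smul_gradLogSumExp_mem (hS : ∀ i, (S i).Nonempty) (t : ι → NNReal) (x : E) :
    ∑ i, (t i : ℝ) • gradLogSumExp (S i) x ∈ ∑ i, t i • convexHull ℝ (S i : Set E) :=
  Set.mem_fintype_sum _ _ |>.2 ⟨fun i => (t i : ℝ) • gradLogSumExp (S i) x,
    fun i => Set.smul_mem_smul_set (a := t i) (gradLogSumExp_mem (hS i) x), rfl⟩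

variable [FiniteDimensional ℝ E]

/-- For y interior, Φ(x) = ∑ tᵢ log(expSum) - ⟨y, x⟩ grows at least like δ‖x‖, where δ is the radius
of a ball about y inside the combination. It therefore has a minimum, and the critical point
equation there says that y is the value of the gradient map. -/
theorem interior_subset_range_sum_smul_gradLogSumExp (hS : ∀ i, (S i).Nonempty) (t : ι → NNReal) :
    interior (∑ i, t i • convexHull ℝ (S i : Set E)) ⊆
      Set.range fun x => ∑ i, (t i : ℝ) • gradLogSumExp (S i) x := by
  intro y hy
  obtain ⟨δ, hδ, hball⟩ := Metric.nhds_basis_closedBall.mem_iff.1 (mem_interior_iff_mem_nhds.1 hy)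
  set Φ : E → ℝ := fun x => ∑ i, (t i : ℝ) * Real.log (expSum (S i) x) - ⟪y, x⟫_ℝ with hΦ
  have hderiv : ∀ x, HasFDerivAt Φ
      (∑ i, (t i : ℝ) • innerSL ℝ (gradLogSumExp (S i) x) - innerSL ℝ y) x := fun x =>
    (HasFDerivAt.fun_sum fun i _ => (hasFDerivAt_log_expSum (hS i) x).const_mul _).sub
      (innerSL ℝ y).hasFDerivAt
  have hlow : ∀ x, δ * ‖x‖ ≤ Φ x := by
    intro x
    -- The point at distance δ from y in direction x gives the bound; for x = 0 the quotient is 0 by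
    -- convention and the point is y itself.
    have hmem : y + (δ / ‖x‖) • x ∈ ∑ i, t i • convexHull ℝ (S i : Set E) := by
      apply hball
      rw [mem_closedBall_iff_norm, add_sub_cancel_left, norm_smul, norm_div, norm_norm,
        Real.norm_of_nonneg hδ.le]
      rcases eq_or_ne ‖x‖ 0 with h | h
      · simp [h, hδ.le]
      · rw [div_mul_cancel₀ _ h]
    obtain ⟨g, hg, hsum⟩ := (Set.mem_fintype_sum _ _).1 hmem
    have h1 : ∀ i, ⟪g i, x⟫_ℝ ≤ (t i : ℝ) * Real.log (expSum (S i) x) := by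
      intro i
      obtain ⟨q, hq, hqg⟩ := hg i
      rw [← hqg]
      change ⟪(t i : ℝ) • q, x⟫_ℝ ≤ _
      rw [inner_smul_left]
      exact mul_le_mul_of_nonneg_left (inner_le_log_expSum hq x) (t i).2
    have h2 : ⟪y + (δ / ‖x‖) • x, x⟫_ℝ ≤ ∑ i, (t i : ℝ) * Real.log (expSum (S i) x) := by
      rw [← hsum, sum_inner]
      exact Finset.sum_le_sum fun i _ => h1 i
    rw [inner_add_left, inner_smul_left, real_inner_self_eq_norm_sq] at h2
    have h3 : (starRingEnd ℝ) (δ / ‖x‖) * ‖x‖ ^ 2 = δ * ‖x‖ := by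
      rcases eq_or_ne ‖x‖ 0 with h | h
      · simp [h]
      · simp only [conj_trivial]; field_simp
    rw [h3] at h2
    simp only [hΦ]
    linarith
  have hcont : Continuous Φ := continuous_iff_continuousAt.2 fun x => (hderiv x).continuousAt
  obtain ⟨x, hx⟩ := hcont.exists_forall_le' 0 (by
    filter_upwards [(tendsto_norm_cocompact_atTop (E := E)).eventually_ge_atTop (Φ 0 / δ)] with x hx
    refine le_trans ?_ (hlow x)
    rwa [mul_comm, ← div_le_iff₀ hδ])
  refine ⟨x, ?_⟩
  have h0 := IsLocalMin.hasFDerivAt_eq_zero (Filter.Eventually.of_forall hx) (hderiv x)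
  rw [sub_eq_zero] at h0
  refine ext_inner_right ℝ fun v => ?_
  have := congrArg (fun f : E →L[ℝ] ℝ => f v) h0
  simpa [sum_inner, inner_smul_left] using this

/-- In an orthonormal basis the matrix is symmetric and positive definite. -/
theorem det_sum_smul_hessLogSumExp_pos
    (hS : ∀ i, (interior (convexHull ℝ (S i : Set E))).Nonempty) {t : ι → NNReal} (ht : t ≠ 0)
    (x : E) : 0 < (∑ i, (t i : ℝ) • hessLogSumExp (S i) x).det := by
  set A := ∑ i, (t i : ℝ) • hessLogSumExp (S i) x with hA
  have hsymm : ∀ u v, ⟪A u, v⟫_ℝ = ⟪A v, u⟫_ℝ := by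
    intro u v
    simp only [hA, sum_apply, smul_apply, sum_inner, inner_smul_left, inner_hessLogSumExp]
    refine Finset.sum_congr rfl fun i _ => ?_
    simp only [mul_comm]
  set b := stdOrthonormalBasis ℝ E
  rw [ContinuousLinearMap.det, ← LinearMap.det_toMatrix b.toBasis]
  have hentry : ∀ i j, LinearMap.toMatrix b.toBasis b.toBasis (A : E →ₗ[ℝ] E) i j =
      ⟪A (b j), b i⟫_ℝ := by
    intro i j
    rw [LinearMap.toMatrix_apply, OrthonormalBasis.coe_toBasis, OrthonormalBasis.coe_toBasis_repr_apply,
      OrthonormalBasis.repr_apply_apply, real_inner_comm]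
    rfl
  refine Matrix.PosDef.det_pos (Matrix.PosDef.of_dotProduct_mulVec_pos ?_ fun w hw => ?_)
  · ext i j
    simp only [Matrix.conjTranspose_apply, hentry, star_trivial]
    exact hsymm _ _
  · set v := ∑ j, w j • b j with hv
    have hv0 : v ≠ 0 := by
      intro h0
      apply hw
      ext j
      have := b.toBasis.linearIndependent
      rw [Fintype.linearIndependent_iff] at this
      exact this w (by simpa using h0) j
    have hpos := inner_sum_smul_hessLogSumExp_pos hS ht x hv0
    rw [← hA] at hpos
    refine lt_of_lt_of_eq hpos ?_
    symm
    simp only [hv, map_sum, map_smul, sum_inner, inner_sum, inner_smul_left, inner_smul_right,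
      dotProduct, Matrix.mulVec, hentry, Finset.mul_sum, Pi.star_apply, star_trivial, conj_trivial]
    rw [Finset.sum_comm]
    refine Finset.sum_congr rfl fun i _ => Finset.sum_congr rfl fun j _ => ?_
    rw [hsymm (b i) (b j)]
    ring

variable [MeasurableSpace E] [BorelSpace E]

theorem convex_sum_smul {V : Type*} [AddCommGroup V] [Module ℝ V] {K : ι → Set V}
    (hK : ∀ i, Convex ℝ (K i)) (t : ι → NNReal) : Convex ℝ (∑ i, t i • K i) :=
  convex_sum _ fun i _ => (hK i).smul (t i : ℝ)

/-- The volume of a Minkowski combination of polytopes as an integral of a determinant. -/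
theorem lintegral_det_sum_smul_hessLogSumExp (μ : Measure E) [μ.IsAddHaarMeasure]
    (hS : ∀ i, (interior (convexHull ℝ (S i : Set E))).Nonempty) {t : ι → NNReal} (ht : t ≠ 0) :
    ∫⁻ x, ENNReal.ofReal (∑ i, (t i : ℝ) • hessLogSumExp (S i) x).det ∂μ =
      μ (∑ i, t i • convexHull ℝ (S i : Set E)) := by
  have hS0 := fun i => nonempty_of_interior_convexHull_nonempty (hS i)
  have h1 := lintegral_abs_det_fderiv_eq_addHaar_image μ MeasurableSet.univ
    (fun x _ => (hasFDerivAt_sum_smul_gradLogSumExp hS0 t x).hasFDerivWithinAt)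
    (sum_smul_gradLogSumExp_injective hS ht).injOn
  rw [Measure.restrict_univ, Set.image_univ] at h1
  have h2 : ∀ x, |(∑ i, (t i : ℝ) • hessLogSumExp (S i) x).det| =
      (∑ i, (t i : ℝ) • hessLogSumExp (S i) x).det := fun x =>
    abs_of_pos (det_sum_smul_hessLogSumExp_pos hS ht x)
  simp only [h2] at h1
  rw [h1]
  refine le_antisymm (measure_mono ?_) ?_
  · rintro _ ⟨x, rfl⟩
    exact sum_smul_gradLogSumExp_mem hS0 t x
  -- The frontier of a convex set is null, so covering the interior suffices.
  · rw [← measure_congr (interior_ae_eq_of_null_frontier ((convex_sum_smul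
      (fun i => convex_convexHull ℝ (S i : Set E)) t).addHaar_frontier μ))]
    exact measure_mono (interior_subset_range_sum_smul_gradLogSumExp hS0 t)

end LogSumExp

/-! ### Volumes of Minkowski combinations are homogeneous polynomials -/

section Polytopes

variable {E : Type*} [NormedAddCommGroup E] [InnerProductSpace ℝ E]

open scoped InnerProductSpace

theorem continuous_hessLogSumExp {S : Finset E} (hS : S.Nonempty) :
    Continuous (hessLogSumExp S) := by
  have h1 : ∀ p, Continuous fun x => expWeight S x p := fun p =>
    continuous_iff_continuousAt.2 fun x => (hasFDerivAt_expWeight hS x p).continuousAt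
  have h2 : Continuous (gradLogSumExp S) :=
    continuous_iff_continuousAt.2 fun x => (hasFDerivAt_gradLogSumExp hS x).continuousAt
  unfold hessLogSumExp
  refine Continuous.sub (continuous_finsetSum _ fun p _ => (h1 p).smul continuous_const) ?_
  exact ((ContinuousLinearMap.smulRightL ℝ E E).continuous.comp
    ((innerSL ℝ).continuous.comp h2)).clm_apply h2

variable [FiniteDimensional ℝ E] [MeasurableSpace E] [BorelSpace E] {ι : Type*} [Fintype ι]

theorem isCompact_sum_smul {V : Type*} [NormedAddCommGroup V] [NormedSpace ℝ V] {K : ι → Set V}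
    (hK : ∀ i, IsCompact (K i)) (t : ι → NNReal) : IsCompact (∑ i, t i • K i) := by
  classical
  have : ∀ s : Finset ι, IsCompact (∑ i ∈ s, t i • K i) := by
    intro s
    induction s using Finset.induction_on with
    | empty => simp
    | insert a s ha ih =>
      rw [Finset.sum_insert ha]
      exact ((hK a).smul (t a)).add ih
  exact this _

theorem sum_zero_smul {V : Type*} [AddCommGroup V] [Module ℝ V] {K : ι → Set V}
    (hK : ∀ i, (K i).Nonempty) : ∑ i, (0 : ι → NNReal) i • K i = {0} := by
  have : ∀ i, (0 : ι → NNReal) i • K i = 0 := fun i => by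
    rw [Pi.zero_apply, Set.zero_smul_set (hK i)]
  exact (Finset.sum_congr rfl fun i _ => this i).trans Finset.sum_const_zero

/-- For each fixed x the integrand is a determinant of a linear combination, hence a form in t;
integration over x stays in that finite-dimensional space. -/
theorem measure_sum_smul_convexHull_mem_homogeneousForms (μ : Measure E) [μ.IsAddHaarMeasure]
    (hn : 0 < finrank ℝ E) {S : ι → Finset E}
    (hS : ∀ i, (interior (convexHull ℝ (S i : Set E))).Nonempty) :
    (fun t : ι → NNReal => (μ (∑ i, t i • convexHull ℝ (S i : Set E))).toReal) ∈
      homogeneousForms ι (finrank ℝ E) := by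
  have hS0 := fun i => nonempty_of_interior_convexHull_nonempty (hS i)
  have hne : ∀ i, (convexHull ℝ (S i : Set E)).Nonempty := fun i => (hS i).mono interior_subset
  have : Nontrivial E := Module.nontrivial_of_finrank_pos hn
  set F : E → (ι → NNReal) → ℝ := fun x t => (∑ i, (t i : ℝ) • hessLogSumExp (S i) x).det with hF
  have : Nonempty (Fin (finrank ℝ E)) := ⟨⟨0, hn⟩⟩
  -- The integral formula excludes t = 0. In positive dimension both the determinant of the zero map
  -- and the volume of a point vanish, so it extends.
  have hF0 : ∀ x, F x 0 = 0 := fun x => by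
    simp only [hF, Pi.zero_apply, NNReal.coe_zero, zero_smul, Finset.sum_const_zero]
    exact LinearMap.det_zero' (finBasis ℝ E)
  have hpos : ∀ x t, 0 ≤ F x t := fun x t => by
    rcases eq_or_ne t 0 with rfl | ht
    · rw [hF0]
    · exact (det_sum_smul_hessLogSumExp_pos hS ht x).le
  have hcont : ∀ t, Continuous fun x => F x t := fun t =>
    ContinuousLinearMap.continuous_det.comp
      (continuous_finsetSum _ fun i _ => by
        have := continuous_hessLogSumExp (hS0 i)
        fun_prop)
  have hlin : ∀ t, ∫⁻ x, ENNReal.ofReal (F x t) ∂μ =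
      μ (∑ i, t i • convexHull ℝ (S i : Set E)) := fun t => by
    rcases eq_or_ne t 0 with rfl | ht
    · rw [sum_zero_smul hne, measure_singleton]
      simp [hF0]
    · exact lintegral_det_sum_smul_hessLogSumExp μ hS ht
  have hfin : ∀ t : ι → NNReal, μ (∑ i, t i • convexHull ℝ (S i : Set E)) ≠ ∞ := fun t =>
    (isCompact_sum_smul (fun i => (S i).finite_toSet.isCompact_convexHull ℝ) t).measure_ne_top
  have hmain := integral_mem_of_forall_mem μ (homogeneousForms ι (finrank ℝ E)) F
    (fun x => by
      have := det_sum_smul_mem_homogeneousForms (finBasis ℝ E)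
        fun i => (hessLogSumExp (S i) x : E →ₗ[ℝ] E)
      convert this using 1
      ext t
      simp [hF, ContinuousLinearMap.det])
    (fun t => by
      refine ⟨(hcont t).aestronglyMeasurable, ?_⟩
      rw [hasFiniteIntegral_iff_ofReal (Filter.Eventually.of_forall fun x => hpos x t), hlin]
      exact (hfin t).lt_top)
  convert hmain using 1
  ext t
  rw [integral_eq_lintegral_of_nonneg_ae (Filter.Eventually.of_forall fun x => hpos x t)
    (hcont t).aestronglyMeasurable, hlin]

end Polytopes

/-! ### From polytopes to arbitrary convex bodies -/

section Bodies

variable {V : Type*} [NormedAddCommGroup V] [NormedSpace ℝ V]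

/-- Every point of K is interior to a simplex contained in the ε-thickening. Finitely many such
interiors cover K, and the hull of all their vertices stays in the thickening, which is convex. -/
theorem exists_convexHull_between [FiniteDimensional ℝ V] {K : Set V} (hK : IsCompact K) (hconv : Convex ℝ K) {ε : ℝ}
    (hε : 0 < ε) : ∃ S : Finset V, K ⊆ interior (convexHull ℝ (S : Set V)) ∧
      convexHull ℝ (S : Set V) ⊆ Metric.cthickening ε K := by
  classical
  have hU : ∀ x ∈ K, Metric.thickening ε K ∈ nhds x := fun x hx =>
    Metric.isOpen_thickening.mem_nhds (Metric.self_subset_thickening hε K hx)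
  have hb : ∀ x ∈ K, ∃ S : Finset V, x ∈ interior (convexHull ℝ (S : Set V)) ∧
      (S : Set V) ⊆ Metric.thickening ε K := by
    intro x hx
    obtain ⟨b, hxb, hbU⟩ := exists_mem_interior_convexHull_affineBasis (hU x hx)
    refine ⟨Finset.univ.image b, ?_, ?_⟩
    · simpa using hxb
    · simpa using (subset_convexHull ℝ _).trans hbU
  choose! S hS using hb
  obtain ⟨t, htK, ht⟩ := hK.elim_nhds_subcover (fun x => interior (convexHull ℝ (S x : Set V)))
    fun x hx => isOpen_interior.mem_nhds (hS x hx).1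
  refine ⟨t.biUnion S, ht.trans (Set.iUnion₂_subset fun x hx => interior_mono
    (convexHull_mono ?_)), (convexHull_min ?_ (hconv.thickening ε)).trans
    (Metric.thickening_subset_cthickening _ _)⟩
  · exact_mod_cast Finset.subset_biUnion_of_mem S hx
  · intro y hy
    rw [Finset.mem_coe, Finset.mem_biUnion] at hy
    obtain ⟨x, hx, hxy⟩ := hy
    exact (hS x (htK x hx)).2 hxy

variable {ι : Type*} [Fintype ι]

theorem sum_smul_subset_cthickening {K P : ι → Set V} (hK : ∀ i, IsCompact (K i)) {ε : ℝ}
    (hε : 0 ≤ ε) (hP : ∀ i, P i ⊆ Metric.cthickening ε (K i)) (t : ι → NNReal) :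
    ∑ i, t i • P i ⊆ Metric.cthickening ((∑ i, (t i : ℝ)) * ε) (∑ i, t i • K i) := by
  intro x hx
  obtain ⟨g, hg, rfl⟩ := (Set.mem_fintype_sum _ _).1 hx
  have h1 : ∀ i, ∃ y ∈ t i • K i, dist (g i) y ≤ t i * ε := by
    intro i
    obtain ⟨p, hp, hpg⟩ := hg i
    have hp' := hP i hp
    rw [(hK i).cthickening_eq_biUnion_closedBall hε] at hp'
    obtain ⟨y, hy, hpy⟩ := Set.mem_iUnion₂.1 hp'
    refine ⟨t i • y, Set.smul_mem_smul_set hy, ?_⟩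
    rw [← hpg]
    change dist ((t i : ℝ) • p) ((t i : ℝ) • y) ≤ _
    rw [dist_smul₀, NNReal.norm_eq]
    exact mul_le_mul_of_nonneg_left hpy (t i).2
  choose y hy hgy using h1
  refine Metric.mem_cthickening_of_dist_le _ (∑ i, y i) _ _
    ((Set.mem_fintype_sum _ _).2 ⟨y, hy, rfl⟩) ?_
  rw [Finset.sum_mul]
  exact (dist_sum_sum_le _ _ _).trans (Finset.sum_le_sum fun i _ => hgy i)

theorem sum_smul_mono {K P : ι → Set V} (h : ∀ i, K i ⊆ P i) (t : ι → NNReal) :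
    ∑ i, t i • K i ⊆ ∑ i, t i • P i :=
  Set.finsetSum_subset_finsetSum _ _ _ fun i _ => Set.smul_set_mono (h i)

/-- Polytopes squeezed between Kᵢ and its 1/(k + 1)-thickening give volumes converging for each t,
and pointwise limits of forms are forms. -/
theorem measure_sum_smul_mem_homogeneousForms_of_inner {E : Type*} [NormedAddCommGroup E]
    [InnerProductSpace ℝ E] [FiniteDimensional ℝ E] [MeasurableSpace E] [BorelSpace E]
    (μ : Measure E) [μ.IsAddHaarMeasure] (hn : 0 < finrank ℝ E) {K : ι → Set E}
    (hK : ∀ i, IsCompact (K i)) (hconv : ∀ i, Convex ℝ (K i)) (hne : ∀ i, (K i).Nonempty) :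
    (fun t : ι → NNReal => (μ (∑ i, t i • K i)).toReal) ∈ homogeneousForms ι (finrank ℝ E) := by
  have hε : ∀ k : ℕ, (0 : ℝ) < 1 / (k + 1) := fun k => Nat.one_div_pos_of_nat
  choose S hS1 hS2 using fun (k : ℕ) (i : ι) =>
    exists_convexHull_between (hK i) (hconv i) (hε k)
  refine limit_mem_of_forall_mem _ _ (fun k => measure_sum_smul_convexHull_mem_homogeneousForms μ
    hn (S := S k) fun i => (hne i).mono (hS1 k i)) _ fun t => ?_
  have hc := isCompact_sum_smul hK t
  refine (ENNReal.tendsto_toReal hc.measure_ne_top).comp ?_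
  have hlim : Filter.Tendsto (fun k : ℕ => (∑ i, (t i : ℝ)) * (1 / (k + 1))) Filter.atTop
      (nhds 0) := by
    simpa using (tendsto_one_div_add_atTop_nhds_zero_nat (𝕜 := ℝ)).const_mul (∑ i, (t i : ℝ))
  refine tendsto_of_tendsto_of_tendsto_of_le_of_le tendsto_const_nhds
    ((tendsto_measure_cthickening_of_isCompact hc).comp hlim) (fun k => ?_) fun k => ?_
  · exact measure_mono (sum_smul_mono (fun i => (hS1 k i).trans interior_subset) t)
  · exact measure_mono (sum_smul_subset_cthickening hK (hε k).le (hS2 k) t)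

theorem map_equiv_apply_image {W : Type*} [NormedAddCommGroup W] [NormedSpace ℝ W]
    [MeasurableSpace V] [BorelSpace V] [MeasurableSpace W] [BorelSpace W] (μ : Measure V)
    (e : V ≃L[ℝ] W) (A : Set V) : μ.map e (e '' A) = μ A := by
  have := e.toHomeomorph.toMeasurableEquiv.map_apply (μ := μ) (e '' A)
  refine this.trans ?_
  exact congrArg μ (Set.preimage_image_eq _ e.injective)

theorem image_sum_smul {W : Type*} [NormedAddCommGroup W] [NormedSpace ℝ W]
    (e : V ≃L[ℝ] W) (K : ι → Set V) (t : ι → NNReal) :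
    e '' (∑ i, t i • K i) = ∑ i, t i • e '' K i := by
  rw [Set.image_finsetSum]
  refine Finset.sum_congr rfl fun i _ => ?_
  exact Set.image_smul_comm _ _ _ fun x => e.map_smul (t i : ℝ) x

/-- **Minkowski's theorem**: the volume of `∑ t_i K_i` is a homogeneous polynomial in `t`. -/
theorem measure_sum_smul_mem_homogeneousForms [FiniteDimensional ℝ V] [MeasurableSpace V] [BorelSpace V] (μ : Measure V)
    [μ.IsAddHaarMeasure] (hn : 0 < finrank ℝ V) (K : ι → ConvexBody V) :
    (fun t : ι → NNReal => (μ (∑ i, t i • (K i : Set V))).toReal) ∈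
      homogeneousForms ι (finrank ℝ V) := by
  let e : V ≃L[ℝ] EuclideanSpace ℝ (Fin (finrank ℝ V)) :=
    ContinuousLinearEquiv.ofFinrankEq (by simp)
  have : (μ.map e).IsAddHaarMeasure := e.isAddHaarMeasure_map μ
  have h := measure_sum_smul_mem_homogeneousForms_of_inner (μ.map e) (by simpa using hn)
    (K := fun i => e '' (K i : Set V)) (fun i => (K i).isCompact.image e.continuous)
    (fun i => (K i).convex.is_linear_image ⟨e.map_add, e.map_smul⟩) (fun i => (K i).nonempty.image _)
  rw [finrank_euclideanSpace_fin] at h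
  convert h using 3 with t
  rw [← image_sum_smul, map_equiv_apply_image]

end Bodies

/-! ### The polarization formula and the derivative of the volume -/

/-- The sum is the m-th forward difference of r ↦ r ^ c at 0. -/
theorem sum_alternating_choose_mul_pow (m c : ℕ) (hc : c ≤ m) :
    ∑ k ∈ Finset.range (m + 1), (m.choose k : ℝ) * ((-1) ^ (m - k) * (k : ℝ) ^ c) =
      if c = m then (m.factorial : ℝ) else 0 := by
  have h1 := fwdDiff_iter_eq_sum_shift (1 : ℝ) (fun r : ℝ => r ^ c) m 0
  have h2 : (fwdDiff (1 : ℝ))^[m] (fun r : ℝ => r ^ c) 0 =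
      if c = m then (m.factorial : ℝ) else 0 := by
    split_ifs with h
    · subst h
      rw [fwdDiff_iter_eq_factorial]
      simp
    · rw [fwdDiff_iter_pow_eq_zero_of_lt (lt_of_le_of_ne hc h)]
      rfl
  rw [← h2, h1]
  refine Finset.sum_congr rfl fun k _ => ?_
  simp
  ring

/-- The multiplicities with which `L` and `B` occur in the sum over `J` of the family
`(L, …, L, B)`. -/
def pairCount (m : ℕ) (J : Finset (Fin (m + 1))) : Fin 2 → NNReal :=
  ![((J.filter fun j : Fin (m + 1) => (j : ℕ) < m).card : NNReal),
    ((J.filter fun j : Fin (m + 1) => ¬ (j : ℕ) < m).card : NNReal)]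

/-- The subsets J are paired according to whether they contain the last index, which is the slot of
B; the rest depends only on the number of remaining indices. -/
theorem sum_pairCount (m : ℕ) (f : (Fin 2 → NNReal) → ℝ) :
    ∑ J : Finset (Fin (m + 1)), (-1 : ℝ) ^ (m + 1 - J.card) * f (pairCount m J) =
      ∑ k ∈ Finset.range (m + 1), (m.choose k : ℝ) *
        ((-1) ^ (m - k) * (f ![k, 1] - f ![k, 0])) := by
  classical
  set s : Finset (Fin (m + 1)) := Finset.univ.erase (Fin.last m) with hs
  have hcard : s.card = m := by simp [hs]
  have hlast : Fin.last m ∉ s := by simp [hs]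
  have huniv : (Finset.univ : Finset (Finset (Fin (m + 1)))) =
      (insert (Fin.last m) s).powerset := by
    rw [hs, Finset.insert_erase (Finset.mem_univ _), Finset.powerset_univ]
  have hlt : ∀ j ∈ s, (j : ℕ) < m := by
    intro j hj
    have := Finset.ne_of_mem_erase hj
    exact Fin.val_lt_last this
  rw [huniv, Finset.sum_powerset_insert hlast, ← Finset.sum_add_distrib]
  have hsum := Finset.sum_powerset_apply_card
    (fun k => (-1 : ℝ) ^ (m - k) * (f ![k, 1] - f ![k, 0])) (x := s)
  rw [hcard] at hsum
  simp only [nsmul_eq_mul] at hsum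
  rw [← hsum]
  refine Finset.sum_congr rfl fun t ht => ?_
  have hts : t ⊆ s := Finset.mem_powerset.1 ht
  have hlt' : ∀ j ∈ t, (j : ℕ) < m := fun j hj => hlt j (hts hj)
  have hlast' : Fin.last m ∉ t := fun h => hlast (hts h)
  have h1 : pairCount m t = ![(t.card : NNReal), 0] := by
    rw [pairCount, Finset.filter_true_of_mem hlt', Finset.filter_false_of_mem
      (fun j hj => not_not.2 (hlt' j hj))]
    simp
  have h2 : pairCount m (insert (Fin.last m) t) = ![(t.card : NNReal), 1] := by
    rw [pairCount, Finset.filter_insert, Finset.filter_insert, if_neg (by simp), if_pos (by simp),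
      Finset.filter_true_of_mem hlt', Finset.filter_false_of_mem
      (fun j hj => not_not.2 (hlt' j hj))]
    simp
  have hle : t.card ≤ m := (Finset.card_le_card hts).trans_eq hcard
  rw [h1, h2, Finset.card_insert_of_notMem hlast', Nat.succ_sub hle, Nat.add_sub_add_right, pow_succ]
  ring

/-- This matches polarization with differentiation. Both sides are linear in f, so monomials t₀^c
t₁^d with c + d = m + 1 suffice. For d = 0 the differences vanish, for d = 1 the alternating sum is
m!, and for d ≥ 2 it is a too high difference of a power of degree c < m. -/
theorem hasDerivWithinAt_homogeneousForm (m : ℕ) {f : (Fin 2 → NNReal) → ℝ}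
    (hf : f ∈ homogeneousForms (Fin 2) (m + 1)) :
    HasDerivWithinAt (fun t : ℝ => f ![1, t.toNNReal])
      ((m.factorial : ℝ)⁻¹ * ∑ J : Finset (Fin (m + 1)),
        (-1 : ℝ) ^ (m + 1 - J.card) * f (pairCount m J)) (Set.Ici 0) 0 := by
  simp only [sum_pairCount]
  induction hf using Submodule.span_induction with
  | mem f hf =>
    obtain ⟨p, rfl⟩ := hf
    set c := (Finset.univ.filter fun j => p j = 0).card with hc
    set d := (Finset.univ.filter fun j => ¬ p j = 0).card with hd
    have hcd : c + d = m + 1 := by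
      rw [hc, hd, Finset.card_filter_add_card_filter_not, Finset.card_univ, Fintype.card_fin]
    have hprod : ∀ t : Fin 2 → NNReal, ∏ j, (t (p j) : ℝ) = (t 0 : ℝ) ^ c * (t 1 : ℝ) ^ d := by
      intro t
      rw [← Finset.prod_filter_mul_prod_filter_not Finset.univ fun j => p j = 0,
        Finset.prod_eq_pow_card (b := (t 0 : ℝ)), Finset.prod_eq_pow_card (b := (t 1 : ℝ))]
      · intro j hj
        have : p j = 1 := by
          have := (Finset.mem_filter.1 hj).2
          omega
        rw [this]
      · intro j hj
        rw [(Finset.mem_filter.1 hj).2]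
    simp only [hprod]
    simp only [Matrix.cons_val_zero, Matrix.cons_val_one, NNReal.coe_one, one_pow, one_mul,
      NNReal.coe_natCast, NNReal.coe_zero, mul_one]
    have hkey : (m.factorial : ℝ)⁻¹ * ∑ k ∈ Finset.range (m + 1), (m.choose k : ℝ) *
        ((-1) ^ (m - k) * ((k : ℝ) ^ c - (k : ℝ) ^ c * 0 ^ d)) = (d : ℝ) * 0 ^ (d - 1) := by
      rcases Nat.eq_zero_or_pos d with h0 | h0
      · simp [h0]
      · simp only [zero_pow h0.ne', mul_zero, sub_zero]
        rw [sum_alternating_choose_mul_pow m c (by omega)]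
        rcases Nat.eq_or_lt_of_le (Nat.succ_le_of_lt h0) with h1 | h1
        · rw [if_pos (by omega), ← h1, inv_mul_cancel₀ (by positivity)]
          simp
        · rw [if_neg (by omega), zero_pow (by omega)]
          simp
    rw [hkey]
    refine ((hasDerivAt_pow d (0 : ℝ)).hasDerivWithinAt (s := Set.Ici 0)).congr (fun t ht => ?_) ?_
    · rw [Real.coe_toNNReal _ ht]
    · simp
  | zero => simpa using hasDerivWithinAt_const (0 : ℝ) (Set.Ici 0) (0 : ℝ)
  | add f g _ _ ihf ihg =>
    refine (ihf.add ihg).congr_deriv ?_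
    rw [← mul_add, ← Finset.sum_add_distrib]
    congr 1
    refine Finset.sum_congr rfl fun k _ => ?_
    simp only [Pi.add_apply]
    ring
  | smul a f _ ih =>
    refine (ih.const_mul a).congr_deriv ?_
    rw [mul_left_comm, Finset.mul_sum]
    congr 1
    refine Finset.sum_congr rfl fun k _ => ?_
    simp only [Pi.smul_apply, smul_eq_mul]
    ring

theorem exists_differentiable_eq_homogeneousForm {ι : Type*} [Fintype ι] {n : ℕ}
    {f : (ι → NNReal) → ℝ} (hf : f ∈ homogeneousForms ι n) :
    ∃ g : (ι → ℝ) → ℝ, Differentiable ℝ g ∧ ∀ t : ι → NNReal, f t = g fun i => t i := by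
  induction hf using Submodule.span_induction with
  | mem f hf =>
    obtain ⟨p, rfl⟩ := hf
    exact ⟨fun t => ∏ j, t (p j), by fun_prop, fun t => rfl⟩
  | zero => exact ⟨0, by fun_prop, fun t => rfl⟩
  | add f₁ f₂ _ _ ih₁ ih₂ =>
    obtain ⟨g₁, hg₁, h₁⟩ := ih₁
    obtain ⟨g₂, hg₂, h₂⟩ := ih₂
    exact ⟨g₁ + g₂, hg₁.add hg₂, fun t => by simp [h₁, h₂]⟩
  | smul a f _ ih =>
    obtain ⟨g, hg, h⟩ := ih
    exact ⟨a • g, hg.const_smul a, fun t => by simp [h]⟩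

variable {V : Type*} [NormedAddCommGroup V] [NormedSpace ℝ V]

theorem coe_sum_convexBody {ι : Type*} (s : Finset ι) (K : ι → ConvexBody V) :
    ((∑ i ∈ s, K i : ConvexBody V) : Set V) = ∑ i ∈ s, (K i : Set V) :=
  map_sum (⟨⟨fun K : ConvexBody V => (K : Set V), rfl⟩, fun _ _ => rfl⟩ :
    ConvexBody V →+ Set V) K s

/-- Convexity enters here: a k-fold Minkowski sum of a convex body is its dilate by k. -/
theorem sum_pair_eq (m : ℕ) (L B : ConvexBody V) (J : Finset (Fin (m + 1))) :
    ∑ j ∈ J, (if (j : ℕ) < m then (L : Set V) else B) =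
      ∑ i, pairCount m J i • ((![L, B] : Fin 2 → ConvexBody V) i : Set V) := by
  have h1 : ∀ j : Fin (m + 1), (if (j : ℕ) < m then (L : Set V) else B) =
      ((if (j : ℕ) < m then L else B : ConvexBody V) : Set V) := fun j => by split_ifs <;> rfl
  simp only [h1]
  rw [← coe_sum_convexBody, Finset.sum_ite, Finset.sum_const, Finset.sum_const,
    ← Nat.cast_smul_eq_nsmul NNReal, ← Nat.cast_smul_eq_nsmul NNReal, Fin.sum_univ_two]
  rfl

/-! ### The mixed volume V₁ as a one-sided derivative -/

section Measure

theorem isAddHaarMeasure_measure [FiniteDimensional ℝ V] {n : ℕ} [Fact (finrank ℝ V = n)]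
    [MeasurableSpace V] [BorelSpace V] {Ω : V [⋀^Fin n]→ₗ[ℝ] ℝ} (hΩ : Ω ≠ 0) :
    Ω.measure.IsAddHaarMeasure := by
  rw [AlternatingMap.measure]
  refine Measure.IsAddHaarMeasure.nnreal_smul _ ?_
  rw [nnnorm_ne_zero_iff]
  exact fun h => hΩ ((Ω.map_basis_eq_zero_iff _).1 h)

variable [FiniteDimensional ℝ V] {m : ℕ} [hV : Fact (finrank ℝ V = m + 1)]
  [MeasurableSpace V] [BorelSpace V]

theorem hasDerivWithinAt_measure_add_smul {Ω : V [⋀^Fin (m + 1)]→ₗ[ℝ] ℝ} (hΩ : Ω ≠ 0)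
    (L B : ConvexBody V) :
    HasDerivWithinAt (fun t : ℝ => (Ω.measure ((L : Set V) + t • (B : Set V))).toReal)
      ((m + 1) * mixedVolumePair Ω 1 L B) (Set.Ici 0) 0 := by
  have := isAddHaarMeasure_measure hΩ
  have hf := measure_sum_smul_mem_homogeneousForms Ω.measure (hV.out ▸ Nat.succ_pos m) ![L, B]
  rw [hV.out] at hf
  have h := hasDerivWithinAt_homogeneousForm m hf
  have h1 : (m + 1) * mixedVolumePair Ω 1 L B = (m.factorial : ℝ)⁻¹ *
      ∑ J : Finset (Fin (m + 1)), (-1 : ℝ) ^ (m + 1 - J.card) *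
        (Ω.measure (∑ i, pairCount m J i • ((![L, B] : Fin 2 → ConvexBody V) i : Set V))).toReal := by
    simp only [← sum_pair_eq]
    rw [mixedVolumePair, mixedVolume, ← mul_assoc, Nat.factorial_succ]
    congr 1
    push_cast
    field_simp
  rw [h1]
  refine h.congr (fun t ht => ?_) ?_
  · rw [Fin.sum_univ_two]
    simp only [Matrix.cons_val_zero, Matrix.cons_val_one, one_smul]
    rw [NNReal.smul_def, Real.coe_toNNReal _ ht]
  · rw [Fin.sum_univ_two]
    simp only [Matrix.cons_val_zero, Matrix.cons_val_one, one_smul]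
    rw [NNReal.smul_def, Real.coe_toNNReal _ le_rfl]

end Measure

/-! ### Properties of the mixed volume `V₁` -/

theorem hasDerivWithinAt_unique {f : ℝ → ℝ} {a b : ℝ} (h : HasDerivWithinAt f a (Set.Ici 0) 0)
    (h' : HasDerivWithinAt f b (Set.Ici 0) 0) : a = b :=
  (uniqueDiffOn_Ici (0 : ℝ) 0 Set.self_mem_Ici).eq_deriv _ h h'

theorem hasDerivWithinAt_nonneg {f : ℝ → ℝ} {a : ℝ} (h : HasDerivWithinAt f a (Set.Ici 0) 0)
    (h0 : ∀ t, 0 ≤ t → f 0 ≤ f t) : 0 ≤ a := by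
  have h1 := (hasDerivWithinAt_iff_tendsto_slope' (by simp)).1 (h.mono Set.Ioi_subset_Ici_self)
  refine ge_of_tendsto h1 ?_
  filter_upwards [self_mem_nhdsWithin] with t ht
  rw [slope_def_field]
  have ht' : 0 < t := ht
  exact div_nonneg (sub_nonneg.2 (h0 t ht'.le)) (by linarith)

/-- A point as a convex body. -/
def pointBody {V : Type*} [NormedAddCommGroup V] [NormedSpace ℝ V] (x : V) : ConvexBody V :=
  ⟨{x}, convex_singleton x, isCompact_singleton, Set.singleton_nonempty x⟩

/-- The segment `[0, v]` as a convex body. -/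
def segmentBody {V : Type*} [NormedAddCommGroup V] [NormedSpace ℝ V] (v : V) : ConvexBody V :=
  ⟨segment ℝ 0 v, convex_segment 0 v, by
    rw [segment_eq_image_lineMap]
    exact isCompact_Icc.image (AffineMap.lineMap_continuous), ⟨0, left_mem_segment ℝ 0 v⟩⟩

section

variable {V : Type*} [NormedAddCommGroup V] [NormedSpace ℝ V] [FiniteDimensional ℝ V]
  {m : ℕ} [hV : Fact (finrank ℝ V = m + 1)] [MeasurableSpace V] [BorelSpace V]
  {Ω : V [⋀^Fin (m + 1)]→ₗ[ℝ] ℝ}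

theorem measure_smul_toReal (K : Set V) {c : ℝ} (hc : 0 ≤ c) (hΩ : Ω ≠ 0) :
    (Ω.measure (c • K)).toReal = c ^ (m + 1) * (Ω.measure K).toReal := by
  have := isAddHaarMeasure_measure hΩ
  rw [Measure.addHaar_smul, hV.out, ENNReal.toReal_mul, abs_of_nonneg (pow_nonneg hc _),
    ENNReal.toReal_ofReal (pow_nonneg hc _)]

/-- All three mixed volumes are directional derivatives at (1, 0, 0) of one polynomial, the volume
of rL + xB + yC, and the derivative is linear in the direction. -/
theorem mixedVolumePair_add (hΩ : Ω ≠ 0) (L B C : ConvexBody V) :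
    mixedVolumePair Ω 1 L ((B + C : ConvexBody V) : Set V) =
      mixedVolumePair Ω 1 L B + mixedVolumePair Ω 1 L C := by
  have := isAddHaarMeasure_measure hΩ
  have hf := measure_sum_smul_mem_homogeneousForms Ω.measure (hV.out ▸ Nat.succ_pos m) ![L, B, C]
  obtain ⟨g, hg, hfg⟩ := exists_differentiable_eq_homogeneousForm hf
  have hd : ∀ w : Fin 3 → ℝ, HasDerivWithinAt (fun t : ℝ => g (![1, 0, 0] + t • w))
      (fderiv ℝ g ![1, 0, 0] w) (Set.Ici 0) 0 := by
    intro w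
    have h1 : HasDerivAt (fun t : ℝ => (![1, 0, 0] : Fin 3 → ℝ) + t • w) w 0 := by
      simpa using ((hasDerivAt_id (0 : ℝ)).smul_const w).const_add (![1, 0, 0] : Fin 3 → ℝ)
    have h2 : HasFDerivAt g (fderiv ℝ g ![1, 0, 0]) (![1, 0, 0] + (0 : ℝ) • w) := by
      rw [zero_smul, add_zero]
      exact (hg _).hasFDerivAt
    exact (h2.comp_hasDerivAt (0 : ℝ) h1).hasDerivWithinAt
  have hval : ∀ x y : ℝ, 0 ≤ x → 0 ≤ y →
      (Ω.measure ((L : Set V) + (x • (B : Set V) + y • (C : Set V)))).toReal = g ![1, x, y] := by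
    intro x y hx hy
    have := hfg ![1, x.toNNReal, y.toNNReal]
    simp only [Fin.sum_univ_three, Matrix.cons_val_zero, Matrix.cons_val_one, Matrix.cons_val,
      NNReal.smul_def, NNReal.coe_one, one_smul, Real.coe_toNNReal _ hx, Real.coe_toNNReal _ hy, add_assoc] at this
    rw [this]
    congr 1
    ext i
    fin_cases i <;> simp [hx, hy]
  have h0 : ∀ K : ConvexBody V, (0 : ℝ) • (K : Set V) = 0 := fun K => Set.zero_smul_set K.nonempty
  have hB := hasDerivWithinAt_unique (hasDerivWithinAt_measure_add_smul hΩ L B)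
    ((hd ![0, 1, 0]).congr (fun t ht => by
      have := hval t 0 ht le_rfl
      rw [h0, add_zero] at this
      simpa using this) (by
      have := hval 0 0 le_rfl le_rfl
      rw [h0, h0, add_zero] at this
      simpa [h0] using this))
  have hC := hasDerivWithinAt_unique (hasDerivWithinAt_measure_add_smul hΩ L C)
    ((hd ![0, 0, 1]).congr (fun t ht => by
      have := hval 0 t le_rfl ht
      rw [h0, zero_add] at this
      simpa using this) (by
      have := hval 0 0 le_rfl le_rfl
      rw [h0, h0, add_zero] at this
      simpa [h0] using this))
  have hBC := hasDerivWithinAt_unique (hasDerivWithinAt_measure_add_smul hΩ L (B + C))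
    ((hd ![0, 1, 1]).congr (fun t ht => by
      have := hval t t ht ht
      rw [← smul_add] at this
      simpa using this) (by
      have := hval 0 0 le_rfl le_rfl
      rw [h0, h0, add_zero] at this
      simpa [h0] using this))
  have hlin : fderiv ℝ g ![1, 0, 0] ![0, 1, 1] =
      fderiv ℝ g ![1, 0, 0] ![0, 1, 0] + fderiv ℝ g ![1, 0, 0] ![0, 0, 1] := by
    rw [← map_add]
    congr 1
    ext i
    fin_cases i <;> simp
  rw [← hB, ← hC, ← hBC, ← mul_add] at hlin
  exact mul_left_cancel₀ (by positivity) hlin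

/-- The difference vol(L + tC) - vol(L + tB) is non-negative and vanishes at t = 0, so its right
derivative there is non-negative. -/
theorem mixedVolumePair_mono (hΩ : Ω ≠ 0) (L : ConvexBody V) {B C : ConvexBody V}
    (h : (B : Set V) ⊆ C) : mixedVolumePair Ω 1 L B ≤ mixedVolumePair Ω 1 L C := by
  have := isAddHaarMeasure_measure hΩ
  have hd := (hasDerivWithinAt_measure_add_smul hΩ L C).sub
    (hasDerivWithinAt_measure_add_smul hΩ L B)
  have hnn := hasDerivWithinAt_nonneg hd fun t ht => by
    simp only [Pi.sub_apply]
    rw [Set.zero_smul_set B.nonempty, Set.zero_smul_set C.nonempty, sub_self, sub_nonneg]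
    refine ENNReal.toReal_mono (L.isCompact.add (C.isCompact.smul t)).measure_ne_top ?_
    exact measure_mono (Set.add_subset_add_left (Set.smul_set_mono h))
  rw [← mul_sub] at hnn
  exact sub_nonneg.1 (nonneg_of_mul_nonneg_right hnn (by positivity))

theorem mixedVolumePair_pointBody (hΩ : Ω ≠ 0) (L : ConvexBody V) (x : V) :
    mixedVolumePair Ω 1 L (pointBody x) = 0 := by
  have := isAddHaarMeasure_measure hΩ
  have h := hasDerivWithinAt_unique (hasDerivWithinAt_measure_add_smul hΩ L (pointBody x))
    ((hasDerivWithinAt_const (0 : ℝ) (Set.Ici 0) ((Ω.measure (L : Set V)).toReal)).congr_of_mem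
      (fun t _ => by
        change (Ω.measure ((L : Set V) + t • {x})).toReal = _
        rw [Set.smul_set_singleton, Set.add_singleton, Set.image_add_right,
          measure_preimage_add_right]) Set.self_mem_Ici)
  exact (mul_eq_zero_iff_left (by positivity)).1 h

theorem mixedVolumePair_nonneg (hΩ : Ω ≠ 0) (L B : ConvexBody V) :
    0 ≤ mixedVolumePair Ω 1 L B := by
  obtain ⟨x, hx⟩ := B.nonempty
  rw [← mixedVolumePair_pointBody hΩ L x]
  exact mixedVolumePair_mono hΩ L (Set.singleton_subset_iff.2 hx)

theorem mixedVolumePair_smul (hΩ : Ω ≠ 0) (L B : ConvexBody V) {c : ℝ} (hc : 0 ≤ c) :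
    mixedVolumePair Ω 1 L ((c • B : ConvexBody V) : Set V) = c * mixedVolumePair Ω 1 L B := by
  have hB := hasDerivWithinAt_measure_add_smul hΩ L B
  have hmul : HasDerivWithinAt (fun t : ℝ => t * c) c (Set.Ici 0) 0 := by
    simpa using ((hasDerivAt_id (0 : ℝ)).mul_const c).hasDerivWithinAt (s := Set.Ici 0)
  have hB' : HasDerivWithinAt (fun t : ℝ => (Ω.measure ((L : Set V) + t • (B : Set V))).toReal)
      ((m + 1) * mixedVolumePair Ω 1 L B) (Set.Ici 0) (0 * c) := by rwa [zero_mul]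
  have hcomp := HasDerivWithinAt.comp (h := fun t : ℝ => t * c) (0 : ℝ) hB' hmul
    fun t (ht : 0 ≤ t) => (mul_nonneg ht hc : 0 ≤ t * c)
  have h := hasDerivWithinAt_unique (hasDerivWithinAt_measure_add_smul hΩ L (c • B))
    (hcomp.congr_of_mem (fun t _ => by
      simp only [Function.comp_apply]
      rw [ConvexBody.coe_smul, smul_smul]) Set.self_mem_Ici)
  rw [mul_assoc] at h
  rw [mul_left_cancel₀ (by positivity) h, mul_comm]

/-- Differentiate vol(cL + tB) = c^(m+1) vol(L + t c⁻¹B). -/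
theorem mixedVolumePair_smul_left (hΩ : Ω ≠ 0) (L B : ConvexBody V) {c : ℝ} (hc : 0 < c) :
    mixedVolumePair Ω 1 ((c • L : ConvexBody V) : Set V) B =
      c ^ m * mixedVolumePair Ω 1 L B := by
  have hB := (hasDerivWithinAt_measure_add_smul hΩ L (c⁻¹ • B)).const_mul (c ^ (m + 1))
  have h := hasDerivWithinAt_unique (hasDerivWithinAt_measure_add_smul hΩ (c • L) B)
    (hB.congr_of_mem (fun t _ => by
      rw [← measure_smul_toReal _ hc.le hΩ, smul_add, ConvexBody.coe_smul, ConvexBody.coe_smul,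
        smul_smul, smul_smul]
      congr 5
      field_simp) Set.self_mem_Ici)
  rw [mixedVolumePair_smul hΩ L B (inv_nonneg.2 hc.le)] at h
  have h2 : c ^ (m + 1) * ((m + 1) * (c⁻¹ * mixedVolumePair Ω 1 L B)) =
      (m + 1) * (c ^ m * mixedVolumePair Ω 1 L B) := by
    rw [pow_succ]
    field_simp
  rw [h2] at h
  exact mul_left_cancel₀ (by positivity) h

theorem mixedVolumePair_self (hΩ : Ω ≠ 0) (B : ConvexBody V) :
    mixedVolumePair Ω 1 B B = (Ω.measure (B : Set V)).toReal := by
  have hpow : HasDerivWithinAt (fun t : ℝ => (1 + t) ^ (m + 1) * (Ω.measure (B : Set V)).toReal)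
      ((m + 1) * (Ω.measure (B : Set V)).toReal) (Set.Ici 0) 0 := by
    have h1 := (((hasDerivAt_id (0 : ℝ)).const_add 1).pow (m + 1)).mul_const
      (Ω.measure (B : Set V)).toReal
    simpa using h1.hasDerivWithinAt (s := Set.Ici 0)
  have h := hasDerivWithinAt_unique (hasDerivWithinAt_measure_add_smul hΩ B B)
    (hpow.congr_of_mem (fun t (ht : 0 ≤ t) => by
      rw [← measure_smul_toReal _ (by positivity) hΩ, B.convex.add_smul zero_le_one ht, one_smul])
      Set.self_mem_Ici)
  exact mul_left_cancel₀ (by positivity) h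

/-- Iterates the multiplicative Brunn–Minkowski inequality along (2^(k+1) - 1)L + B = 2^k L + ((2^k
- 1)L + B), so that no passage to n-th roots is needed. -/
theorem pow_le_measure_nsmul_add (hΩ : Ω ≠ 0) {L B : ConvexBody V}
    (hL : (Ω.measure (L : Set V)).toReal = 1) (hB : 1 ≤ (Ω.measure (B : Set V)).toReal) (k : ℕ) :
    ((2 : ℝ) ^ k) ^ (m + 1) ≤
      (Ω.measure (((2 : ℝ) ^ k - 1) • (L : Set V) + (B : Set V))).toReal := by
  have := isAddHaarMeasure_measure hΩ
  induction k with
  | zero => simpa [Set.zero_smul_set L.nonempty] using hB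
  | succ k ih =>
    have h1 : (1 : ℝ) ≤ 2 ^ k := one_le_pow₀ one_le_two
    have hset : ((2 : ℝ) ^ (k + 1) - 1) • (L : Set V) + (B : Set V) =
        (2 : ℝ) ^ k • (L : Set V) + (((2 : ℝ) ^ k - 1) • (L : Set V) + (B : Set V)) := by
      rw [← add_assoc, ← L.convex.add_smul (by positivity) (by linarith)]
      congr 2
      ring
    have hc1 : IsCompact ((2 : ℝ) ^ k • (L : Set V)) := L.isCompact.smul _
    have hc2 : IsCompact (((2 : ℝ) ^ k - 1) • (L : Set V) + (B : Set V)) :=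
      (L.isCompact.smul _).add B.isCompact
    have hbm := ENNReal.toReal_mono (ENNReal.pow_ne_top (hc1.add hc2).measure_ne_top)
      (four_pow_mul_measure_mul_measure_le Ω.measure hc1 hc2)
    rw [ENNReal.toReal_mul, ENNReal.toReal_mul, ENNReal.toReal_pow, ENNReal.toReal_pow,
      measure_smul_toReal _ (by positivity) hΩ, hL, mul_one, hV.out] at hbm
    rw [hset]
    refine le_of_sq_le_sq ?_ ENNReal.toReal_nonneg
    refine le_trans ?_ hbm
    have h4 : (ENNReal.toReal 4) = 4 := by simp
    rw [h4]
    calc (((2 : ℝ) ^ (k + 1)) ^ (m + 1)) ^ 2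
        = 4 ^ (m + 1) * ((2 ^ k) ^ (m + 1) * (2 ^ k) ^ (m + 1)) := by
          rw [← mul_pow, ← mul_pow, ← pow_mul, mul_comm (m + 1) 2, pow_mul]
          congr 1
          ring
      _ ≤ _ := by gcongr

/-- With r = 1/(2^(k+1) - 1), rescaling the dyadic bound gives vol(L + rB) ≥ (1 + r)^(m+1). By
Bernoulli the difference quotients along this sequence r → 0 are at least m + 1. -/
theorem one_le_mixedVolumePair (hΩ : Ω ≠ 0) {L B : ConvexBody V}
    (hL : (Ω.measure (L : Set V)).toReal = 1) (hB : (Ω.measure (B : Set V)).toReal = 1) :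
    1 ≤ mixedVolumePair Ω 1 L B := by
  have hd := (hasDerivWithinAt_iff_tendsto_slope' (by simp)).1
    ((hasDerivWithinAt_measure_add_smul hΩ L B).mono Set.Ioi_subset_Ici_self)
  have hpow : Filter.Tendsto (fun k : ℕ => (2 : ℝ) ^ (k + 1) - 1) Filter.atTop Filter.atTop :=
    Filter.tendsto_atTop_add_const_right _ _
      ((tendsto_pow_atTop_atTop_of_one_lt one_lt_two).comp (Filter.tendsto_add_atTop_nat 1))
  have hpos : ∀ k : ℕ, 0 < (2 : ℝ) ^ (k + 1) - 1 := fun k =>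
    sub_pos.2 (one_lt_pow₀ one_lt_two (Nat.succ_ne_zero k))
  have hr : Filter.Tendsto (fun k : ℕ => ((2 : ℝ) ^ (k + 1) - 1)⁻¹) Filter.atTop
      (nhdsWithin 0 (Set.Ioi 0)) :=
    tendsto_nhdsWithin_iff.2 ⟨tendsto_inv_atTop_zero.comp hpow,
      Filter.Eventually.of_forall fun k => inv_pos.2 (hpos k)⟩
  have hle := ge_of_tendsto (hd.comp hr) (b := (m + 1 : ℝ)) (Filter.Eventually.of_forall fun k => by
    set r := ((2 : ℝ) ^ (k + 1) - 1)⁻¹ with hrdef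
    have hr0 : 0 < r := inv_pos.2 (hpos k)
    have h1 := pow_le_measure_nsmul_add hΩ hL hB.ge (k + 1)
    have h2 : (L : Set V) + r • (B : Set V) =
        r • (((2 : ℝ) ^ (k + 1) - 1) • (L : Set V) + (B : Set V)) := by
      rw [smul_add, smul_smul, hrdef, inv_mul_cancel₀ (hpos k).ne', one_smul]
    have h3 : (1 + r) ^ (m + 1) ≤ (Ω.measure ((L : Set V) + r • (B : Set V))).toReal := by
      rw [h2, measure_smul_toReal _ hr0.le hΩ]
      refine le_trans (le_of_eq ?_) (mul_le_mul_of_nonneg_left h1 (by positivity))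
      rw [← mul_pow]
      congr 1
      have := hpos k
      rw [hrdef]
      field_simp
      ring
    have h4 := one_add_mul_le_pow (by linarith : (-2 : ℝ) ≤ r) (m + 1)
    simp only [Function.comp_apply, slope_def_field]
    rw [Set.zero_smul_set B.nonempty, add_zero, hL, sub_zero, le_div_iff₀ hr0]
    push_cast at h4
    linarith)
  nlinarith [(by positivity : (0 : ℝ) < m + 1)]

/-- **Minkowski's first inequality**. -/
theorem measure_pow_mul_measure_le_mixedVolumePair_pow (hΩ : Ω ≠ 0) (hm : 1 ≤ m)
    (L B : ConvexBody V) :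
    (Ω.measure (L : Set V)).toReal ^ m * (Ω.measure (B : Set V)).toReal ≤
      mixedVolumePair Ω 1 L B ^ (m + 1) := by
  have hnn := pow_nonneg (mixedVolumePair_nonneg hΩ L B) (m + 1)
  rcases (ENNReal.toReal_nonneg (a := Ω.measure (L : Set V))).eq_or_lt with hl | hl
  · rwa [← hl, zero_pow (by omega), zero_mul]
  rcases (ENNReal.toReal_nonneg (a := Ω.measure (B : Set V))).eq_or_lt with hb | hb
  · rwa [← hb, mul_zero]
  -- Both volumes are now positive, so L and B can be rescaled to volume 1.
  have hroot : ∀ x : ℝ, 0 < x → ∃ a : ℝ, 0 < a ∧ a ^ (m + 1) * x = 1 := fun x hx => by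
    refine ⟨x⁻¹ ^ ((m + 1 : ℕ) : ℝ)⁻¹, Real.rpow_pos_of_pos (inv_pos.2 hx) _, ?_⟩
    rw [Real.rpow_inv_natCast_pow (inv_nonneg.2 hx.le) (Nat.succ_ne_zero m),
      inv_mul_cancel₀ hx.ne']
  obtain ⟨a, ha, hal⟩ := hroot _ hl
  obtain ⟨b, hb0, hbb⟩ := hroot _ hb
  have h1 := one_le_mixedVolumePair hΩ (L := a • L) (B := b • B)
    (by rw [ConvexBody.coe_smul, measure_smul_toReal _ ha.le hΩ, hal])
    (by rw [ConvexBody.coe_smul, measure_smul_toReal _ hb0.le hΩ, hbb])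
  rw [mixedVolumePair_smul_left hΩ _ _ ha, mixedVolumePair_smul hΩ _ _ hb0.le] at h1
  have h2 := one_le_pow₀ h1 (n := m + 1)
  set l := (Ω.measure (L : Set V)).toReal
  set c := (Ω.measure (B : Set V)).toReal
  set v := mixedVolumePair Ω 1 L B
  calc l ^ m * c = l ^ m * c * 1 := (mul_one _).symm
    _ ≤ l ^ m * c * (a ^ m * (b * v)) ^ (m + 1) := by gcongr
    _ = (a ^ (m + 1) * l) ^ m * (b ^ (m + 1) * c) * v ^ (m + 1) := by
        rw [mul_pow, mul_pow, mul_pow, ← pow_mul, ← pow_mul, mul_comm m (m + 1)]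
        ring
    _ = v ^ (m + 1) := by rw [hal, hbb]; simp

end

/-! ### Support functions and surface area measures -/

section SupportFunction

variable {V : Type*} [NormedAddCommGroup V] [NormedSpace ℝ V]

/-- The support function of a convex body. -/
def supportFunction (C : ConvexBody V) (ξ : StrongDual ℝ V) : ℝ := sSup (ξ '' (C : Set V))

theorem bddAbove_image (C : ConvexBody V) (ξ : StrongDual ℝ V) : BddAbove (ξ '' (C : Set V)) :=
  (C.isCompact.image ξ.continuous).bddAbove

theorem le_supportFunction (C : ConvexBody V) (ξ : StrongDual ℝ V) {x : V} (hx : x ∈ (C : Set V)) :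
    ξ x ≤ supportFunction C ξ :=
  le_csSup (bddAbove_image C ξ) ⟨x, hx, rfl⟩

theorem supportFunction_le {C : ConvexBody V} {ξ : StrongDual ℝ V} {a : ℝ}
    (h : ∀ x ∈ (C : Set V), ξ x ≤ a) : supportFunction C ξ ≤ a :=
  csSup_le (C.nonempty.image _) (by rintro _ ⟨x, hx, rfl⟩; exact h x hx)

theorem continuous_supportFunction (C : ConvexBody V) : Continuous (supportFunction C) := by
  refine IsCompact.continuous_sSup (f := fun (ξ : StrongDual ℝ V) (x : V) => ξ x) C.isCompact ?_
  exact isBoundedBilinearMap_apply.continuous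

theorem supportFunction_add (C D : ConvexBody V) (ξ : StrongDual ℝ V) :
    supportFunction (C + D) ξ = supportFunction C ξ + supportFunction D ξ := by
  rw [supportFunction, ConvexBody.coe_add, Set.image_add,
    csSup_add (C.nonempty.image _) (bddAbove_image C ξ) (D.nonempty.image _) (bddAbove_image D ξ)]
  rfl

theorem supportFunction_smul (C : ConvexBody V) {c : ℝ} (hc : 0 ≤ c) (ξ : StrongDual ℝ V) :
    supportFunction (c • C) ξ = c * supportFunction C ξ := by
  rw [supportFunction, ConvexBody.coe_smul, Set.image_smul_comm _ _ _ (map_smul ξ c),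
    Real.sSup_smul_of_nonneg hc]
  rfl

theorem supportFunction_homogeneous (C : ConvexBody V) {c : ℝ} (hc : 0 ≤ c) (ξ : StrongDual ℝ V) :
    supportFunction C (c • ξ) = c * supportFunction C ξ := by
  have : (c • ξ) '' (C : Set V) = c • (ξ '' (C : Set V)) := by
    rw [← Set.image_smul, Set.image_image]
    rfl
  rw [supportFunction, this, Real.sSup_smul_of_nonneg hc]
  rfl

theorem supportFunction_segmentBody (v : V) (ξ : StrongDual ℝ V) :
    supportFunction (segmentBody v) ξ = max 0 (ξ v) := by
  refine le_antisymm (supportFunction_le ?_) (max_le ?_ ?_)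
  · rintro _ ⟨a, b, ha, hb, hab, rfl⟩
    rw [smul_zero, zero_add, map_smul, smul_eq_mul]
    rcases le_total 0 (ξ v) with h | h
    · exact le_max_of_le_right (by nlinarith)
    · exact le_max_of_le_left (by nlinarith)
  · have := le_supportFunction (segmentBody v) ξ (left_mem_segment ℝ 0 v)
    rwa [map_zero] at this
  · exact le_supportFunction (segmentBody v) ξ (right_mem_segment ℝ 0 v)

/-- Hahn–Banach separation, with the separating functional normalised to the unit sphere. -/
theorem subset_of_supportFunction_le {C D : ConvexBody V}
    (h : ∀ ξ : Metric.sphere (0 : StrongDual ℝ V) 1, supportFunction C ξ ≤ supportFunction D ξ) :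
    (C : Set V) ⊆ D := by
  intro x hx
  by_contra hxD
  obtain ⟨ξ, u, hξ, hu⟩ := geometric_hahn_banach_closed_point D.convex D.isClosed hxD
  have hξ0 : ξ ≠ 0 := by
    rintro rfl
    obtain ⟨y, hy⟩ := D.nonempty
    have h1 := hξ y hy
    simp only [zero_apply] at h1 hu
    linarith
  have hn : 0 < ‖ξ‖ := norm_pos_iff.2 hξ0
  have h1 := h ⟨‖ξ‖⁻¹ • ξ, by simp [norm_smul, hn.ne']⟩
  simp only [supportFunction_homogeneous _ (inv_nonneg.2 hn.le)] at h1
  have h2 := le_of_mul_le_mul_left h1 (inv_pos.2 hn)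
  have h3 := le_supportFunction C ξ hx
  have h4 := supportFunction_le (C := D) (ξ := ξ) fun y hy => (hξ y hy).le
  linarith

variable [FiniteDimensional ℝ V]

variable (V) in
/-- The closed unit ball as a convex body. -/
def unitBallBody : ConvexBody V :=
  ⟨Metric.closedBall 0 1, convex_closedBall 0 1, isCompact_closedBall 0 1,
    Metric.nonempty_closedBall.2 zero_le_one⟩

theorem one_le_supportFunction_unitBallBody (ξ : Metric.sphere (0 : StrongDual ℝ V) 1) :
    1 ≤ supportFunction (unitBallBody V) ξ := by
  have hξ : ‖(ξ : StrongDual ℝ V)‖ = 1 := by simp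
  refine hξ.symm.le.trans ?_
  have h0 : 0 ≤ supportFunction (unitBallBody V) ξ := by
    have := le_supportFunction (unitBallBody V) ξ (Metric.mem_closedBall_self zero_le_one)
    rwa [map_zero] at this
  have hle : ∀ x : V, (ξ : StrongDual ℝ V) x ≤ supportFunction (unitBallBody V) ξ * ‖x‖ := by
    intro x
    rcases eq_or_ne x 0 with rfl | hx
    · simp
    have hn : 0 < ‖x‖ := norm_pos_iff.2 hx
    have := le_supportFunction (unitBallBody V) ξ (x := ‖x‖⁻¹ • x) (by
      change _ ∈ Metric.closedBall _ _
      simp [norm_smul, hn.ne'])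
    rw [map_smul, smul_eq_mul, inv_mul_le_iff₀ hn] at this
    linarith
  refine ContinuousLinearMap.opNorm_le_bound _ h0 fun x => ?_
  rw [Real.norm_eq_abs, abs_le]
  have h1 := hle (-x)
  rw [map_neg, norm_neg] at h1
  exact ⟨by linarith, hle x⟩

open scoped CompactlySupported

instance : CompactSpace (Metric.sphere (0 : StrongDual ℝ V) 1) :=
  isCompact_iff_compactSpace.1 (isCompact_sphere _ _)

/-- The restriction of the support function to the unit sphere of the dual space. -/
def supportOnSphere (C : ConvexBody V) : C_c(Metric.sphere (0 : StrongDual ℝ V) 1, ℝ) where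
  toFun ξ := supportFunction C ξ
  continuous_toFun := (continuous_supportFunction C).comp continuous_subtype_val
  hasCompactSupport' := HasCompactSupport.of_compactSpace _

/-- A Minkowski additive, positively homogeneous, monotone functional on convex bodies is given by
integration of the support function against a finite measure. -/
theorem exists_measure_integral_supportFunction (w : ConvexBody V → ℝ)
    (hadd : ∀ B C, w (B + C) = w B + w C) (hsmul : ∀ (c : ℝ) B, 0 ≤ c → w (c • B) = c * w B)
    (hmono : ∀ B C : ConvexBody V, (B : Set V) ⊆ C → w B ≤ w C) :
    ∃ S : Measure (Metric.sphere (0 : StrongDual ℝ V) 1), IsFiniteMeasure S ∧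
      ∀ C, w C = ∫ ξ, supportFunction C ξ ∂S := by
  let X := Metric.sphere (0 : StrongDual ℝ V) 1
  -- N(f) is the infimum of w(C) - w(D) over differences h_C - h_D dominating f on the sphere. It is
  -- a sublinear functional, to which Hahn–Banach applies.
  let s : C_c(X, ℝ) → Set ℝ := fun f =>
    {a | ∃ C D : ConvexBody V, (∀ ξ : X, f ξ ≤ supportFunction C ξ - supportFunction D ξ) ∧
      a = w C - w D}
  let N : C_c(X, ℝ) → ℝ := fun f => sInf (s f)
  have hbound : ∀ f : C_c(X, ℝ), ∃ k : ℝ, 0 ≤ k ∧ ∀ ξ, |f ξ| ≤ k := by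
    intro f
    obtain ⟨k, hk⟩ := isCompact_univ.exists_bound_of_continuousOn f.continuous.continuousOn
    exact ⟨max k 0, le_max_right _ _, fun ξ => (hk ξ trivial).trans (le_max_left _ _)⟩
  have hne : ∀ f, (s f).Nonempty := by
    intro f
    obtain ⟨k, hk0, hk⟩ := hbound f
    refine ⟨_, k • unitBallBody V, (0 : ℝ) • unitBallBody V, fun ξ => ?_, rfl⟩
    rw [supportFunction_smul _ hk0, supportFunction_smul _ le_rfl, zero_mul, sub_zero]
    have h1 := one_le_supportFunction_unitBallBody ξ
    have h2 := (le_abs_self _).trans (hk ξ)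
    nlinarith
  have hbdd : ∀ f, BddBelow (s f) := by
    intro f
    obtain ⟨k, hk0, hk⟩ := hbound f
    refine ⟨-(k * w (unitBallBody V)), ?_⟩
    rintro _ ⟨C, D, hCD, rfl⟩
    -- From h_C - h_D ≥ f ≥ -k and the unit ball having support function at least 1 on the sphere, D
    -- lies in C + k · ball; monotonicity bounds N(f) below.
    have h1 := hmono D (C + k • unitBallBody V) (subset_of_supportFunction_le fun ξ => by
      rw [supportFunction_add, supportFunction_smul _ hk0]
      have h1 := one_le_supportFunction_unitBallBody ξ
      have h2 := (abs_le.1 (hk ξ)).1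
      have h3 := hCD ξ
      nlinarith)
    rw [hadd, hsmul _ _ hk0] at h1
    linarith
  have hN_add : ∀ f g, N (f + g) ≤ N f + N g := by
    intro f g
    rw [← csInf_add (hne f) (hbdd f) (hne g) (hbdd g)]
    refine csInf_le_csInf (hbdd _) ((hne f).add (hne g)) ?_
    rintro _ ⟨_, ⟨C, D, h, rfl⟩, _, ⟨C', D', h', rfl⟩, rfl⟩
    refine ⟨C + C', D + D', fun ξ => ?_, ?_⟩
    · have h1 := h ξ
      have h2 := h' ξ
      rw [supportFunction_add, supportFunction_add]
      simp only [CompactlySupportedContinuousMap.coe_add, Pi.add_apply]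
      linarith
    · simp only [hadd]
      ring
  have hN_le : ∀ (c : ℝ), 0 < c → ∀ f, N (c • f) ≤ c * N f := by
    intro c hc f
    change _ ≤ c • sInf (s f)
    rw [← Real.sInf_smul_of_nonneg hc.le]
    refine csInf_le_csInf (hbdd _) (hne f).smul_set ?_
    rintro _ ⟨_, ⟨C, D, h, rfl⟩, rfl⟩
    refine ⟨c • C, c • D, fun ξ => ?_, ?_⟩
    · rw [supportFunction_smul _ hc.le, supportFunction_smul _ hc.le, ← mul_sub]
      exact mul_le_mul_of_nonneg_left (h ξ) hc.le
    · simp only [hsmul _ _ hc.le, smul_eq_mul]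
      ring
  have hN_hom : ∀ (c : ℝ), 0 < c → ∀ f, N (c • f) = c * N f := by
    intro c hc f
    refine le_antisymm (hN_le c hc f) ?_
    have h1 := hN_le c⁻¹ (inv_pos.2 hc) (c • f)
    rw [smul_smul, inv_mul_cancel₀ hc.ne', one_smul] at h1
    rwa [le_inv_mul_iff₀ hc] at h1
  have hN_zero : N 0 = 0 := by
    have := hN_hom 2 two_pos 0
    rw [smul_zero] at this
    linarith
  obtain ⟨Λ, -, hΛ⟩ := exists_extension_of_le_sublinear (⊥ : C_c(X, ℝ) →ₗ.[ℝ] ℝ) N hN_hom hN_add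
    (by
      rintro ⟨x, hx⟩
      have hx0 : x = 0 := hx
      subst hx0
      have : (⊥ : C_c(X, ℝ) →ₗ.[ℝ] ℝ) ⟨0, hx⟩ = 0 := LinearPMap.map_zero _
      rw [this, hN_zero])
  have hw0 : w ((0 : ℝ) • unitBallBody V) = 0 := by rw [hsmul _ _ le_rfl, zero_mul]
  have hnonneg : ∀ f : C_c(X, ℝ), 0 ≤ f → 0 ≤ Λ f := by
    intro f hf
    have h1 : Λ (-f) ≤ 0 := (hΛ (-f)).trans (csInf_le (hbdd _)
      ⟨(0 : ℝ) • unitBallBody V, (0 : ℝ) • unitBallBody V, fun ξ => by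
        have : 0 ≤ f ξ := hf ξ
        rw [sub_self]
        simpa using this, by rw [sub_self]⟩)
    rw [map_neg] at h1
    linarith
  -- Bounding Λ by N at both h_C and -h_C pins down its value.
  have hval : ∀ C, Λ (supportOnSphere C) = w C := by
    intro C
    refine le_antisymm ((hΛ _).trans (csInf_le (hbdd _)
      ⟨C, (0 : ℝ) • unitBallBody V, fun ξ => ?_, by rw [hw0, sub_zero]⟩)) ?_
    · rw [supportFunction_smul _ le_rfl, zero_mul, sub_zero]
      exact le_rfl
    · have h1 := (hΛ (-supportOnSphere C)).trans (csInf_le (hbdd _)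
        ⟨(0 : ℝ) • unitBallBody V, C, fun ξ => by
          rw [supportFunction_smul _ le_rfl, zero_mul, zero_sub]
          exact le_rfl, rfl⟩)
      rw [map_neg, hw0] at h1
      linarith
  let P : C_c(X, ℝ) →ₚ[ℝ] ℝ := PositiveLinearMap.mk₀ Λ hnonneg
  refine ⟨RealRMK.rieszMeasure P, inferInstance, fun C => ?_⟩
  rw [← hval]
  exact (RealRMK.integral_rieszMeasure P (supportOnSphere C)).symm

end SupportFunction

/-! ### Surface area measures and the symmetry of V₁ under projection bodies -/

section Symmetry

variable {V : Type*} [NormedAddCommGroup V] [NormedSpace ℝ V] [FiniteDimensional ℝ V]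
  {m : ℕ} [hV : Fact (finrank ℝ V = m + 1)]

variable (V) in
/-- The canonical isometry onto the double dual. -/
def doubleDualEquiv : V ≃ₗᵢ[ℝ] StrongDual ℝ (StrongDual ℝ V) :=
  (NormedSpace.inclusionInDoubleDualLi ℝ).toLinearIsometryEquiv (by
    have h1 : finrank ℝ V = m + 1 := hV.out
    have h2 : finrank ℝ (StrongDual ℝ (StrongDual ℝ V)) = m + 1 := Fact.out
    rw [h1, h2])

theorem doubleDualEquiv_apply (x : V) (ξ : StrongDual ℝ V) :
    doubleDualEquiv V (m := m) x ξ = ξ x := rfl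

variable [MeasurableSpace V] [BorelSpace V] {Ω : V [⋀^Fin (m + 1)]→ₗ[ℝ] ℝ}

/-- S plays the role of the surface area measure of L, with the usual factor 1/n absorbed. -/
theorem exists_surfaceAreaMeasure (hΩ : Ω ≠ 0) (L : ConvexBody V) :
    ∃ S : Measure (Metric.sphere (0 : StrongDual ℝ V) 1), IsFiniteMeasure S ∧
      ∀ C : ConvexBody V, mixedVolumePair Ω 1 L C = ∫ ξ, supportFunction C ξ ∂S := by
  refine exists_measure_integral_supportFunction
    (fun C : ConvexBody V => mixedVolumePair Ω 1 (L : Set V) (C : Set V)) ?_ ?_ ?_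
  · intro B C
    exact mixedVolumePair_add hΩ L B C
  · intro c B hc
    exact mixedVolumePair_smul hΩ L B hc
  · intro B C h
    exact mixedVolumePair_mono hΩ L h

/-- The support function of the projection body, as a mixed volume. -/
def projectionSupport (Ω : V [⋀^Fin (m + 1)]→ₗ[ℝ] ℝ) (L : Set V) (v : V) : ℝ :=
  (m + 1) * mixedVolumePair Ω 1 L (segmentBody v)

/-- The symmetry `V₁(L, Π M) = V₁(M, Π L)`. -/
theorem mixedVolumePair_projection_symm (hΩ : Ω ≠ 0)
    {Ω' : (StrongDual ℝ V) [⋀^Fin (m + 1)]→ₗ[ℝ] ℝ} (hΩ' : Ω' ≠ 0)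
    (L B : ConvexBody V) (M Z : ConvexBody (StrongDual ℝ V))
    (hB : ∀ ξ, supportFunction B ξ = projectionSupport Ω' M ξ)
    (hZ : ∀ v, supportFunction Z (doubleDualEquiv V (m := m) v) = projectionSupport Ω L v) :
    mixedVolumePair Ω 1 L B = mixedVolumePair Ω' 1 M Z := by
  obtain ⟨S, hS, hSL⟩ := exists_surfaceAreaMeasure hΩ L
  obtain ⟨T, hT, hTM⟩ := exists_surfaceAreaMeasure hΩ' M
  rw [hSL B, hTM Z]
  -- The segment [0, v] has support function max(0, ξ(v)), so both sides become double integrals of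
  -- the same kernel max(0, η(ξ)) against S and T.
  have h1 : ∀ ξ, supportFunction B ξ = (m + 1) *
      ∫ η : Metric.sphere (0 : StrongDual ℝ (StrongDual ℝ V)) 1,
        max 0 ((η : StrongDual ℝ (StrongDual ℝ V)) ξ) ∂T := by
    intro ξ
    rw [hB, projectionSupport, hTM]
    simp only [supportFunction_segmentBody]
  have h2 : ∀ η, supportFunction Z η = (m + 1) *
      ∫ ξ : Metric.sphere (0 : StrongDual ℝ V) 1, max 0 (η ξ) ∂S := by
    intro η
    obtain ⟨v, rfl⟩ := (doubleDualEquiv V (m := m)).surjective η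
    rw [hZ, projectionSupport, hSL]
    simp only [supportFunction_segmentBody, doubleDualEquiv_apply]
  simp only [h1, h2, integral_const_mul]
  congr 1
  refine integral_integral_swap_of_hasCompactSupport
    (f := fun (ξ : Metric.sphere (0 : StrongDual ℝ V) 1)
      (η : Metric.sphere (0 : StrongDual ℝ (StrongDual ℝ V)) 1) =>
      max 0 ((η : StrongDual ℝ (StrongDual ℝ V)) ξ)) ?_ (HasCompactSupport.of_compactSpace _)
  refine continuous_const.max ?_
  exact isBoundedBilinearMap_apply.continuous.comp
    ((continuous_subtype_val.comp continuous_snd).prodMk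
      (continuous_subtype_val.comp continuous_fst))

end Symmetry

/-! ### Volumes of shadows -/

/-- Fibrewise: over each point of the projection the fibre of K is a compact interval, which the sum
lengthens by exactly t; elsewhere both fibres are empty. -/
theorem prod_measure_add_Icc {Q : Type*} [NormedAddCommGroup Q] [NormedSpace ℝ Q]
    [MeasurableSpace Q] [BorelSpace Q] [SecondCountableTopology Q] (ν : Measure Q) [SFinite ν]
    {K : Set (ℝ × Q)} (hK : IsCompact K) (hconv : Convex ℝ K) {t : ℝ} (ht : 0 ≤ t) :
    ((volume : Measure ℝ).prod ν) (K + Set.Icc 0 t ×ˢ {0}) =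
      ((volume : Measure ℝ).prod ν) K + ENNReal.ofReal t * ν (Prod.snd '' K) := by
  have hK' : IsCompact (K + Set.Icc (0 : ℝ) t ×ˢ {(0 : Q)}) :=
    hK.add (isCompact_Icc.prod isCompact_singleton)
  have hP : MeasurableSet (Prod.snd '' K) := (hK.image continuous_snd).measurableSet
  rw [Measure.prod_apply_symm hK'.measurableSet, Measure.prod_apply_symm hK.measurableSet,
    ← lintegral_indicator_const hP, ← lintegral_add_right _ (measurable_const.indicator hP)]
  refine lintegral_congr fun y => ?_
  set A : Set ℝ := (fun x => (x, y)) ⁻¹' K with hA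
  have hfib : (fun x => (x, y)) ⁻¹' (K + Set.Icc (0 : ℝ) t ×ˢ {(0 : Q)}) = A + Set.Icc 0 t := by
    ext x
    simp only [Set.mem_preimage, Set.mem_add, hA, Set.mem_prod, Set.mem_singleton_iff]
    constructor
    · rintro ⟨⟨a, z⟩, ha, ⟨b, w⟩, ⟨hb, hw⟩, hab⟩
      simp only [Prod.mk_add_mk, Prod.mk.injEq] at hab hw
      rw [hw, add_zero] at hab
      exact ⟨a, by rw [← hab.2]; exact ha, b, hb, hab.1⟩
    · rintro ⟨a, ha, b, hb, hab⟩
      exact ⟨(a, y), ha, (b, 0), ⟨hb, rfl⟩, by simp [hab]⟩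
  rw [hfib]
  by_cases hy : y ∈ Prod.snd '' K
  · have hne : A.Nonempty := by
      obtain ⟨⟨x, _⟩, hx, rfl⟩ := hy
      exact ⟨x, hx⟩
    have hcomp : IsCompact A := by
      have : A = Prod.fst '' (K ∩ (Set.univ ×ˢ {y})) := by
        ext x
        simp [hA]
      rw [this]
      exact (hK.inter_right (isClosed_univ.prod isClosed_singleton)).image continuous_fst
    have hAconv : Convex ℝ A := by
      intro a ha b hb p q hp hq hpq
      have := hconv ha hb hp hq hpq
      simp only [Prod.smul_mk, Prod.mk_add_mk, ← add_smul, hpq, one_smul] at this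
      exact this
    have hIcc := eq_Icc_of_connected_compact ⟨hne, hAconv.isPreconnected⟩ hcomp
    have hle : sInf A ≤ sSup A := Real.sInf_le_sSup A hcomp.bddBelow hcomp.bddAbove
    rw [Set.indicator_of_mem hy]
    generalize sInf A = a at hIcc hle
    generalize sSup A = b at hIcc hle
    rw [hIcc, Set.Icc_add_Icc hle ht, Real.volume_Icc, Real.volume_Icc,
      ← ENNReal.ofReal_add (sub_nonneg.2 hle) ht]
    congr 1
    ring
  · have hempty : A = ∅ := by
      rw [Set.eq_empty_iff_forall_notMem]
      exact fun x hx => hy ⟨(x, y), hx, rfl⟩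
    rw [hempty, Set.empty_add, Set.indicator_of_notMem hy]
    simp

section Shadow

variable {V : Type*} [NormedAddCommGroup V] [NormedSpace ℝ V] [FiniteDimensional ℝ V]
  {m : ℕ} [hV : Fact (finrank ℝ V = m + 1)]
  {Q : Type*} [NormedAddCommGroup Q] [NormedSpace ℝ Q] [FiniteDimensional ℝ Q]
  [hQ : Fact (finrank ℝ Q = m)]

/-- The isomorphism `(r, y) ↦ r v + s y` for a section `s` of a projection along `v`. -/
def splitEquiv (π : V →ₗ[ℝ] Q) (s : Q →ₗ[ℝ] V) (hs : ∀ y, π (s y) = y) {v : V} (hv : v ≠ 0)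
    (hπ : π v = 0) : (ℝ × Q) ≃L[ℝ] V :=
  (LinearMap.linearEquivOfInjective
    (((LinearMap.toSpanSingleton ℝ V v).coprod s : ℝ × Q →ₗ[ℝ] V)) (by
      rw [← LinearMap.ker_eq_bot, LinearMap.ker_eq_bot']
      rintro ⟨r, y⟩ h
      simp only [LinearMap.coprod_apply, LinearMap.toSpanSingleton_apply] at h
      have hy : y = 0 := by simpa [hπ, hs] using congrArg π h
      subst hy
      have hr : r = 0 := by simpa [hv] using h
      rw [hr]
      rfl) (by
      rw [finrank_prod, finrank_self, hQ.out, hV.out, add_comm])).toContinuousLinearEquiv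

variable {π : V →ₗ[ℝ] Q} {s : Q →ₗ[ℝ] V} {v : V}

theorem splitEquiv_apply (hs : ∀ y, π (s y) = y) (hv : v ≠ 0) (hπ : π v = 0) (r : ℝ) (y : Q) :
    splitEquiv (m := m) π s hs hv hπ (r, y) = r • v + s y := by
  rfl

variable [MeasurableSpace V] [BorelSpace V] [MeasurableSpace Q] [BorelSpace Q]
  {Ω : V [⋀^Fin (m + 1)]→ₗ[ℝ] ℝ} {η : Q [⋀^Fin m]→ₗ[ℝ] ℝ}

/-- Both sides are Haar measures, so it suffices to compare them on one parallelepiped, spanned by v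
and the lift of a basis of Q. The relation between η and Ω makes the two values agree. -/
theorem measure_eq_map_splitEquiv (hΩ : Ω ≠ 0) (hs : ∀ y, π (s y) = y) (hv : v ≠ 0)
    (hπ : π v = 0) (hη : ∀ w : Fin m → V, η (fun i => π (w i)) = Ω (Fin.cons v w)) :
    Ω.measure = ((volume : Measure ℝ).prod η.measure).map (splitEquiv (m := m) π s hs hv hπ) := by
  set T := splitEquiv (m := m) π s hs hv hπ with hT
  let c := finBasisOfFinrankEq ℝ Q hQ.out
  have hli : LinearIndependent ℝ (Fin.cons v (fun i => s (c i)) : Fin (m + 1) → V) := by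
    refine linearIndependent_finCons.2 ⟨c.linearIndependent.map' s ?_, ?_⟩
    · rw [LinearMap.ker_eq_bot]
      exact Function.LeftInverse.injective hs
    · intro hmem
      have : v ∈ LinearMap.range s := by
        refine Submodule.span_le.2 ?_ hmem
        rintro _ ⟨i, rfl⟩
        exact ⟨c i, rfl⟩
      obtain ⟨y, rfl⟩ := this
      rw [hs] at hπ
      exact hv (by rw [hπ, map_zero])
  have hne : Ω (Fin.cons v fun i => s (c i)) ≠ 0 := by
    let b := basisOfLinearIndependentOfCardEqFinrank hli (by rw [hV.out, Fintype.card_fin])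
    have := (Ω.map_basis_ne_zero_iff b).2 hΩ
    rwa [coe_basisOfLinearIndependentOfCardEqFinrank] at this
  have hηc : η c = Ω (Fin.cons v fun i => s (c i)) := by
    rw [← hη]
    congr 1
    ext i
    rw [hs]
  have hη0 : η ≠ 0 := by
    rintro rfl
    exact hne hηc.symm
  have := isAddHaarMeasure_measure hΩ
  have := isAddHaarMeasure_measure hη0
  have : (((volume : Measure ℝ).prod η.measure).map T).IsAddHaarMeasure :=
    T.isAddHaarMeasure_map _
  have h := Measure.isAddLeftInvariant_eq_smul Ω.measure
    (((volume : Measure ℝ).prod η.measure).map T)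
  set κ := Ω.measure.addHaarScalarFactor (((volume : Measure ℝ).prod η.measure).map T)
  have hpre : parallelepiped (Fin.cons v fun i => s (c i) : Fin (m + 1) → V) =
      T '' (Set.Icc 0 1 ×ˢ parallelepiped c) := by
    ext x
    simp only [mem_parallelepiped_iff, Set.mem_image, Set.mem_prod, Prod.exists]
    constructor
    · rintro ⟨t, ht, rfl⟩
      refine ⟨t 0, ∑ i, t i.succ • c i, ⟨⟨ht.1 0, ht.2 0⟩, fun i => t i.succ,
        ⟨fun i => ht.1 _, fun i => ht.2 _⟩, rfl⟩, ?_⟩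
      rw [hT, splitEquiv_apply, Fin.sum_univ_succ]
      simp
    · rintro ⟨r, y, ⟨hr, t, ht, rfl⟩, rfl⟩
      refine ⟨Fin.cons r t, ⟨fun i => ?_, fun i => ?_⟩, ?_⟩
      · refine Fin.cases ?_ (fun j => ?_) i
        · exact hr.1
        · exact ht.1 j
      · refine Fin.cases ?_ (fun j => ?_) i
        · exact hr.2
        · exact ht.2 j
      · rw [hT, splitEquiv_apply, Fin.sum_univ_succ]
        simp
  have h1 := Ω.measure_parallelepiped (Fin.cons v fun i => s (c i))
  rw [h, Measure.smul_apply, hpre, map_equiv_apply_image, Measure.prod_prod,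
    η.measure_parallelepiped, hηc, Real.volume_Icc, sub_zero, ENNReal.ofReal_one, one_mul] at h1
  have h2 : κ = 1 := by
    have h3 : ENNReal.ofReal |Ω (Fin.cons v fun i => s (c i))| ≠ 0 := by simpa using hne
    have h4 : (κ : ℝ≥0∞) * ENNReal.ofReal |Ω (Fin.cons v fun i => s (c i))| =
      1 * ENNReal.ofReal |Ω (Fin.cons v fun i => s (c i))| := by rw [one_mul]; exact h1
    exact_mod_cast (ENNReal.mul_left_inj h3 ENNReal.ofReal_ne_top).1 h4
  rw [h, h2, one_smul]

theorem measure_add_smul_segment (hΩ : Ω ≠ 0) (hs : ∀ y, π (s y) = y) (hv : v ≠ 0)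
    (hπ : π v = 0) (hη : ∀ w : Fin m → V, η (fun i => π (w i)) = Ω (Fin.cons v w))
    (L : ConvexBody V) {t : ℝ} (ht : 0 ≤ t) :
    Ω.measure ((L : Set V) + t • segment ℝ 0 v) =
      Ω.measure (L : Set V) + ENNReal.ofReal t * η.measure (π '' L) := by
  rw [measure_eq_map_splitEquiv hΩ hs hv hπ hη]
  set T := splitEquiv (m := m) π s hs hv hπ with hT
  have hTL : (L : Set V) = T '' (T ⁻¹' (L : Set V)) := (Set.image_preimage_eq _ T.surjective).symm
  have hseg : t • segment ℝ 0 v = T '' (Set.Icc 0 t ×ˢ {0}) := by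
    ext x
    simp only [segment_eq_image, smul_zero, zero_add, Set.mem_smul_set, Set.mem_image,
      Set.mem_prod, Set.mem_singleton_iff, Prod.exists]
    constructor
    · rintro ⟨_, ⟨θ, hθ, rfl⟩, rfl⟩
      refine ⟨t * θ, 0, ⟨⟨mul_nonneg ht hθ.1, mul_le_of_le_one_right ht hθ.2⟩, rfl⟩, ?_⟩
      rw [hT, splitEquiv_apply, map_zero, add_zero, smul_smul]
    · rintro ⟨r, y, ⟨hr, rfl⟩, rfl⟩
      refine ⟨(r / t) • v, ⟨r / t, ⟨div_nonneg hr.1 ht, div_le_one_of_le₀ hr.2 ht⟩, rfl⟩, ?_⟩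
      rw [hT, splitEquiv_apply, map_zero, add_zero, smul_smul]
      rcases ht.eq_or_lt with h | h
      · subst h
        rw [zero_mul, le_antisymm hr.2 hr.1]
      · rw [mul_div_cancel₀ _ h.ne']
  have hsnd : π '' (L : Set V) = Prod.snd '' (T ⁻¹' (L : Set V)) := by
    conv_lhs => rw [hTL]
    rw [Set.image_image]
    refine Set.image_congr fun z _ => ?_
    obtain ⟨r, y⟩ := z
    rw [hT, splitEquiv_apply]
    simp [hπ, hs]
  have hK : IsCompact (T ⁻¹' (L : Set V)) := T.toHomeomorph.isCompact_preimage.2 L.isCompact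
  have hconv : Convex ℝ (T ⁻¹' (L : Set V)) := L.convex.is_linear_preimage ⟨T.map_add, T.map_smul⟩
  rw [hseg, hsnd]
  conv_lhs => rw [hTL, ← Set.image_add, map_equiv_apply_image]
  conv_rhs => rw [hTL, map_equiv_apply_image]
  rw [prod_measure_add_Icc _ hK hconv ht, Set.preimage_image_eq _ T.injective]

end Shadow

section

variable {V : Type*} [NormedAddCommGroup V] [NormedSpace ℝ V] [FiniteDimensional ℝ V]
  {m : ℕ} [hV : Fact (finrank ℝ V = m + 1)] [MeasurableSpace V] [BorelSpace V]
  {Ω : V [⋀^Fin (m + 1)]→ₗ[ℝ] ℝ}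

theorem measure_add_smul_segment_eq_shadowVolume (hΩ : Ω ≠ 0) (L : ConvexBody V) {v : V}
    (hv : v ≠ 0) {t : ℝ} (ht : 0 ≤ t) :
    Ω.measure ((L : Set V) + t • segment ℝ 0 v) =
      Ω.measure (L : Set V) + ENNReal.ofReal t * shadowVolume Ω L v hv := by
  unfold shadowVolume
  let : MeasurableSpace (V ⧸ Submodule.span ℝ {v}) := borel _
  have : BorelSpace (V ⧸ Submodule.span ℝ {v}) := ⟨rfl⟩
  have : IsClosed ((Submodule.span ℝ {v} : Submodule ℝ V) : Set V) :=
    Submodule.closed_of_finiteDimensional _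
  have : Fact (finrank ℝ (V ⧸ Submodule.span ℝ {v}) = m) := ⟨by
    have h1 := (Submodule.span ℝ {v}).finrank_quotient_add_finrank
    rw [finrank_span_singleton hv, hV.out] at h1
    omega⟩
  exact measure_add_smul_segment hΩ (mkQ_quotSection v) hv
    ((Submodule.Quotient.mk_eq_zero _).2 (Submodule.mem_span_singleton_self v))
    (contraction_mkQ Ω v) L ht

/-- Needed because `projectionBody` uses `toReal`, which would turn an infinite shadow into 0. -/
theorem shadowVolume_ne_top (hΩ : Ω ≠ 0) (L : ConvexBody V) {v : V} (hv : v ≠ 0) :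
    shadowVolume Ω L v hv ≠ ∞ := by
  have := isAddHaarMeasure_measure hΩ
  have h := measure_add_smul_segment_eq_shadowVolume hΩ L hv zero_le_one
  rw [ENNReal.ofReal_one, one_mul, one_smul] at h
  refine ne_top_of_le_ne_top ?_ (le_add_self.trans_eq h.symm)
  exact (L.isCompact.add (segmentBody v).isCompact).measure_ne_top

theorem projectionSupport_eq_shadowVolume (hΩ : Ω ≠ 0) (L : ConvexBody V) {v : V} (hv : v ≠ 0) :
    projectionSupport Ω L v = (shadowVolume Ω L v hv).toReal := by
  have := isAddHaarMeasure_measure hΩ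
  have hlin : HasDerivWithinAt (fun t : ℝ => (Ω.measure (L : Set V)).toReal +
      t * (shadowVolume Ω L v hv).toReal) (shadowVolume Ω L v hv).toReal (Set.Ici 0) 0 := by
    simpa using (((hasDerivAt_id (0 : ℝ)).mul_const
      (shadowVolume Ω L v hv).toReal).const_add
        (Ω.measure (L : Set V)).toReal).hasDerivWithinAt (s := Set.Ici 0)
  refine hasDerivWithinAt_unique (hasDerivWithinAt_measure_add_smul hΩ L (segmentBody v))
    (hlin.congr_of_mem (fun t (ht : 0 ≤ t) => ?_) Set.self_mem_Ici)
  change (Ω.measure ((L : Set V) + t • segment ℝ 0 v)).toReal = _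
  rw [measure_add_smul_segment_eq_shadowVolume hΩ L hv ht, ENNReal.toReal_add
    L.isCompact.measure_ne_top (ENNReal.mul_ne_top ENNReal.ofReal_ne_top
      (shadowVolume_ne_top hΩ L hv)), ENNReal.toReal_mul, ENNReal.toReal_ofReal ht]

/-- If L lies in the ball of radius R and ‖tv‖ = 2R + 1, then L and L + tv are disjoint subsets of L
+ t[0, v], so t vol(π_v L) ≥ vol(L). The bound puts a neighbourhood of 0 inside ΠL. -/
theorem exists_pos_mul_norm_le_projectionSupport (hΩ : Ω ≠ 0) (L : ConvexBody V)
    (hL : (interior (L : Set V)).Nonempty) :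
    ∃ c : ℝ, 0 < c ∧ ∀ v, c * ‖v‖ ≤ projectionSupport Ω L v := by
  have := isAddHaarMeasure_measure hΩ
  obtain ⟨R, hR⟩ := L.isCompact.isBounded.subset_closedBall 0
  have hR0 : 0 ≤ R := by
    obtain ⟨x, hx⟩ := L.nonempty
    exact (norm_nonneg x).trans (mem_closedBall_zero_iff.1 (hR hx))
  have hvol : 0 < (Ω.measure (L : Set V)).toReal :=
    ENNReal.toReal_pos (Measure.measure_pos_of_nonempty_interior _ hL).ne'
      L.isCompact.measure_ne_top
  refine ⟨(Ω.measure (L : Set V)).toReal / (2 * R + 1), by positivity, fun v => ?_⟩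
  rcases eq_or_ne v 0 with rfl | hv
  · rw [norm_zero, mul_zero]
    exact mul_nonneg (by positivity) (mixedVolumePair_nonneg hΩ L _)
  have hn : 0 < ‖v‖ := norm_pos_iff.2 hv
  rw [projectionSupport_eq_shadowVolume hΩ L hv]
  set t := (2 * R + 1) / ‖v‖ with ht
  have ht0 : 0 < t := by positivity
  have hdisj : Disjoint (L : Set V) ((L : Set V) + {t • v}) := by
    rw [Set.disjoint_left]
    rintro x hx ⟨y, hy, _, rfl, hxy⟩
    have h1 := mem_closedBall_zero_iff.1 (hR hx)
    have h2 := mem_closedBall_zero_iff.1 (hR hy)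
    have h3 : t • v = x - y := by rw [← hxy]; simp
    have h4 : ‖t • v‖ = 2 * R + 1 := by
      rw [norm_smul, Real.norm_of_nonneg ht0.le, ht, div_mul_cancel₀ _ hn.ne']
    rw [h3] at h4
    have := norm_sub_le x y
    linarith
  have hsub : (L : Set V) ∪ ((L : Set V) + {t • v}) ⊆ (L : Set V) + t • segment ℝ 0 v := by
    refine Set.union_subset (fun x hx => ⟨x, hx, 0, ?_, add_zero x⟩) (Set.add_subset_add_left ?_)
    · exact ⟨0, left_mem_segment ℝ 0 v, smul_zero t⟩
    · rw [Set.singleton_subset_iff]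
      exact ⟨v, right_mem_segment ℝ 0 v, rfl⟩
  have hle := measure_mono (μ := Ω.measure) hsub
  have htr : Ω.measure ((L : Set V) + {t • v}) = Ω.measure (L : Set V) := by
    rw [Set.add_singleton, Set.image_add_right, measure_preimage_add_right]
  rw [measure_union hdisj (L.isCompact.add isCompact_singleton).measurableSet, htr,
    measure_add_smul_segment_eq_shadowVolume hΩ L hv ht0.le,
    ENNReal.add_le_add_iff_left L.isCompact.measure_ne_top] at hle
  have hle' := ENNReal.toReal_mono (ENNReal.mul_ne_top ENNReal.ofReal_ne_top
    (shadowVolume_ne_top hΩ L hv)) hle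
  rw [ENNReal.toReal_mul, ENNReal.toReal_ofReal ht0.le, ht] at hle'
  rw [div_mul_eq_mul_div, div_le_iff₀ (by positivity)]
  rw [div_mul_eq_mul_div, le_div_iff₀ hn] at hle'
  linarith

end

/-! ### Projection bodies -/

section SublinearBody

variable {V : Type*} [NormedAddCommGroup V] [NormedSpace ℝ V] [FiniteDimensional ℝ V]
  {m : ℕ} [hV : Fact (finrank ℝ V = m + 1)]

/-- Hahn–Banach from the line ℝv. On negative multiples of v the bound follows from 0 = p(0) ≤ p(cv)
+ p(-cv). -/
theorem exists_le_sublinear_eq {p : V → ℝ} (hadd : ∀ v w, p (v + w) ≤ p v + p w)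
    (hsmul : ∀ c : ℝ, 0 < c → ∀ v, p (c • v) = c * p v) (v : V) :
    ∃ ξ : StrongDual ℝ V, (∀ w, ξ w ≤ p w) ∧ ξ v = p v := by
  have hp0 : p 0 = 0 := by
    have := hsmul 2 two_pos 0
    rw [smul_zero] at this
    linarith
  rcases eq_or_ne v 0 with rfl | hv
  · obtain ⟨g, -, hg⟩ := exists_extension_of_le_sublinear (⊥ : V →ₗ.[ℝ] ℝ) p hsmul hadd (by
      rintro ⟨x, hx⟩
      have hx0 : x = 0 := hx
      subst hx0
      have : (⊥ : V →ₗ.[ℝ] ℝ) ⟨0, hx⟩ = 0 := LinearPMap.map_zero _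
      rw [this, hp0])
    exact ⟨g.toContinuousLinearMap, hg, by rw [map_zero, hp0]⟩
  · obtain ⟨g, hgv, hg⟩ := exists_extension_of_le_sublinear
      (LinearPMap.mkSpanSingleton v (p v) hv) p hsmul hadd (by
        rintro ⟨x, hx⟩
        obtain ⟨c, rfl⟩ := Submodule.mem_span_singleton.1 hx
        rw [LinearPMap.mkSpanSingleton'_apply, RingHom.id_apply,
          smul_eq_mul]
        rcases lt_trichotomy c 0 with hc | rfl | hc
        · have h1 := hadd (c • v) ((-c) • v)
          rw [← add_smul, add_neg_cancel, zero_smul, hp0, hsmul _ (neg_pos.2 hc)] at h1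
          change c * p v ≤ p (c • v)
          linarith
        · change 0 * p v ≤ p ((0 : ℝ) • v)
          rw [zero_mul, zero_smul, hp0]
        · exact (hsmul c hc v).ge)
    refine ⟨g.toContinuousLinearMap, hg, ?_⟩
    have h1 := hgv ⟨v, Submodule.mem_span_singleton_self v⟩
    rw [LinearPMap.mkSpanSingleton_apply] at h1
    exact h1

theorem exists_convexBody_of_sublinear {p : V → ℝ} (hadd : ∀ v w, p (v + w) ≤ p v + p w)
    (hsmul : ∀ c : ℝ, 0 < c → ∀ v, p (c • v) = c * p v) {C : ℝ} (hC0 : 0 ≤ C)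
    (hC : ∀ v, p v ≤ C * ‖v‖) :
    ∃ Z : ConvexBody (StrongDual ℝ V), (Z : Set (StrongDual ℝ V)) = {ξ | ∀ v, ξ v ≤ p v} ∧
      ∀ v, supportFunction Z (doubleDualEquiv V (m := m) v) = p v := by
  have hconv : Convex ℝ {ξ : StrongDual ℝ V | ∀ v, ξ v ≤ p v} := by
    intro ξ hξ ζ hζ a b ha hb hab v
    have h1 := mul_le_mul_of_nonneg_left (hξ v) ha
    have h2 := mul_le_mul_of_nonneg_left (hζ v) hb
    simp only [add_apply, smul_apply, smul_eq_mul]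
    calc a * ξ v + b * ζ v ≤ a * p v + b * p v := add_le_add h1 h2
      _ = p v := by rw [← add_mul, hab, one_mul]
  have hclosed : IsClosed {ξ : StrongDual ℝ V | ∀ v, ξ v ≤ p v} := by
    have : {ξ : StrongDual ℝ V | ∀ v, ξ v ≤ p v} = ⋂ v, {ξ | ξ v ≤ p v} := by
      ext ξ
      simp
    rw [this]
    refine isClosed_iInter fun v => isClosed_le ?_ continuous_const
    fun_prop
  have hbdd : Bornology.IsBounded {ξ : StrongDual ℝ V | ∀ v, ξ v ≤ p v} := by
    refine (Metric.isBounded_closedBall (x := (0 : StrongDual ℝ V)) (r := C)).subset fun ξ hξ => ?_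
    rw [mem_closedBall_zero_iff]
    refine ContinuousLinearMap.opNorm_le_bound _ hC0 fun v => ?_
    rw [Real.norm_eq_abs, abs_le]
    have h1 := (hξ (-v)).trans (hC (-v))
    rw [map_neg, norm_neg] at h1
    exact ⟨by linarith, (hξ v).trans (hC v)⟩
  have hne : {ξ : StrongDual ℝ V | ∀ v, ξ v ≤ p v}.Nonempty := by
    obtain ⟨ξ, hξ, -⟩ := exists_le_sublinear_eq hadd hsmul 0
    exact ⟨ξ, hξ⟩
  refine ⟨⟨_, hconv, Metric.isCompact_of_isClosed_isBounded hclosed hbdd, hne⟩, rfl, fun v => ?_⟩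
  refine le_antisymm (supportFunction_le fun ξ hξ => hξ v) ?_
  obtain ⟨ξ, hξ, hv⟩ := exists_le_sublinear_eq hadd hsmul v
  rw [← hv]
  exact le_supportFunction _ (doubleDualEquiv V (m := m) v) (x := ξ) hξ

theorem dualForm_ne_zero {Ω : V [⋀^Fin (m + 1)]→ₗ[ℝ] ℝ} (hΩ : Ω ≠ 0) : dualForm Ω ≠ 0 := by
  intro h
  have h1 := dualForm_dualBasis Ω (finBasisOfFinrankEq ℝ V hV.out)
  rw [h] at h1
  exact (Ω.map_basis_ne_zero_iff _).2 hΩ (inv_eq_zero.1 h1.symm)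

end SublinearBody

section ProjectionBody

variable {V : Type*} [NormedAddCommGroup V] [NormedSpace ℝ V] [FiniteDimensional ℝ V]
  {m : ℕ} [hV : Fact (finrank ℝ V = m + 1)] [MeasurableSpace V] [BorelSpace V]
  {Ω : V [⋀^Fin (m + 1)]→ₗ[ℝ] ℝ}

/-- The segment [0, v + w] is contained in [0, v] + [0, w]. -/
theorem projectionSupport_add_le (hΩ : Ω ≠ 0) (L : ConvexBody V) (v w : V) :
    projectionSupport Ω L (v + w) ≤ projectionSupport Ω L v + projectionSupport Ω L w := by
  rw [projectionSupport, projectionSupport, projectionSupport, ← mul_add,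
    ← mixedVolumePair_add hΩ]
  refine mul_le_mul_of_nonneg_left (mixedVolumePair_mono hΩ L ?_) (by positivity)
  rintro _ ⟨a, b, ha, hb, hab, rfl⟩
  refine ⟨b • v, ⟨a, b, ha, hb, hab, by simp⟩, b • w, ⟨a, b, ha, hb, hab, by simp⟩, ?_⟩
  simp

theorem projectionSupport_smul (hΩ : Ω ≠ 0) (L : ConvexBody V) {c : ℝ} (hc : 0 ≤ c) (v : V) :
    projectionSupport Ω L (c • v) = c * projectionSupport Ω L v := by
  have : segmentBody (c • v) = c • segmentBody v := by
    refine ConvexBody.ext ?_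
    rw [ConvexBody.coe_smul]
    change segment ℝ 0 (c • v) = c • segment ℝ 0 v
    simp only [segment_eq_image, smul_zero, zero_add, ← Set.image_smul, Set.image_image]
    refine Set.image_congr fun θ _ => ?_
    rw [smul_smul, smul_smul, mul_comm]
  rw [projectionSupport, this, mixedVolumePair_smul hΩ L _ hc, projectionSupport]
  ring

theorem projectionSupport_zero (hΩ : Ω ≠ 0) (L : ConvexBody V) :
    projectionSupport Ω L 0 = 0 := by
  have := projectionSupport_smul hΩ L le_rfl 0
  rwa [zero_mul, smul_zero] at this

/-- [0, -u] is [0, u] translated by -u, and V₁ does not see translations of its last entry. -/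
theorem projectionSupport_neg (hΩ : Ω ≠ 0) (L : ConvexBody V) (v : V) :
    projectionSupport Ω L (-v) = projectionSupport Ω L v := by
  have key : ∀ u : V, projectionSupport Ω L (-u) ≤ projectionSupport Ω L u := by
    intro u
    have h1 : ((segmentBody (-u) : ConvexBody V) : Set V) ⊆
        (segmentBody u + pointBody (-u) : ConvexBody V) := by
      rintro _ ⟨a, b, ha, hb, hab, rfl⟩
      refine ⟨a • u, ⟨b, a, hb, ha, by linarith, by simp⟩, -u, rfl, ?_⟩
      have : b = 1 - a := by linarith
      subst this
      module
    have h2 := mixedVolumePair_mono hΩ L h1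
    rw [mixedVolumePair_add hΩ, mixedVolumePair_pointBody hΩ, add_zero] at h2
    exact mul_le_mul_of_nonneg_left h2 (by positivity)
  refine le_antisymm (key v) ?_
  have := key (-v)
  rwa [neg_neg] at this

theorem exists_projectionSupport_le (hΩ : Ω ≠ 0) (L : ConvexBody V) :
    ∃ C : ℝ, 0 ≤ C ∧ ∀ v, projectionSupport Ω L v ≤ C * ‖v‖ := by
  refine ⟨(m + 1) * mixedVolumePair Ω 1 L (unitBallBody V),
    mul_nonneg (by positivity) (mixedVolumePair_nonneg hΩ L _), fun v => ?_⟩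
  have h1 : ((segmentBody v : ConvexBody V) : Set V) ⊆
      (‖v‖ • unitBallBody V : ConvexBody V) := by
    rw [ConvexBody.coe_smul]
    change segment ℝ 0 v ⊆ ‖v‖ • Metric.closedBall (0 : V) 1
    rw [smul_closedBall _ _ zero_le_one, smul_zero, norm_norm, mul_one]
    exact (convex_closedBall 0 ‖v‖).segment_subset (Metric.mem_closedBall_self (norm_nonneg _))
      (by simp)
  have h2 := mixedVolumePair_mono hΩ L h1
  rw [mixedVolumePair_smul hΩ L _ (norm_nonneg v)] at h2
  rw [projectionSupport, mul_assoc, mul_comm _ ‖v‖]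
  exact mul_le_mul_of_nonneg_left h2 (by positivity)

theorem projectionBody_eq (hΩ : Ω ≠ 0) (L : ConvexBody V) :
    projectionBody Ω L = {ξ : StrongDual ℝ V | ∀ v, ξ v ≤ projectionSupport Ω L v} := by
  ext ξ
  refine ⟨fun h v => ?_, fun h v hv => ?_⟩
  · rcases eq_or_ne v 0 with rfl | hv
    · rw [map_zero, projectionSupport_zero hΩ]
    · rw [projectionSupport_eq_shadowVolume hΩ L hv]
      exact h v hv
  · rw [← projectionSupport_eq_shadowVolume hΩ L hv]
    exact h v

/-- The projection body is a convex body with the expected support function. -/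
theorem exists_projectionBody (hΩ : Ω ≠ 0) (L : ConvexBody V) :
    ∃ Z : ConvexBody (StrongDual ℝ V), (Z : Set (StrongDual ℝ V)) = projectionBody Ω L ∧
      ∀ v, supportFunction Z (doubleDualEquiv V (m := m) v) = projectionSupport Ω L v := by
  obtain ⟨C, hC0, hC⟩ := exists_projectionSupport_le hΩ L
  rw [projectionBody_eq hΩ]
  exact exists_convexBody_of_sublinear (projectionSupport_add_le hΩ L)
    (fun c hc v => projectionSupport_smul hΩ L hc.le v) hC0 hC

theorem interior_nonempty_of_forall_mul_norm_le {W : Type*} [NormedAddCommGroup W]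
    [NormedSpace ℝ W] {p : W → ℝ} {c : ℝ} (hc : 0 < c) (h : ∀ v, c * ‖v‖ ≤ p v) :
    (interior {ξ : StrongDual ℝ W | ∀ v, ξ v ≤ p v}).Nonempty := by
  refine ⟨0, mem_interior_iff_mem_nhds.2 (Filter.mem_of_superset (Metric.closedBall_mem_nhds 0 hc)
    fun ξ hξ v => ?_)⟩
  rw [mem_closedBall_zero_iff] at hξ
  calc ξ v ≤ ‖ξ v‖ := le_abs_self _
    _ ≤ ‖ξ‖ * ‖v‖ := ξ.le_opNorm v
    _ ≤ c * ‖v‖ := by gcongr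
    _ ≤ p v := h v

theorem interior_projectionBody_nonempty (hΩ : Ω ≠ 0) (L : ConvexBody V)
    (hL : (interior (L : Set V)).Nonempty) : (interior (projectionBody Ω L)).Nonempty := by
  obtain ⟨c, hc, h⟩ := exists_pos_mul_norm_le_projectionSupport hΩ L hL
  rw [projectionBody_eq hΩ]
  exact interior_nonempty_of_forall_mul_norm_le hc h

end ProjectionBody

/-! ### Projection bodies of bodies in the dual space -/

section DualProjectionBody

variable {V : Type*} [NormedAddCommGroup V] [NormedSpace ℝ V] [FiniteDimensional ℝ V]
  {m : ℕ} [hV : Fact (finrank ℝ V = m + 1)]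

/-- The projection body of a body in `V*`, as a body in `V`. -/
theorem exists_unitBall_supportFunction_eq
    {Ω' : (StrongDual ℝ V) [⋀^Fin (m + 1)]→ₗ[ℝ] ℝ} (hΩ' : Ω' ≠ 0) (M : ConvexBody (StrongDual ℝ V))
    (hM : (interior (M : Set (StrongDual ℝ V))).Nonempty) :
    ∃ B : ConvexBody V, IsUnitBall B ∧ ∀ ξ, supportFunction B ξ = projectionSupport Ω' M ξ := by
  obtain ⟨Z, hZ, hZs⟩ := exists_projectionBody hΩ' M
  rw [projectionBody_eq hΩ'] at hZ
  -- The projection body of M lives in the double dual and is carried back to V by the inverse of J;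
  -- it is symmetric since its support function is even.
  let J := doubleDualEquiv V (m := m)
  let B : ConvexBody V := ⟨J.symm '' Z, Z.convex.is_linear_image ⟨J.symm.map_add, J.symm.map_smul⟩,
    Z.isCompact.image J.symm.continuous, Z.nonempty.image _⟩
  have hB : (B : Set V) = J ⁻¹' (Z : Set _) := J.symm.toEquiv.image_eq_preimage_symm _
  refine ⟨B, ⟨fun x hx => ?_, ?_⟩, fun ξ => ?_⟩
  · rw [← SetLike.mem_coe, hB, Set.mem_preimage, hZ] at hx ⊢
    intro ξ
    have h1 := hx (-ξ)
    rw [projectionSupport_neg hΩ'] at h1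
    rw [map_neg] at h1
    exact (map_neg ξ x).trans_le h1
  · obtain ⟨c, hc, h⟩ := exists_pos_mul_norm_le_projectionSupport hΩ' M hM
    rw [hB, hZ]
    change (interior (J.toHomeomorph ⁻¹' _)).Nonempty
    rw [← J.toHomeomorph.preimage_interior]
    exact (interior_nonempty_of_forall_mul_norm_le hc h).preimage J.surjective
  · rw [← hZs ξ, supportFunction, supportFunction]
    congr 1
    change ξ '' (J.symm '' Z) = _
    rw [Set.image_image]
    refine Set.image_congr fun η _ => ?_
    conv_rhs => rw [← J.apply_symm_apply η]
    rfl

end DualProjectionBody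

/-! ### Ellipsoids -/

section Ellipsoid

/-- Uniqueness of Haar measure, with the constant read off from the unit cube. -/
theorem measure_image_euclideanSpace {Q : Type*} [NormedAddCommGroup Q] [NormedSpace ℝ Q]
    [FiniteDimensional ℝ Q] {k : ℕ} [hQ : Fact (finrank ℝ Q = k)] [MeasurableSpace Q]
    [BorelSpace Q] (η : Q [⋀^Fin k]→ₗ[ℝ] ℝ) (g : EuclideanSpace ℝ (Fin k) ≃L[ℝ] Q)
    (A : Set (EuclideanSpace ℝ (Fin k))) :
    η.measure (g '' A) =
      ENNReal.ofReal |η fun i => g (EuclideanSpace.basisFun (Fin k) ℝ i)| * volume A := by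
  have : ((volume : Measure (EuclideanSpace ℝ (Fin k))).map g).IsAddHaarMeasure :=
    g.isAddHaarMeasure_map _
  have h := Measure.isAddLeftInvariant_eq_smul η.measure
    ((volume : Measure (EuclideanSpace ℝ (Fin k))).map g)
  set κ := η.measure.addHaarScalarFactor ((volume : Measure (EuclideanSpace ℝ (Fin k))).map g)
  have h1 := η.measure_parallelepiped fun i => g (EuclideanSpace.basisFun (Fin k) ℝ i)
  have h2 : parallelepiped (fun i => g (EuclideanSpace.basisFun (Fin k) ℝ i)) =
      g '' parallelepiped (EuclideanSpace.basisFun (Fin k) ℝ) :=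
    (image_parallelepiped (g : EuclideanSpace ℝ (Fin k) →ₗ[ℝ] Q) _).symm
  rw [h, Measure.smul_apply, h2, map_equiv_apply_image, OrthonormalBasis.volume_parallelepiped] at h1
  rw [← h1, h, Measure.smul_apply, map_equiv_apply_image]
  simp [ENNReal.smul_def]

end Ellipsoid

section Ellipsoid

open scoped InnerProductSpace

variable {V : Type*} [NormedAddCommGroup V] [NormedSpace ℝ V] [FiniteDimensional ℝ V]
  {m : ℕ} [hV : Fact (finrank ℝ V = m + 1)]

omit [FiniteDimensional ℝ V] in
theorem IsEllipsoid.exists_equiv {E : ConvexBody V} (hE : IsEllipsoid E) :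
    ∃ (f : EuclideanSpace ℝ (Fin (m + 1)) ≃L[ℝ] V) (c : V),
      (E : Set V) = {c} + f '' Metric.closedBall 0 1 := by
  obtain ⟨f, c, h⟩ := hE
  revert f
  rw [hV.out]
  intro f h
  refine ⟨f.toContinuousLinearEquiv, c, ?_⟩
  rw [h, Set.singleton_add, Set.image_image]
  rfl

theorem exists_orthonormalBasis_eq_smul {u : EuclideanSpace ℝ (Fin (m + 1))} (hu : u ≠ 0) :
    ∃ b : OrthonormalBasis (Fin (m + 1)) ℝ (EuclideanSpace ℝ (Fin (m + 1))), u = ‖u‖ • b 0 := by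
  have hn : ‖u‖ ≠ 0 := norm_ne_zero_iff.2 hu
  obtain ⟨b, hb⟩ := Orthonormal.exists_orthonormalBasis_extension_of_card_eq (𝕜 := ℝ)
    (E := EuclideanSpace ℝ (Fin (m + 1))) (ι := Fin (m + 1)) (by simp)
    (v := fun _ => ‖u‖⁻¹ • u) (s := {0}) (by
      rw [orthonormal_iff_ite]
      rintro ⟨i, hi⟩ ⟨j, hj⟩
      rw [Set.mem_singleton_iff] at hi hj
      subst hi
      subst hj
      have h1 : ‖‖u‖⁻¹ • u‖ = 1 := by rw [norm_smul, norm_inv, norm_norm, inv_mul_cancel₀ hn]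
      simp [h1])
  refine ⟨b, ?_⟩
  rw [hb 0 rfl, smul_smul, mul_inv_cancel₀ hn, one_smul]

variable {Q : Type*} [NormedAddCommGroup Q] [NormedSpace ℝ Q] [FiniteDimensional ℝ Q]
  [hQ : Fact (finrank ℝ Q = m)] {π : V →ₗ[ℝ] Q} {s : Q →ₗ[ℝ] V} {v : V}

theorem exists_smul_eq_of_apply_eq_zero {m : ℕ} [Fact (finrank ℝ V = m + 1)]
    [Fact (finrank ℝ Q = m)] (hs : ∀ y, π (s y) = y) (hv : v ≠ 0) (hπ : π v = 0) {x : V}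
    (hx : π x = 0) : ∃ r : ℝ, x = r • v := by
  obtain ⟨⟨r, y⟩, rfl⟩ := (splitEquiv (m := m) π s hs hv hπ).surjective x
  rw [splitEquiv_apply, map_add, map_smul, hπ, hs, smul_zero, zero_add] at hx
  exact ⟨r, by rw [splitEquiv_apply, hx, map_zero, add_zero]⟩

/-- A Euclidean parametrization of the image of a ball under a projection. -/
theorem exists_image_closedBall_eq (hs : ∀ y, π (s y) = y) (hv : v ≠ 0) (hπ : π v = 0)
    (f : EuclideanSpace ℝ (Fin (m + 1)) ≃L[ℝ] V)
    (b : OrthonormalBasis (Fin (m + 1)) ℝ (EuclideanSpace ℝ (Fin (m + 1)))) {r : ℝ} (hr : r ≠ 0)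
    (hb : v = r • f (b 0)) :
    ∃ g : EuclideanSpace ℝ (Fin m) ≃L[ℝ] Q,
      (∀ i, g (EuclideanSpace.basisFun (Fin m) ℝ i) = π (f (b i.succ))) ∧
      π '' (f '' Metric.closedBall 0 1) = g '' Metric.closedBall 0 1 := by
  have hb0 : π (f (b 0)) = 0 := by
    rw [hb, map_smul] at hπ
    exact (smul_eq_zero.1 hπ).resolve_left hr
  -- ι is an isometry onto the orthogonal complement of b 0. Since π ∘ f kills b 0, the image of the
  -- whole ball is the image of the ball in that complement.
  let ι : EuclideanSpace ℝ (Fin m) →ₗ[ℝ] EuclideanSpace ℝ (Fin (m + 1)) :=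
    { toFun := fun y => ∑ i, y i • b i.succ
      map_add' := fun x y => by simp [add_smul, Finset.sum_add_distrib]
      map_smul' := fun c y => by simp [mul_smul, Finset.smul_sum] }
  have hι : ∀ y, ι y = ∑ i, y i • b i.succ := fun y => rfl
  have hrepr : ∀ y, ι y = b.repr.symm (WithLp.toLp 2 (Fin.cons 0 y : Fin (m + 1) → ℝ)) := by
    intro y
    rw [← b.sum_repr_symm, Fin.sum_univ_succ, hι]
    simp
  have hnorm : ∀ y, ‖ι y‖ = ‖y‖ := by
    intro y
    rw [hrepr, LinearIsometryEquiv.norm_map, EuclideanSpace.norm_eq, EuclideanSpace.norm_eq,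
      Fin.sum_univ_succ]
    simp
  have hinj : Function.Injective ((π ∘ₗ (f : EuclideanSpace ℝ (Fin (m + 1)) →ₗ[ℝ] V)) ∘ₗ ι) := by
    rw [← LinearMap.ker_eq_bot, LinearMap.ker_eq_bot']
    intro y hy
    obtain ⟨q, hq⟩ := exists_smul_eq_of_apply_eq_zero (m := m) hs hv hπ hy
    rw [hb] at hq
    have h1 : f (ι y) = f ((q * r) • b 0) := by rw [map_smul, mul_smul]; exact hq
    have h2 := f.injective h1
    ext i
    have h3 := congrArg (fun x => ⟪b i.succ, x⟫_ℝ) h2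
    simp only [hι, inner_sum, inner_smul_right, b.inner_eq_ite] at h3
    simpa [Fin.succ_inj] using h3
  let g := (LinearMap.linearEquivOfInjective _ hinj (by
    rw [finrank_euclideanSpace_fin, hQ.out])).toContinuousLinearEquiv
  have hg : ∀ y, g y = π (f (ι y)) := fun y => rfl
  refine ⟨g, fun i => ?_, ?_⟩
  · rw [hg, hι]
    congr 2
    simp
  · ext z
    simp only [Set.mem_image, mem_closedBall_zero_iff, exists_exists_and_eq_and]
    constructor
    · rintro ⟨x, hx, rfl⟩
      refine ⟨WithLp.toLp 2 fun i => b.repr x i.succ, ?_, ?_⟩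
      · refine le_trans ?_ hx
        rw [← b.repr.norm_map x, EuclideanSpace.norm_eq, EuclideanSpace.norm_eq]
        refine Real.sqrt_le_sqrt ?_
        rw [Fin.sum_univ_succ (fun i => ‖(b.repr x) i‖ ^ 2)]
        exact le_add_of_nonneg_left (sq_nonneg _)
      · rw [hg, hι]
        conv_rhs => rw [← b.sum_repr x, Fin.sum_univ_succ, map_add, map_add, map_smul, map_smul,
          hb0, smul_zero, zero_add]
    · rintro ⟨y, hy, rfl⟩
      exact ⟨ι y, (hnorm y).trans_le hy, rfl⟩

variable [MeasurableSpace V] [BorelSpace V]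

theorem abs_apply_orthonormalBasis (Ω : V [⋀^Fin (m + 1)]→ₗ[ℝ] ℝ)
    (f : EuclideanSpace ℝ (Fin (m + 1)) ≃L[ℝ] V)
    (b : OrthonormalBasis (Fin (m + 1)) ℝ (EuclideanSpace ℝ (Fin (m + 1)))) :
    |Ω fun i => f (b i)| = |Ω fun i => f (EuclideanSpace.basisFun (Fin (m + 1)) ℝ i)| := by
  have h1 := Ω.measure_parallelepiped fun i => f (b i)
  have h2 : parallelepiped (fun i => f (b i)) = f '' parallelepiped b :=
    (image_parallelepiped (f : EuclideanSpace ℝ (Fin (m + 1)) →ₗ[ℝ] V) _).symm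
  rw [h2, measure_image_euclideanSpace, OrthonormalBasis.volume_parallelepiped, mul_one] at h1
  exact ((ENNReal.ofReal_eq_ofReal_iff (abs_nonneg _) (abs_nonneg _)).1 h1).symm

variable [MeasurableSpace Q] [BorelSpace Q] {Ω : V [⋀^Fin (m + 1)]→ₗ[ℝ] ℝ}
  {η : Q [⋀^Fin m]→ₗ[ℝ] ℝ}

/-- Take an orthonormal basis whose first vector points along f⁻¹v. The shadow is then a linear
image of an m-dimensional ball, with volume factor |Ω(v, f b₁, …, f b_m)|, and v = ‖f⁻¹v‖ f(b₀). -/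
theorem measure_image_ellipsoid (hs : ∀ y, π (s y) = y) (hv : v ≠ 0) (hπ : π v = 0)
    (hη : ∀ w : Fin m → V, η (fun i => π (w i)) = Ω (Fin.cons v w))
    (f : EuclideanSpace ℝ (Fin (m + 1)) ≃L[ℝ] V) (c : V) :
    η.measure (π '' ({c} + f '' Metric.closedBall 0 1)) =
      ENNReal.ofReal (|Ω fun i => f (EuclideanSpace.basisFun (Fin (m + 1)) ℝ i)| * ‖f.symm v‖) *
        ballVolume m := by
  have hu : f.symm v ≠ 0 := by simpa using hv
  obtain ⟨b, hb⟩ := exists_orthonormalBasis_eq_smul hu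
  have hvb : v = ‖f.symm v‖ • f (b 0) := by rw [← map_smul, ← hb, f.apply_symm_apply]
  obtain ⟨g, hg, himage⟩ := exists_image_closedBall_eq hs hv hπ f b (norm_ne_zero_iff.2 hu) hvb
  rw [Set.image_add, Set.image_singleton, Set.singleton_add, Set.image_add_left,
    measure_preimage_add, himage, measure_image_euclideanSpace, ballVolume]
  congr 2
  simp only [hg]
  rw [hη]
  have h1 : (Fin.cons v fun i : Fin m => f (b i.succ) : Fin (m + 1) → V) =
      Function.update (fun i => f (b i)) 0 (‖f.symm v‖ • f (b 0)) := by
    ext i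
    refine Fin.cases ?_ (fun j => ?_) i
    · simpa using hvb
    · simp
  rw [h1, Ω.map_update_smul, Function.update_eq_self, smul_eq_mul, abs_mul, abs_norm,
    abs_apply_orthonormalBasis, mul_comm]

theorem shadowVolume_ellipsoid (f : EuclideanSpace ℝ (Fin (m + 1)) ≃L[ℝ] V) (c : V)
    (hv : v ≠ 0) :
    shadowVolume Ω ({c} + f '' Metric.closedBall 0 1) v hv =
      ENNReal.ofReal (|Ω fun i => f (EuclideanSpace.basisFun (Fin (m + 1)) ℝ i)| * ‖f.symm v‖) *
        ballVolume m := by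
  unfold shadowVolume
  let : MeasurableSpace (V ⧸ Submodule.span ℝ {v}) := borel _
  have : BorelSpace (V ⧸ Submodule.span ℝ {v}) := ⟨rfl⟩
  have : IsClosed ((Submodule.span ℝ {v} : Submodule ℝ V) : Set V) :=
    Submodule.closed_of_finiteDimensional _
  have : Fact (finrank ℝ (V ⧸ Submodule.span ℝ {v}) = m) := ⟨by
    have h1 := (Submodule.span ℝ {v}).finrank_quotient_add_finrank
    rw [finrank_span_singleton hv, hV.out] at h1
    omega⟩
  exact measure_image_ellipsoid (mkQ_quotSection v) hv
    ((Submodule.Quotient.mk_eq_zero _).2 (Submodule.mem_span_singleton_self v))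
    (contraction_mkQ Ω v) f c

end Ellipsoid

/-! ### Volumes and projection bodies of ellipsoids -/

section EllipsoidProjection

open scoped InnerProductSpace

variable {V : Type*} [NormedAddCommGroup V] [NormedSpace ℝ V] [FiniteDimensional ℝ V]
  {m : ℕ} [hV : Fact (finrank ℝ V = m + 1)]

theorem ballVolume_ne_top (k : ℕ) : ballVolume k ≠ ∞ :=
  (isCompact_closedBall (0 : EuclideanSpace ℝ (Fin k)) 1).measure_lt_top.ne

theorem ballVolume_ne_zero (k : ℕ) : ballVolume k ≠ 0 :=
  (Metric.measure_closedBall_pos volume (0 : EuclideanSpace ℝ (Fin k)) one_pos).ne'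

theorem ballVolume_toReal_pos (k : ℕ) : 0 < (ballVolume k).toReal :=
  ENNReal.toReal_pos (ballVolume_ne_zero k) (ballVolume_ne_top k)

/-- The image of the standard basis under a linear parametrization by Euclidean space. -/
def euclideanBasis (f : EuclideanSpace ℝ (Fin (m + 1)) ≃L[ℝ] V) : Basis (Fin (m + 1)) ℝ V :=
  (EuclideanSpace.basisFun (Fin (m + 1)) ℝ).toBasis.map f.toLinearEquiv

omit [FiniteDimensional ℝ V] hV in
theorem euclideanBasis_apply (f : EuclideanSpace ℝ (Fin (m + 1)) ≃L[ℝ] V) (i : Fin (m + 1)) :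
    euclideanBasis f i = f (EuclideanSpace.basisFun (Fin (m + 1)) ℝ i) := by
  simp [euclideanBasis]

/-- The parametrization of the dual space by Euclidean space dual to `f`. -/
def dualEuclideanEquiv (f : EuclideanSpace ℝ (Fin (m + 1)) ≃L[ℝ] V) :
    EuclideanSpace ℝ (Fin (m + 1)) ≃L[ℝ] StrongDual ℝ V :=
  ((EuclideanSpace.basisFun (Fin (m + 1)) ℝ).toBasis.equiv (dualBasis (euclideanBasis f))
    (Equiv.refl _)).toContinuousLinearEquiv

omit hV in
theorem dualEuclideanEquiv_basisFun (f : EuclideanSpace ℝ (Fin (m + 1)) ≃L[ℝ] V)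
    (i : Fin (m + 1)) : dualEuclideanEquiv f (EuclideanSpace.basisFun (Fin (m + 1)) ℝ i) =
      dualBasis (euclideanBasis f) i := by
  have h := (EuclideanSpace.basisFun (Fin (m + 1)) ℝ).toBasis.equiv_apply i
    (dualBasis (euclideanBasis f)) (Equiv.refl _)
  rw [OrthonormalBasis.coe_toBasis] at h
  exact h

omit hV in
-- The dual parametrization is the inverse transpose of f, so it turns Euclidean balls into sets
-- with support function proportional to ‖f⁻¹v‖.
theorem dualEuclideanEquiv_apply (f : EuclideanSpace ℝ (Fin (m + 1)) ≃L[ℝ] V)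
    (y : EuclideanSpace ℝ (Fin (m + 1))) (v : V) :
    dualEuclideanEquiv f y v = ⟪y, f.symm v⟫_ℝ := by
  have hy := (EuclideanSpace.basisFun (Fin (m + 1)) ℝ).sum_repr y
  conv_lhs => rw [← hy, map_sum]
  conv_rhs => rw [← hy, sum_inner]
  rw [_root_.sum_apply]
  refine Finset.sum_congr rfl fun i _ => ?_
  rw [map_smul, dualEuclideanEquiv_basisFun, _root_.smul_apply, dualBasis_apply,
    inner_smul_left]
  simp [euclideanBasis, EuclideanSpace.inner_single_left]

variable {Ω : V [⋀^Fin (m + 1)]→ₗ[ℝ] ℝ}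

omit [FiniteDimensional ℝ V] hV in
theorem abs_apply_basisFun_pos (hΩ : Ω ≠ 0) (f : EuclideanSpace ℝ (Fin (m + 1)) ≃L[ℝ] V) :
    0 < |Ω fun i => f (EuclideanSpace.basisFun (Fin (m + 1)) ℝ i)| := by
  refine abs_pos.2 fun h => hΩ ?_
  have h1 := Ω.eq_smul_basis_det (euclideanBasis f)
  have h2 : Ω (euclideanBasis f) = 0 := by
    rw [← h]
    exact congrArg Ω (funext (euclideanBasis_apply f))
  rw [h1, h2, zero_smul]

variable [MeasurableSpace V] [BorelSpace V]

/-- The projection body of an ellipsoid is an ellipsoid. -/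
theorem projectionBody_ellipsoid (hΩ : Ω ≠ 0) (f : EuclideanSpace ℝ (Fin (m + 1)) ≃L[ℝ] V) (c : V) :
    projectionBody Ω ({c} + f '' Metric.closedBall 0 1) =
      dualEuclideanEquiv f '' Metric.closedBall 0
        (|Ω fun i => f (EuclideanSpace.basisFun (Fin (m + 1)) ℝ i)| * (ballVolume m).toReal) := by
  set ρ := |Ω fun i => f (EuclideanSpace.basisFun (Fin (m + 1)) ℝ i)| * (ballVolume m).toReal
  have hρ : 0 < ρ := mul_pos (abs_apply_basisFun_pos hΩ f) (ballVolume_toReal_pos m)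
  have hsh : ∀ (v : V) (hv : v ≠ 0),
      (shadowVolume Ω ({c} + f '' Metric.closedBall 0 1) v hv).toReal = ρ * ‖f.symm v‖ := by
    intro v hv
    rw [shadowVolume_ellipsoid, ENNReal.toReal_mul, ENNReal.toReal_ofReal (by positivity)]
    ring
  ext ξ
  obtain ⟨y, rfl⟩ := (dualEuclideanEquiv f).surjective ξ
  rw [(dualEuclideanEquiv f).injective.mem_set_image, mem_closedBall_zero_iff, projectionBody,
    Set.mem_ofPred_eq]
  simp only [hsh, dualEuclideanEquiv_apply]
  constructor
  · intro h
    rcases eq_or_ne y 0 with rfl | hy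
    · simpa using hρ.le
    -- Testing at v = f y is the equality case of Cauchy–Schwarz.
    have h1 := h (f y) (by simpa using hy)
    rw [f.symm_apply_apply, real_inner_self_eq_norm_mul_norm] at h1
    exact le_of_mul_le_mul_right h1 (norm_pos_iff.2 hy)
  · intro h v _
    exact (real_inner_le_norm _ _).trans (mul_le_mul_of_nonneg_right h (norm_nonneg _))

theorem measure_ellipsoid (f : EuclideanSpace ℝ (Fin (m + 1)) ≃L[ℝ] V) (c : V) :
    Ω.measure ({c} + f '' Metric.closedBall 0 1) =
      ENNReal.ofReal |Ω fun i => f (EuclideanSpace.basisFun (Fin (m + 1)) ℝ i)| *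
        ballVolume (m + 1) := by
  rw [Set.singleton_add, Set.image_add_left, measure_preimage_add, measure_image_euclideanSpace,
    ballVolume]

/-- With δ = |Ω(f e)|, the radius δω_m contributes (δω_m)^(m+1) and the dual form contributes δ⁻¹.
The remaining δ^m is what cancels against vol(E)^(1-n). -/
theorem measure_projectionBody_ellipsoid (hΩ : Ω ≠ 0)
    (f : EuclideanSpace ℝ (Fin (m + 1)) ≃L[ℝ] V) (c : V) :
    ((dualForm Ω).measure (projectionBody Ω ({c} + f '' Metric.closedBall 0 1))).toReal =
      |Ω fun i => f (EuclideanSpace.basisFun (Fin (m + 1)) ℝ i)| ^ m *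
        (ballVolume m).toReal ^ (m + 1) * (ballVolume (m + 1)).toReal := by
  have hδ := abs_apply_basisFun_pos hΩ f
  have h1 : (fun i => f (EuclideanSpace.basisFun (Fin (m + 1)) ℝ i)) = euclideanBasis f :=
    funext fun i => (euclideanBasis_apply f i).symm
  rw [projectionBody_ellipsoid hΩ, measure_image_euclideanSpace]
  simp only [dualEuclideanEquiv_basisFun]
  rw [h1] at hδ ⊢
  have h2 := dualForm_dualBasis Ω (euclideanBasis f)
  have h3 := (ballVolume_toReal_pos m).le
  rw [h2, Measure.addHaar_closedBall' _ _ (by positivity), finrank_euclideanSpace_fin,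
    ENNReal.toReal_mul, ENNReal.toReal_mul, ENNReal.toReal_ofReal (abs_nonneg _),
    ENNReal.toReal_ofReal (by positivity), abs_inv, ← ballVolume]
  field_simp
  ring

/-- The common value of `vol (Π E) vol (E) ^ (1 - n)` for all ellipsoids `E`. -/
theorem IsEllipsoid.measure_mul_zpow (hΩ : Ω ≠ 0) {E : ConvexBody V} (hE : IsEllipsoid E) :
    (dualForm Ω).measure (projectionBody Ω E) * Ω.measure (E : Set V) ^ (1 - ((m + 1 : ℕ) : ℤ)) =
      ENNReal.ofReal
        ((ballVolume m).toReal ^ (m + 1) * (ballVolume (m + 1)).toReal /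
          (ballVolume (m + 1)).toReal ^ m) := by
  obtain ⟨f, c, h⟩ := hE.exists_equiv (m := m)
  have hδ := abs_apply_basisFun_pos hΩ f
  have ha := ballVolume_toReal_pos (m + 1)
  obtain ⟨Z, hZ, -⟩ := exists_projectionBody hΩ E
  have := isAddHaarMeasure_measure hΩ
  have := isAddHaarMeasure_measure (dualForm_ne_zero hΩ)
  have hfin : (dualForm Ω).measure (projectionBody Ω E) ≠ ∞ := by
    rw [← hZ]; exact Z.isCompact.measure_lt_top.ne
  have hexp : (1 - ((m + 1 : ℕ) : ℤ)) = -(m : ℤ) := by push_cast; ring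
  rw [hexp, ENNReal.zpow_neg, zpow_natCast, ← ENNReal.ofReal_toReal hfin, h,
    measure_projectionBody_ellipsoid hΩ, measure_ellipsoid,
    ← ENNReal.ofReal_toReal (ballVolume_ne_top (m + 1)), ← ENNReal.ofReal_mul hδ.le,
    ← ENNReal.ofReal_pow (by positivity), ← ENNReal.ofReal_inv_of_pos (by positivity),
    ← ENNReal.ofReal_mul (by positivity), ENNReal.toReal_ofReal ha.le]
  congr 1
  field_simp
  ring

omit [MeasurableSpace V] [BorelSpace V] in
-- Ensures that the quantifier over ellipsoids in Petty's inequality is not vacuous.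
theorem exists_isEllipsoid : ∃ E : ConvexBody V, IsEllipsoid E := by
  have h : finrank ℝ (EuclideanSpace ℝ (Fin (finrank ℝ V))) = finrank ℝ V := by simp
  let f := LinearEquiv.ofFinrankEq _ _ h
  refine ⟨⟨f '' Metric.closedBall 0 1, ?_, ?_, ?_⟩, f, 0, ?_⟩
  · exact (convex_closedBall _ _).is_linear_image f.toLinearMap.isLinear
  · exact (isCompact_closedBall _ _).image f.toContinuousLinearEquiv.continuous
  · exact (Metric.nonempty_closedBall.2 zero_le_one).image _
  · simp

end EllipsoidProjection

/-! ### Petty's inequality and the invariant `𝒱` -/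

section Petty

variable {V : Type*} [NormedAddCommGroup V] [NormedSpace ℝ V] [FiniteDimensional ℝ V]
  {m : ℕ} [hV : Fact (finrank ℝ V = m + 1)] [MeasurableSpace V] [BorelSpace V]
  {Ω : V [⋀^Fin (m + 1)]→ₗ[ℝ] ℝ}

theorem measure_ne_top (hΩ : Ω ≠ 0) (K : ConvexBody V) : Ω.measure (K : Set V) ≠ ∞ :=
  have := isAddHaarMeasure_measure hΩ
  K.isCompact.measure_lt_top.ne

theorem measure_toReal_pos (hΩ : Ω ≠ 0) {K : ConvexBody V} (hK : (interior (K : Set V)).Nonempty) :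
    0 < (Ω.measure (K : Set V)).toReal :=
  have := isAddHaarMeasure_measure hΩ
  ENNReal.toReal_pos (Measure.measure_pos_of_nonempty_interior _ hK).ne' (measure_ne_top hΩ K)

theorem measure_projectionBody_ne_top (hΩ : Ω ≠ 0) (K : ConvexBody V) :
    (dualForm Ω).measure (projectionBody Ω K) ≠ ∞ := by
  obtain ⟨Z, hZ, -⟩ := exists_projectionBody hΩ K
  rw [← hZ]
  exact measure_ne_top (dualForm_ne_zero hΩ) Z

variable (m) in
/-- The value of `vol (Π E) vol (E) ^ (1 - n)` for an ellipsoid `E`, `n = m + 1`. -/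
def ellipsoidValue : ℝ :=
  (ballVolume m).toReal ^ (m + 1) * (ballVolume (m + 1)).toReal / (ballVolume (m + 1)).toReal ^ m

/-- The ellipsoid side is the constant `ellipsoidValue m`; positivity and finiteness of the volumes
allow passing from extended to real numbers. -/
theorem pettyProjectionInequality_iff (hΩ : Ω ≠ 0) :
    PettyProjectionInequality Ω ↔ ∀ K : ConvexBody V, (interior (K : Set V)).Nonempty →
      ellipsoidValue m * (Ω.measure (K : Set V)).toReal ^ m ≤
        ((dualForm Ω).measure (projectionBody Ω K)).toReal := by
  have key : ∀ K E : ConvexBody V, (interior (K : Set V)).Nonempty → IsEllipsoid E →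
      ((dualForm Ω).measure (projectionBody Ω E) *
          Ω.measure (E : Set V) ^ (1 - ((m + 1 : ℕ) : ℤ)) ≤
        (dualForm Ω).measure (projectionBody Ω K) *
          Ω.measure (K : Set V) ^ (1 - ((m + 1 : ℕ) : ℤ)) ↔
      ellipsoidValue m * (Ω.measure (K : Set V)).toReal ^ m ≤
        ((dualForm Ω).measure (projectionBody Ω K)).toReal) := by
    intro K E hK hE
    have hpos := measure_toReal_pos hΩ hK
    have hexp : (1 - ((m + 1 : ℕ) : ℤ)) = -(m : ℤ) := by push_cast; ring
    rw [hE.measure_mul_zpow hΩ, hexp, ENNReal.zpow_neg, zpow_natCast,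
      ← ENNReal.ofReal_toReal (measure_projectionBody_ne_top hΩ K),
      ← ENNReal.ofReal_toReal (measure_ne_top hΩ K), ← ENNReal.ofReal_pow hpos.le,
      ← ENNReal.ofReal_inv_of_pos (by positivity), ← ENNReal.ofReal_mul (by positivity),
      ENNReal.ofReal_le_ofReal_iff (by positivity), ← div_eq_mul_inv, le_div_iff₀ (by positivity),
      ENNReal.toReal_ofReal hpos.le, ENNReal.toReal_ofReal ENNReal.toReal_nonneg, ellipsoidValue]
  constructor
  · intro h K hK
    obtain ⟨E, hE⟩ := exists_isEllipsoid (V := V)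
    exact (key K E hK hE).1 (h K E hK hE)
  · intro h K E hK hE
    exact (key K E hK hE).2 (h K hK)

theorem symplecticVolume_prod (hΩ : Ω ≠ 0) (B : Set V) (A : Set (StrongDual ℝ V)) :
    symplecticVolume Ω (B ×ˢ A) = Ω.measure B * (dualForm Ω).measure A := by
  have := isAddHaarMeasure_measure hΩ
  have := isAddHaarMeasure_measure (dualForm_ne_zero hΩ)
  exact Measure.prod_prod _ _

/-- The normalising constant ω_n^m / ω_m^(m+1) times `ellipsoidValue m` is ω_n, so it can be
cancelled. -/
theorem busemannInvariant_le_volumeInvariant_iff (hΩ : Ω ≠ 0) (B : ConvexBody V) :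
    busemannInvariant B ≤ volumeInvariant Ω B ↔
      ENNReal.ofReal (ellipsoidValue m) ≤
        ⨆ (L : ConvexBody V) (_ : mixedVolumePair Ω 1 L B = 1), ENNReal.ofReal
          ((Ω.measure (B : Set V)).toReal *
            ((dualForm Ω).measure (projectionBody Ω L)).toReal) := by
  have hS : (⨆ (L : ConvexBody V) (_ : mixedVolumePair Ω 1 L B = 1),
      symplecticVolume Ω ((B : Set V) ×ˢ projectionBody Ω L)) =
      ⨆ (L : ConvexBody V) (_ : mixedVolumePair Ω 1 L B = 1), ENNReal.ofReal
          ((Ω.measure (B : Set V)).toReal *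
            ((dualForm Ω).measure (projectionBody Ω L)).toReal) := by
    refine iSup_congr fun L => iSup_congr fun _ => ?_
    rw [symplecticVolume_prod hΩ, ENNReal.ofReal_mul ENNReal.toReal_nonneg,
      ENNReal.ofReal_toReal (measure_ne_top hΩ B),
      ENNReal.ofReal_toReal (measure_projectionBody_ne_top hΩ L)]
  have ha := ballVolume_toReal_pos (m + 1)
  have hw := ballVolume_toReal_pos m
  have hκ : ballVolume (m + 1) ^ m / ballVolume m ^ (m + 1) = ENNReal.ofReal
      ((ballVolume (m + 1)).toReal ^ m / (ballVolume m).toReal ^ (m + 1)) := by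
    rw [ENNReal.ofReal_div_of_pos (by positivity), ENNReal.ofReal_pow ha.le,
      ENNReal.ofReal_pow hw.le, ENNReal.ofReal_toReal (ballVolume_ne_top _),
      ENNReal.ofReal_toReal (ballVolume_ne_top _)]
  have hκ' : 0 < (ballVolume (m + 1)).toReal ^ m / (ballVolume m).toReal ^ (m + 1) := by positivity
  have hB : ballVolume (m + 1) = ENNReal.ofReal
      ((ballVolume (m + 1)).toReal ^ m / (ballVolume m).toReal ^ (m + 1)) *
        ENNReal.ofReal (ellipsoidValue m) := by
    rw [← ENNReal.ofReal_mul hκ'.le, ellipsoidValue]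
    conv_lhs => rw [← ENNReal.ofReal_toReal (ballVolume_ne_top (m + 1))]
    congr 1
    field_simp
  rw [volumeInvariant, busemannInvariant, hV.out, hS, hκ]
  refine (iff_of_eq (congrArg (· ≤ _) hB)).trans ?_
  exact ENNReal.mul_le_mul_iff_right (ENNReal.ofReal_pos.2 hκ').ne' ENNReal.ofReal_ne_top

/-- The competitor is L = cB with c^m = 1/vol(B). Then V₁(L, B) = c^m vol(B) = 1 and vol(L) = c, so
Petty's inequality for L reads vol(B) vol*(ΠL) ≥ `ellipsoidValue m`. -/
theorem busemannInvariant_le_of_pettyProjectionInequality (hm : 1 ≤ m) (hΩ : Ω ≠ 0)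
    (h : PettyProjectionInequality Ω) {B : ConvexBody V} (hB : IsUnitBall B) :
    busemannInvariant B ≤ volumeInvariant Ω B := by
  rw [pettyProjectionInequality_iff hΩ] at h
  rw [busemannInvariant_le_volumeInvariant_iff hΩ]
  have hpos := measure_toReal_pos hΩ hB.2
  set β := (Ω.measure (B : Set V)).toReal with hβ
  obtain ⟨c, hc, hcβ⟩ : ∃ c : ℝ, 0 < c ∧ c ^ m = β⁻¹ :=
    ⟨β⁻¹ ^ ((m : ℝ)⁻¹), by positivity, Real.rpow_inv_natCast_pow (by positivity) (by omega)⟩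
  have hvol : (Ω.measure ((c • B : ConvexBody V) : Set V)).toReal = c := by
    rw [ConvexBody.coe_smul, measure_smul_toReal B hc.le hΩ, ← hβ, pow_succ, hcβ]
    field_simp
  have hone : mixedVolumePair Ω 1 (c • B : ConvexBody V) B = 1 := by
    rw [mixedVolumePair_smul_left hΩ B B hc, mixedVolumePair_self hΩ, hcβ, ← hβ,
      inv_mul_cancel₀ hpos.ne']
  refine le_iSup₂_of_le (c • B) hone (ENNReal.ofReal_le_ofReal ?_)
  have hint : (interior ((c • B : ConvexBody V) : Set V)).Nonempty := by
    rw [ConvexBody.coe_smul, interior_smul₀ hc.ne']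
    exact hB.2.smul_set
  have h1 := h (c • B) hint
  rw [hvol, hcβ, ← div_eq_mul_inv, div_le_iff₀ hpos] at h1
  linarith

/-- The hypothesis is applied to B = Π(ΠK), for which the symmetry of V₁ turns the constraint V₁(L,
B) = 1 into V₁(ΠK, ΠL) = 1. -/
theorem pettyProjectionInequality_of_busemannInvariant_le (hm : 1 ≤ m) (hΩ : Ω ≠ 0)
    (h : ∀ B : ConvexBody V, IsUnitBall B → busemannInvariant B ≤ volumeInvariant Ω B) :
    PettyProjectionInequality Ω := by
  rw [pettyProjectionInequality_iff hΩ]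
  intro K hK
  have hΩ' := dualForm_ne_zero hΩ
  obtain ⟨M, hM, hMK⟩ := exists_projectionBody hΩ K
  have hMint : (interior (M : Set (StrongDual ℝ V))).Nonempty := by
    rw [hM]
    exact interior_projectionBody_nonempty hΩ K hK
  obtain ⟨B, hB, hBM⟩ := exists_unitBall_supportFunction_eq hΩ' M hMint
  have hk := measure_toReal_pos hΩ' hMint
  have hb := measure_toReal_pos hΩ hB.2
  have hKpos := measure_toReal_pos hΩ hK
  -- Minkowski's inequality in V*, for M = ΠK and ΠL. It bounds the supremum defining 𝒱(B) from
  -- above by a multiple of vol(B)/k^m, where k = vol*(M).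
  have hdual : ∀ L : ConvexBody V, ((dualForm Ω).measure (M : Set _)).toReal ^ m *
      ((dualForm Ω).measure (projectionBody Ω L)).toReal ≤
        mixedVolumePair Ω 1 L B ^ (m + 1) := by
    intro L
    obtain ⟨Z, hZ, hZL⟩ := exists_projectionBody hΩ L
    rw [← hZ, mixedVolumePair_projection_symm hΩ hΩ' L B M Z hBM hZL]
    exact measure_pow_mul_measure_le_mixedVolumePair_pow hΩ' hm M Z
  have hself : mixedVolumePair Ω 1 K B = ((dualForm Ω).measure (M : Set _)).toReal := by
    rw [mixedVolumePair_projection_symm hΩ hΩ' K B M M hBM hMK, mixedVolumePair_self hΩ']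
  -- The second use of Minkowski's inequality is in V: since V₁(K, B) = k, it bounds vol(B) above by
  -- k^(m+1) / vol(K)^m.
  have hle := measure_pow_mul_measure_le_mixedVolumePair_pow hΩ hm K B
  rw [hself] at hle
  rw [← hM]
  set k := ((dualForm Ω).measure (M : Set (StrongDual ℝ V))).toReal
  have h1 := (busemannInvariant_le_volumeInvariant_iff hΩ B).1 (h B hB)
  have h2 : ENNReal.ofReal (ellipsoidValue m) ≤
      ENNReal.ofReal ((Ω.measure (B : Set V)).toReal / k ^ m) := by
    refine h1.trans (iSup₂_le fun L hL => ENNReal.ofReal_le_ofReal ?_)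
    have h3 := hdual L
    rw [hL, one_pow] at h3
    rw [le_div_iff₀ (by positivity), mul_assoc]
    exact mul_le_of_le_one_right hb.le (by linarith)
  rw [ENNReal.ofReal_le_ofReal_iff (by positivity), le_div_iff₀ (by positivity)] at h2
  have hkm : 0 < k ^ m := by positivity
  refine le_of_mul_le_mul_right ?_ hkm
  calc ellipsoidValue m * (Ω.measure (K : Set V)).toReal ^ m * k ^ m
      = (Ω.measure (K : Set V)).toReal ^ m * (ellipsoidValue m * k ^ m) := by ring
    _ ≤ (Ω.measure (K : Set V)).toReal ^ m * (Ω.measure (B : Set V)).toReal := by gcongr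
    _ ≤ k ^ (m + 1) := hle
    _ = k * k ^ m := by ring

end Petty

end ConvexVolume

end

theorem mainTheorem4 {V : Type*} [NormedAddCommGroup V] [NormedSpace ℝ V]
    [FiniteDimensional ℝ V] [MeasurableSpace V] [BorelSpace V]
    {m : ℕ} (hm : 1 ≤ m) [Fact (Module.finrank ℝ V = m + 1)]
    (Ω : V [⋀^Fin (m + 1)]→ₗ[ℝ] ℝ) (hΩ : Ω ≠ 0) :
    (∀ B : ConvexBody V, ConvexVolume.IsUnitBall B →
        ConvexVolume.busemannInvariant B ≤ ConvexVolume.volumeInvariant Ω B) ↔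
      ConvexVolume.PettyProjectionInequality Ω := by
  exact ⟨ConvexVolume.pettyProjectionInequality_of_busemannInvariant_le hm hΩ,
    fun h _ hB => ConvexVolume.busemannInvariant_le_of_pettyProjectionInequality hm hΩ h hB⟩
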